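/- Let $\rho>0$ and consider on $\mathbb R^2\ni(q,p)$ the map $\Phi_\rho:(q,p)\mapsto(\bar q,\bar p)$, $$\bar p=p+2\log\frac{1+\rho e^{q}}{\rho+e^{q}},\qquad \bar q=q+2\log\frac{\rho+e^{\bar p}}{1+\rho e^{\bar p}} .$$ **(1) Reduction, canonicity, generating function.** $\Phi_\rho$ is the period-2 reduction of the lattice MKdV map: for 2-periodic sequences with $X_1+X_2=0$, $Y_0+Y_1=0$ (and likewise for $\overline X,\overline Y$), the reduced MKdV equations $$\overline X_j=X_j+\log\frac{(\rho+e^{Y_{j-1}})(1+\rho e^{Y_j})}{(\rho+e^{Y_j})(1+\rho e^{Y_{j-1}})},\qquad \overline Y_j=Y_j+\log\frac{(\rho+e^{\overline X_j})(1+\rho e^{\overline X_{j+1}})}{(\rho+e^{\overline X_{j+1}})(1+\rho e^{\overline X_j})}\qquad(j\in\mathbb Z)$$ are equivalent to $\Phi_\rho(q,p)=(\bar q,\bar p)$ with $p=X_1$, $q=Y_1$, $\bar p=\overline X_1$, $\bar q=\overline Y_1$. The map $\Phi_\rho$ is a smooth bijection with $d\bar q\wedge d\bar p=dq\wedge dp$,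 and it is equivalent to $\bar p-p=-\partial H/\partial q$, $\bar q-q=\partial H/\partial\bar p$ for the smooth generating function $$H(q,\bar p)=U_\rho(\bar p)+U_\rho(q),\qquad U_\rho(x)=2\int_0^x\log\frac{\rho+e^\xi}{1+\rho e^\xi}\,d\xi ,$$ where, with $\mathrm{Li}_2(x)=-\int_0^x\frac{\log(1-t)}t\,dt$, $$U_\rho(x)=2\Big[x\log\rho-\mathrm{Li}_2(-e^x/\rho)+\mathrm{Li}_2(-\rho e^x)+\mathrm{Li}_2(-1/\rho)-\mathrm{Li}_2(-\rho)\Big].$$ **(2) Invariant.** $\Phi_\rho$ preserves $$\mathcal I_\rho(q,p)=e^{p-q}+e^{q-p}+2\rho\,(e^{p}+e^{q}+e^{-p}+e^{-q})+\rho^2(e^{p+q}+e^{-(p+q)}).$$ **(3) Closed form of the modified Hamiltonian.** Let $D_\rho$ be the set of $P$ with $P>2\rho^2+8\rho+2$ and $P-4\rho>(1+\rho)^2(\rho+\rho^{-1}-4)$. If $\rho+\rho^{-1}\le 6$ then $\mathcal I_\rho(q,p)\in D_\rho$ for all $(q,p)\neq(0,0)$. For $P\in D_\rho$ put $$\Delta=\frac{P-4\rho-\sqrt{(2\rho^2+P+2)(P-2\rho^2-8\rho-2)}}{2(1+\rho)^2},\qquad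 R_{\rho,P}(q)=(2\rho^2+P+2)(P-2\rho^2-4\rho e^q-4\rho e^{-q}-2),$$ $$\nu_\rho(P)=-\int_0^{2\log\frac{\rho+\Delta}{1+\rho\Delta}}\frac{dq}{\sqrt{R_{\rho,P}(q)}} .$$ Then $0<\Delta<1$, the point $(0,\log\Delta)$ lies on $\mathcal I_\rho=P$ and is mapped to a point with $\bar q=2\log\frac{\rho+\Delta}{1+\rho\Delta}$, and $R_{\rho,P}>0$ on the closed interval of integration. Moreover $(\partial\mathcal I_\rho/\partial p)^2=R_{\rho,\mathcal I_\rho}(q)$ everywhere. The frequency does not depend on the starting point: if $P=\mathcal I_\rho(q,p)\in D_\rho$ and $\partial\mathcal I_\rho/\partial p$ has the same sign $s=\pm1$ at $(q,p)$ and at $\Phi_\rho(q,p)$, then $s\int_q^{\bar q}dq'/\sqrt{R_{\rho,P}(q')}=\nu_\rho(P)$. If $H^*$ is any antiderivative of $\nu_\rho$ on $D_\rho$, i.e. $H^*(P)=\int^P\nu_\rho(P')\,dP'$, then $H^*(\mathcal I_\rho(q,p))$ is a modified Hamiltonian of $\Phi_\rho$: through every point with $\mathcal I_\rho\in D_\rho$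 there is a global solution $\gamma$ of $\dot q=\partial H^*/\partial p$, $\dot p=-\partial H^*/\partial q$, and $\gamma(t+1)=\Phi_\rho(\gamma(t))$ for all $t\in\mathbb R$. **(4) Expansion in $\tau=\rho-1$.** Let $V=U_{1+\tau}(q)$, $T=U_{1+\tau}(p)$, $\{F,G\}=F_qG_p-F_pG_q$, and let $\sum_{n\ge1}Z_n$ be the Baker–Campbell–Hausdorff series of $e^{D_V}e^{D_T}$, $D_GF=\{F,G\}$, i.e. $$Z_1+Z_2+Z_3+\dots=T+V+\tfrac12\{T,V\}+\tfrac1{12}\big(\{T,\{T,V\}\}+\{V,\{V,T\}\}\big)+\cdots,$$ with $Z_n$ homogeneous of degree $n$ in $V,T$. Put $L=p+q-2\log\big((1+e^p)(1+e^q)\big)$, $d=(1+e^p)(1+e^q)$ and $$E_\tau(q,p)=2\tau L-\tau^2\Big[L+\frac{4(e^{p+q}+1)}{d}\Big]+\frac{2\tau^3}{3}\Big[\frac{3(e^{p+2q}+e^{2p+q}+e^p+e^q)}{d^2}+\frac{2(3e^{2(p+q)}+8e^{p+q}+3)}{d^2}+L\Big].$$ Then $Z_1+Z_2+Z_3=E_\tau(q,p)+c(\tau)+O(\tau^4)$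 for every $(q,p)$, with $c(\tau)$ independent of $(q,p)$. Furthermore one can choose, for all $\rho>0$, antiderivatives $H^*_\rho$ of $\nu_\rho$ on $D_\rho$ with $H^*_1=0$ on $(12,\infty)$ such that, as $\tau\to0$: * for every $P>12$, $$H^*_{1+\tau}(P)=-2\tau\log(P+4)+\tau^2\Big(\log(P+4)-\frac8{P+4}\Big)-\frac{2\tau^3}3\Big(\log(P+4)-\frac4{P+4}-\frac{24}{(P+4)^2}\Big)+O(\tau^4);$$ * for every $(q,p)\ne(0,0)$, $H^*_{1+\tau}(\mathcal I_{1+\tau}(q,p))=E_\tau(q,p)+O(\tau^4)$; * to all orders: for every $N\ge0$ there is a function $c_N(\tau)$ such that for every $(q,p)\neq(0,0)$, $H^*_{1+\tau}(\mathcal I_{1+\tau}(q,p))=\sum_{n=1}^NZ_n(q,p)+c_N(\tau)+O(\tau^{N+1})$. -/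

import Mathlib

open Filter Asymptotics
open scoped Topology ContDiff

noncomputable section

namespace MKdV

/-! Phase space is `ℝ × ℝ`; a point is `z = (q, p)`. -/

/-- The reduced lattice MKdV map for sequences `X_j, Y_j` of logarithmic variables; `X', Y'` are
the updated sequences. -/
def ReducedMap (ρ : ℝ) (X Y X' Y' : ℤ → ℝ) : Prop :=
  (∀ j, X' j = X j + Real.log
    (((ρ + Real.exp (Y (j - 1))) * (1 + ρ * Real.exp (Y j))) /
      ((ρ + Real.exp (Y j)) * (1 + ρ * Real.exp (Y (j - 1)))))) ∧
  (∀ j, Y' j = Y j + Real.log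
    (((ρ + Real.exp (X' j)) * (1 + ρ * Real.exp (X' (j + 1)))) /
      ((ρ + Real.exp (X' (j + 1))) * (1 + ρ * Real.exp (X' j)))))

/-- Period-two sequences subject to the constraints `X_1 + X_2 = 0` and `Y_0 + Y_1 = 0`. -/
def PeriodTwo (X Y : ℤ → ℝ) : Prop :=
  (∀ j, X (j + 2) = X j) ∧ (∀ j, Y (j + 2) = Y j) ∧ X 1 + X 2 = 0 ∧ Y 0 + Y 1 = 0

/-- The updated momentum `p̄`. -/
def newP (ρ : ℝ) (z : ℝ × ℝ) : ℝ :=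
  z.2 + 2 * Real.log ((1 + ρ * Real.exp z.1) / (ρ + Real.exp z.1))

/-- The updated coordinate `q̄`. -/
def newQ (ρ : ℝ) (z : ℝ × ℝ) : ℝ :=
  z.1 + 2 * Real.log ((ρ + Real.exp (newP ρ z)) / (1 + ρ * Real.exp (newP ρ z)))

/-- The period-two MKdV map `(q, p) ↦ (q̄, p̄)`. -/
def map (ρ : ℝ) (z : ℝ × ℝ) : ℝ × ℝ := (newQ ρ z, newP ρ z)

/-- The standard symplectic form `dq ∧ dp`. -/
def symplecticForm (u v : ℝ × ℝ) : ℝ := u.1 * v.2 - v.1 * u.2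

/-- The function `x ↦ 2 ∫₀ˣ log ((ρ + e^ξ) / (1 + ρ e^ξ)) dξ`. -/
def potential (ρ x : ℝ) : ℝ :=
  2 * ∫ ξ in (0 : ℝ)..x, Real.log ((ρ + Real.exp ξ) / (1 + ρ * Real.exp ξ))

/-- The generating function (discrete Hamiltonian) `H(q, p̄)`. -/
def genFun (ρ q pbar : ℝ) : ℝ := potential ρ pbar + potential ρ q

/-- The real dilogarithm `Li₂(x) = -∫₀ˣ log(1 - t)/t dt`, for `x ≤ 1`. -/
def dilog (x : ℝ) : ℝ := -∫ t in (0 : ℝ)..x, Real.log (1 - t) / t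

/-- The invariant of the map. -/
def invariant (ρ : ℝ) (z : ℝ × ℝ) : ℝ :=
  Real.exp (z.2 - z.1) + Real.exp (z.1 - z.2)
    + 2 * ρ * (Real.exp z.2 + Real.exp z.1 + Real.exp (-z.2) + Real.exp (-z.1))
    + ρ ^ 2 * (Real.exp (z.2 + z.1) + Real.exp (-(z.2 + z.1)))

/-- The partial derivative `∂F/∂q`. -/
def dq (F : ℝ × ℝ → ℝ) (z : ℝ × ℝ) : ℝ := deriv (fun s => F (s, z.2)) z.1

/-- The partial derivative `∂F/∂p`. -/
def dp (F : ℝ × ℝ → ℝ) (z : ℝ × ℝ) : ℝ := deriv (fun s => F (z.1, s)) z.2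

/-- The Poisson bracket `{F, G} = F_q G_p - F_p G_q`. -/
def poisson (F G : ℝ × ℝ → ℝ) (z : ℝ × ℝ) : ℝ := dq F z * dp G z - dp F z * dq G z

/-- A global solution of Hamilton's equations `q' = ∂K/∂p`, `p' = -∂K/∂q`, along which `K` is
differentiable. -/
def IsHamiltonianTrajectory (K : ℝ × ℝ → ℝ) (γ : ℝ → ℝ × ℝ) : Prop :=
  ∀ t, DifferentiableAt ℝ K (γ t) ∧
    HasDerivAt (fun s => (γ s).1) (dp K (γ t)) t ∧
    HasDerivAt (fun s => (γ s).2) (-dq K (γ t)) t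

/-- `Δ`: the value of `e^p < 1` at the point `q = 0` of the level curve `invariant = P`. -/
def Delta (ρ P : ℝ) : ℝ :=
  (P - 4 * ρ - √((2 * ρ ^ 2 + P + 2) * (P - 2 * ρ ^ 2 - 8 * ρ - 2))) / (2 * (1 + ρ) ^ 2)

/-- The value of `q̄` obtained from `q = 0`, `e^p = Δ`. -/
def qStep (ρ P : ℝ) : ℝ := 2 * Real.log ((ρ + Delta ρ P) / (1 + ρ * Delta ρ P))

/-- The expression under the square root in the elliptic integral. -/
def radicand (ρ P q : ℝ) : ℝ :=
  (2 * ρ ^ 2 + P + 2) *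
    (P - 2 * ρ ^ 2 - 4 * ρ * Real.exp q - 4 * ρ * Real.exp (-q) - 2)

/-- The frequency `ν(P)`. The sign in front comes from `∂p/∂P < 0` on the branch `e^p = Δ < 1`. -/
def frequency (ρ P : ℝ) : ℝ := -∫ q in (0 : ℝ)..qStep ρ P, 1 / √(radicand ρ P q)

/-- The values `P` of the invariant above its minimum (attained only at the fixed point) for which
the step from `q = 0` to `q̄` does not go past a turning point of the level curve. -/
def energyDomain (ρ : ℝ) : Set ℝ :=
  {P | 2 * ρ ^ 2 + 8 * ρ + 2 < P ∧ (1 + ρ) ^ 2 * (ρ + 1 / ρ - 4) < P - 4 * ρ}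

/-- `h` is a modified Hamiltonian in closed form: `h(P) = ∫^P ν(P') dP'`. -/
def IsFrequencyAntiderivative (ρ : ℝ) (h : ℝ → ℝ) : Prop :=
  ∀ P ∈ energyDomain ρ, HasDerivAt h (frequency ρ P) P

/-- For a formal series `Z = ∑_{k ≥ 1} tᵏ Z_k` of functions, `adPow Z W j n` is the coefficient of
`tⁿ` in `(ad_Z)ʲ W`, for the Lie bracket `[F, G] = {G, F}`, which corresponds to the commutator
of the operators `D_F = {·, F}`. -/
def adPow (Z : ℕ → ℝ × ℝ → ℝ) (W : ℝ × ℝ → ℝ) : ℕ → ℕ → ℝ × ℝ → ℝ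
  | 0, n => if n = 0 then W else 0
  | j + 1, n => ∑ k ∈ Finset.Icc 1 n, poisson (adPow Z W j (n - k)) (Z k)

/-- The terms of degree at most `n` of the Baker-Campbell-Hausdorff series
`Z(t) = log (e^{tX} e^{tY})`, by the recursion that is the degree-wise form of
`Z'(t) = (u / (e^u - 1)) X + (u / (1 - e^{-u})) Y`, where `u = ad_{Z(t)}` and `Z(0) = 0`. Note
`x / (e^x - 1) = ∑ bernoulli j / j! xʲ` and `x / (1 - e^{-x}) = ∑ bernoulli' j / j! xʲ`. -/
def bchSeq (X Y : ℝ × ℝ → ℝ) : ℕ → ℕ → ℝ × ℝ → ℝ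
  | 0 => fun _ => 0
  | n + 1 => Function.update (bchSeq X Y n) (n + 1)
      ((1 / ((n : ℝ) + 1)) • ∑ j ∈ Finset.range (n + 1), (1 / (j.factorial : ℝ)) •
        ((bernoulli j : ℝ) • adPow (bchSeq X Y n) X j n
          + (bernoulli' j : ℝ) • adPow (bchSeq X Y n) Y j n))

/-- The term of degree `n` of the Baker-Campbell-Hausdorff series of `X, Y`: the first ones are
`X + Y`, `½ {Y, X}`, `(1/12) ({Y, {Y, X}} + {X, {X, Y}})`. -/
def bchTerm (X Y : ℝ × ℝ → ℝ) (n : ℕ) : ℝ × ℝ → ℝ := bchSeq X Y n n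

/-- The part `V(q)` of the discrete Hamiltonian `H = V(q) + T(p)`, at `ρ = 1 + τ`. -/
def Vpart (τ : ℝ) (z : ℝ × ℝ) : ℝ := potential (1 + τ) z.1

/-- The part `T(p)` of the discrete Hamiltonian `H = V(q) + T(p)`, at `ρ = 1 + τ`. -/
def Tpart (τ : ℝ) (z : ℝ × ℝ) : ℝ := potential (1 + τ) z.2

/-- The Baker-Campbell-Hausdorff series of `e^{D_V} e^{D_T}` up to degree `N` in the brackets; the
degree `n` term is of order `τⁿ`. -/
def bchPartialSum (N : ℕ) (τ : ℝ) (z : ℝ × ℝ) : ℝ :=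
  ∑ n ∈ Finset.Icc 1 N, bchTerm (Vpart τ) (Tpart τ) n z

/-- The explicit third order expansion of the modified Hamiltonian in `q, p`. -/
def expansionQP (τ : ℝ) (z : ℝ × ℝ) : ℝ :=
  let q := z.1
  let p := z.2
  let L := p + q - 2 * Real.log ((1 + Real.exp p) * (1 + Real.exp q))
  let d := (1 + Real.exp p) * (1 + Real.exp q)
  2 * τ * L
    - τ ^ 2 * (L + 4 * (Real.exp (p + q) + 1) / d)
    + 2 * τ ^ 3 / 3 *
      (3 * (Real.exp (p + 2 * q) + Real.exp (2 * p + q) + Real.exp p + Real.exp q) / d ^ 2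
        + 2 * (3 * Real.exp (2 * (p + q)) + 8 * Real.exp (p + q) + 3) / d ^ 2)
    + 2 * τ ^ 3 / 3 * L

/-- The explicit third order expansion of the modified Hamiltonian in the invariant `P`. -/
def expansionP (τ P : ℝ) : ℝ :=
  -2 * τ * Real.log (P + 4)
    + τ ^ 2 * (Real.log (P + 4) - 8 / (P + 4))
    - 2 * τ ^ 3 / 3 * (Real.log (P + 4) - 4 / (P + 4) - 24 / (P + 4) ^ 2)

end MKdV

end

/-!
The map `Φ` is the composition of a shift of `p` by `-force ρ q` and a shift of `q` by
`force ρ p`, where `force ρ` is the derivative of `potential ρ`. Smoothness, bijectivity,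
symplecticity, the generating function and the period-two reduction are read off from this form;
the dilogarithm formula is checked by differentiation.

**The closed form.** `Φ` preserves the invariant `I` and the form `dq ∧ dp`, so it commutes with
the Hamiltonian flow `φ` of `I`, which is complete because the level curves of `I` are compact. On
the branch `∂I/∂p < 0` of a level curve one has `q' = ∂I/∂p = -√R(q)`, so `-∫ dq / √R` measures the
time. At the starting point on the axis `q = 0` the time needed to reach its image is the frequency
`ν(P)`; every orbit of `φ` meets this axis, and commutation gives `Φ = φ_ν(P)` on the whole level
curve (`IsOrbit.map_eq`). The flow of `h ∘ I` with `h' = ν` is `φ` with time rescaled by `ν(P)`,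
hence interpolates `Φ` (`exists_trajectory`). That the time integral has the same value from any
other starting point on the same branch as its image (`sign_mul_time_eq_frequency`) also requires
that `Φ` maps the arc of the branch between the two starting points into the branch, which follows
from the strict convexity of `I` (`partner_pos_of_between`).

**The expansion to all orders.** Put `ρ = e^σ` and consider smooth functions `F` of `(σ, q, p)`
(`Fam`). Pullback by `Φ` agrees with `e^{D_V} e^{D_T}` up to any order in `σ` by Taylor's formula,
and hence with `e^{D_K}`, where `K` is the Baker-Campbell-Hausdorff sum of degree `N`, up to
`O(σ^{N+1})` (`isBigO_comp_famMap`). The algebraic input, `coeff_bchExp`, holds in any associative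
`ℝ`-algebra: both sides solve the differential equation `F' = x F + F y`. A fixed linear combination
of the pullbacks by `Φ^j`, `0 ≤ j ≤ N`, extracts the linear term `D_K F` from the exponentials
`e^{j D_K}`. On the other hand `Φ^j = φ_{jν}`, and Taylor's formula in time shows that the same
combination extracts `ν {F, I}`. With `F = q, p` this gives `dK = ν dI + O(σ^{N+1}) =
d(h ∘ I) + O(σ^{N+1})`, locally uniformly away from the fixed point, and no smoothness of `ν` in the
parameter is needed, only `ν = O(σ)`. Integration over the connected set `ℝ² ∖ {0}` gives
`K = h ∘ I + c(σ) + O(σ^{N+1})` (`isBigO_antiderivative_sub_bchSum`).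

**The explicit third order expansions.** With `a = tanh (q / 2)` and `b = tanh (p / 2)` the gradient
of `K` for `N = 3` and that of the explicit expansion become polynomials in `σ, a, b` modulo `σ⁴`,
and coincide there (`gradient_identity`). The expansion in `P` agrees with the one in `q, p` after
the substitution `P = I(q, p)` modulo `σ⁴` (`expansion_identity`). The constants of integration are
fixed by prescribing the value of `h ∘ I` at one point; for fixed `P` the expansion is obtained by
evaluation along the starting points of the level curves `I = P`, which depend continuously on the
parameter.
-/

noncomputable section

namespace MKdV

/-! ### The map -/

/-- The force `U_ρ'`, by which the map shifts both variables. -/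
def force (ρ x : ℝ) : ℝ := 2 * Real.log ((ρ + Real.exp x) / (1 + ρ * Real.exp x))

lemma exp_force {ρ : ℝ} (hρ : 0 < ρ) (x : ℝ) :
    Real.exp (force ρ x) = ((ρ + Real.exp x) / (1 + ρ * Real.exp x)) ^ 2 := by
  have h : 0 < (ρ + Real.exp x) / (1 + ρ * Real.exp x) := by positivity
  rw [force, mul_comm, Real.exp_mul, Real.exp_log h]
  norm_num

lemma force_neg {ρ : ℝ} (hρ : 0 < ρ) (x : ℝ) : force ρ (-x) = -force ρ x := by
  rw [force, force, ← mul_neg, ← Real.log_inv]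
  congr 2
  rw [Real.exp_neg]
  have := Real.exp_pos x
  field_simp
  ring

lemma force_zero {ρ : ℝ} (hρ : 0 < ρ) : force ρ 0 = 0 := by
  have := force_neg hρ 0
  rw [neg_zero] at this
  linarith

lemma newP_eq {ρ : ℝ} (z : ℝ × ℝ) : newP ρ z = z.2 - force ρ z.1 := by
  rw [newP, force, sub_eq_add_neg, ← mul_neg, ← Real.log_inv, inv_div]

lemma newQ_eq (ρ : ℝ) (z : ℝ × ℝ) : newQ ρ z = z.1 + force ρ (newP ρ z) := rfl

lemma map_eq_iff {ρ : ℝ} (q p q' p' : ℝ) :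
    map ρ (q, p) = (q', p') ↔ p' = p - force ρ q ∧ q' = q + force ρ p' := by
  rw [map, Prod.mk.injEq, newQ_eq, newP_eq]
  constructor
  · rintro ⟨rfl, rfl⟩; exact ⟨rfl, rfl⟩
  · rintro ⟨rfl, rfl⟩; exact ⟨rfl, rfl⟩

lemma contDiff_force {ρ : ℝ} (hρ : 0 < ρ) : ContDiff ℝ ∞ (force ρ) := by
  unfold force
  refine contDiff_const.mul (ContDiff.log (ContDiff.div ?_ ?_ ?_) ?_)
  · exact contDiff_const.add Real.contDiff_exp
  · exact contDiff_const.add (contDiff_const.mul Real.contDiff_exp)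
  · intro x; positivity
  · intro x; positivity

lemma map_fun_eq (ρ : ℝ) : map ρ = fun z : ℝ × ℝ =>
    (z.1 + force ρ (z.2 - force ρ z.1), z.2 - force ρ z.1) := by
  funext z
  rw [map, newQ_eq, newP_eq]

lemma contDiff_map {ρ : ℝ} (hρ : 0 < ρ) : ContDiff ℝ ∞ (map ρ) := by
  rw [map_fun_eq]
  have h := contDiff_force hρ
  have h2 : ContDiff ℝ ∞ (fun z : ℝ × ℝ => z.2 - force ρ z.1) :=
    contDiff_snd.sub (h.comp contDiff_fst)
  exact (contDiff_fst.add (h.comp h2)).prodMk h2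

lemma map_neg {ρ : ℝ} (hρ : 0 < ρ) (z : ℝ × ℝ) : map ρ (-z) = -map ρ z := by
  have h : -z.2 + force ρ z.1 = -(z.2 - force ρ z.1) := by ring
  rw [map_fun_eq]
  simp only [Prod.fst_neg, Prod.snd_neg, force_neg hρ, sub_neg_eq_add, h, Prod.neg_mk]
  congr 1
  ring

lemma bijective_map (ρ : ℝ) : Function.Bijective (map ρ) := by
  rw [map_fun_eq]
  refine Function.bijective_iff_has_inverse.2
    ⟨fun w => (w.1 - force ρ w.2, w.2 + force ρ (w.1 - force ρ w.2)), fun z => ?_, fun w => ?_⟩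
  · ext <;> simp
  · ext <;> simp

lemma hasFDerivAt_map {ρ : ℝ} (hρ : 0 < ρ) (z : ℝ × ℝ) : ∃ (a b : ℝ) (A : ℝ × ℝ →L[ℝ] ℝ × ℝ),
    HasFDerivAt (map ρ) A z ∧
      ∀ u, A u = (u.1 + b * (u.2 - a * u.1), u.2 - a * u.1) := by
  have hd : Differentiable ℝ (force ρ) := (contDiff_force hρ).differentiable (by simp)
  have h1 := (hd z.1).hasDerivAt.comp_hasFDerivAt z (hasFDerivAt_fst (𝕜 := ℝ))
  have h2 := (hasFDerivAt_snd (𝕜 := ℝ) (p := z)).sub h1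
  have h3 := (hd (z.2 - force ρ z.1)).hasDerivAt.comp_hasFDerivAt z h2
  have h4 := ((hasFDerivAt_fst (𝕜 := ℝ) (p := z)).add h3).prodMk h2
  rw [map_fun_eq]
  exact ⟨deriv (force ρ) z.1, deriv (force ρ) (z.2 - force ρ z.1), _, h4, fun u => by simp⟩

lemma symplecticForm_fderiv_map {ρ : ℝ} (hρ : 0 < ρ) (z u v : ℝ × ℝ) :
    symplecticForm (fderiv ℝ (map ρ) z u) (fderiv ℝ (map ρ) z v) = symplecticForm u v := by
  obtain ⟨a, b, A, hA, hu⟩ := hasFDerivAt_map hρ z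
  rw [hA.fderiv, hu, hu]
  simp only [symplecticForm]
  ring

/-! ### Period-two reduction -/

lemma log_ratio_eq_force {ρ : ℝ} (hρ : 0 < ρ) (x : ℝ) :
    Real.log (((ρ + Real.exp x) * (1 + ρ * Real.exp (-x))) /
      ((ρ + Real.exp (-x)) * (1 + ρ * Real.exp x))) = force ρ x := by
  rw [show force ρ x = Real.log (Real.exp (force ρ x)) from (Real.log_exp _).symm, exp_force hρ]
  congr 1
  rw [Real.exp_neg]
  have := Real.exp_pos x
  field_simp
  ring

lemma periodic_two_ext {F G : ℤ → ℝ} (hF : ∀ j, F (j + 2) = F j) (hG : ∀ j, G (j + 2) = G j)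
    (h0 : F 0 = G 0) (h1 : F 1 = G 1) (j : ℤ) : F j = G j := by
  have key : ∀ (n : ℤ) (r : ℤ), F (r + n * 2) = F r ∧ G (r + n * 2) = G r := fun n r =>
    ⟨(show Function.Periodic F 2 from hF).int_mul n r |>.symm ▸ rfl,
      (show Function.Periodic G 2 from hG).int_mul n r |>.symm ▸ rfl⟩
  rcases Int.emod_two_eq_zero_or_one j with h | h
  · have e : j = 0 + (j / 2) * 2 := by omega
    rw [e, (key _ _).1, (key _ _).2, h0]
  · have e : j = 1 + (j / 2) * 2 := by omega
    rw [e, (key _ _).1, (key _ _).2, h1]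

lemma reducedMap_iff {ρ : ℝ} (hρ : 0 < ρ) {X Y X' Y' : ℤ → ℝ} (h : PeriodTwo X Y)
    (h' : PeriodTwo X' Y') : ReducedMap ρ X Y X' Y' ↔ map ρ (Y 1, X 1) = (Y' 1, X' 1) := by
  obtain ⟨hX, hY, hX2, hY0⟩ := h
  obtain ⟨hX', hY', hX2', hY0'⟩ := h'
  have eX2 : X 2 = -X 1 := by linarith
  have eX2' : X' 2 = -X' 1 := by linarith
  have eX0 : X 0 = -X 1 := by rw [← hX 0]; exact eX2
  have eX0' : X' 0 = -X' 1 := by rw [← hX' 0]; exact eX2'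
  have eY0 : Y 0 = -Y 1 := by linarith
  have eY0' : Y' 0 = -Y' 1 := by linarith
  have eYm : Y (-1) = Y 1 := by rw [← hY (-1)]; norm_num
  rw [map_eq_iff]
  have hX1 : X' 1 = X 1 + Real.log (((ρ + Real.exp (Y (1 - 1))) * (1 + ρ * Real.exp (Y 1))) /
      ((ρ + Real.exp (Y 1)) * (1 + ρ * Real.exp (Y (1 - 1))))) ↔ X' 1 = X 1 - force ρ (Y 1) := by
    have := log_ratio_eq_force hρ (-Y 1)
    rw [neg_neg, force_neg hρ] at this
    rw [sub_self, eY0, this, sub_eq_add_neg]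
  have hY1 : Y' 1 = Y 1 + Real.log
      (((ρ + Real.exp (X' 1)) * (1 + ρ * Real.exp (X' (1 + 1)))) /
      ((ρ + Real.exp (X' (1 + 1))) * (1 + ρ * Real.exp (X' 1)))) ↔
      Y' 1 = Y 1 + force ρ (X' 1) := by
    rw [show (1 : ℤ) + 1 = 2 from rfl, eX2', log_ratio_eq_force hρ]
  constructor
  · rintro ⟨hx, hy⟩
    exact ⟨hX1.1 (hx 1), hY1.1 (hy 1)⟩
  · rintro ⟨hx, hy⟩
    refine ⟨periodic_two_ext hX' (fun j => ?_) ?_ (hX1.2 hx),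
      periodic_two_ext hY' (fun j => ?_) ?_ (hY1.2 hy)⟩
    · simp only [show j + 2 - 1 = (j - 1) + 2 by ring, hX, hY]
    · have := log_ratio_eq_force hρ (Y 1)
      simp only [zero_sub, eYm, eY0, eX0, eX0', this]
      linarith
    · simp only [show j + 2 + 1 = (j + 1) + 2 by ring, hX', hY]
    · have := log_ratio_eq_force hρ (-X' 1)
      rw [neg_neg, force_neg hρ] at this
      simp only [zero_add, eX0', eY0, eY0', this]
      linarith

/-! ### The generating function and the dilogarithm -/

lemma hasDerivAt_potential {ρ : ℝ} (hρ : 0 < ρ) (x : ℝ) :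
    HasDerivAt (potential ρ) (force ρ x) x := by
  have hc : Continuous fun ξ : ℝ => Real.log ((ρ + Real.exp ξ) / (1 + ρ * Real.exp ξ)) := by
    have := (contDiff_force hρ).continuous
    have h2 := this.const_mul (1 / 2)
    refine h2.congr fun ξ => ?_
    rw [force]; ring
  exact (intervalIntegral.integral_hasDerivAt_right (hc.intervalIntegrable _ _)
    (hc.stronglyMeasurableAtFilter _ _) hc.continuousAt).const_mul 2

lemma contDiff_potential {ρ : ℝ} (hρ : 0 < ρ) : ContDiff ℝ ∞ (potential ρ) := by
  have h : deriv (potential ρ) = force ρ := funext fun x => (hasDerivAt_potential hρ x).deriv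
  rw [contDiff_infty_iff_deriv]
  exact ⟨fun x => (hasDerivAt_potential hρ x).differentiableAt, h ▸ contDiff_force hρ⟩

lemma contDiff_genFun {ρ : ℝ} (hρ : 0 < ρ) :
    ContDiff ℝ ∞ (fun w : ℝ × ℝ => genFun ρ w.1 w.2) := by
  unfold genFun
  exact ((contDiff_potential hρ).comp contDiff_snd).add ((contDiff_potential hρ).comp contDiff_fst)

lemma map_eq_iff_genFun {ρ : ℝ} (hρ : 0 < ρ) (q p q' p' : ℝ) :
    map ρ (q, p) = (q', p') ↔
        (p' - p = -deriv (fun s => genFun ρ s p') q ∧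
          q' - q = deriv (fun s => genFun ρ q s) p') := by
  have h1 : deriv (fun s => genFun ρ s p') q = force ρ q :=
    ((hasDerivAt_potential hρ q).const_add _).deriv
  have h2 : deriv (fun s => genFun ρ q s) p' = force ρ p' :=
    ((hasDerivAt_potential hρ p').add_const _).deriv
  rw [h1, h2, map_eq_iff]
  constructor
  · rintro ⟨h, h'⟩; constructor <;> linarith
  · rintro ⟨h, h'⟩; constructor <;> linarith

/-- Where `1 - x > 0` the dilogarithm is an antiderivative of `-log (1 - x) / x`; the quotient
extends continuously over `x = 0`, although it is literally `0` there. -/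
lemma hasDerivAt_dilog {x : ℝ} (hx : x < 0) :
    HasDerivAt dilog (-(Real.log (1 - x) / x)) x := by
  set g : ℝ → ℝ := dslope (fun t => Real.log (1 - t)) 0 with hg
  have hlog : ∀ t < (1 : ℝ), DifferentiableAt ℝ (fun t => Real.log (1 - t)) t := fun t ht =>
    ((differentiableAt_const _).sub differentiableAt_id).log (by simp; linarith)
  have hgc : ContinuousOn g (Set.Iio 1) := by
    rw [hg, continuousOn_dslope (Iio_mem_nhds one_pos)]
    exact ⟨fun t ht => (hlog t ht).continuousAt.continuousWithinAt, hlog 0 one_pos⟩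
  have hEq : ∀ t : ℝ, t ≠ 0 → g t = Real.log (1 - t) / t := fun t ht => by
    rw [hg, dslope_of_ne _ ht, slope_def_field]; simp
  have hint : ∀ y : ℝ, dilog y = -∫ t in (0 : ℝ)..y, g t := fun y => by
    rw [dilog]
    congr 1
    refine intervalIntegral.integral_congr_ae ?_
    filter_upwards [MeasureTheory.compl_mem_ae_iff.2 (MeasureTheory.measure_singleton (0 : ℝ))]
      with t ht _
    exact (hEq t ht).symm
  rw [show dilog = fun y => -∫ t in (0 : ℝ)..y, g t from funext hint, ← hEq x hx.ne]
  have hsub : Set.uIcc 0 x ⊆ Set.Iio 1 := by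
    rw [Set.uIcc_of_ge hx.le]
    exact fun t ht => lt_of_le_of_lt ht.2 one_pos
  have hnx : Set.Iio (1 : ℝ) ∈ 𝓝 x := Iio_mem_nhds (hx.trans one_pos)
  exact (intervalIntegral.integral_hasDerivAt_right
    (hgc.mono hsub).intervalIntegrable
    (hgc.stronglyMeasurableAtFilter isOpen_Iio x (hx.trans one_pos))
    (hgc.continuousAt hnx)).neg

lemma potential_eq_dilog {ρ : ℝ} (hρ : 0 < ρ) (x : ℝ) : potential ρ x =
        2 * (x * Real.log ρ
          - dilog (-Real.exp x / ρ) + dilog (-ρ * Real.exp x)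
          + dilog (-1 / ρ) - dilog (-ρ)) := by
  set F : ℝ → ℝ := fun x => 2 * (x * Real.log ρ
          - dilog (-Real.exp x / ρ) + dilog (-ρ * Real.exp x)
          + dilog (-1 / ρ) - dilog (-ρ)) with hF
  have hd : ∀ y, HasDerivAt (fun y => potential ρ y - F y) 0 y := fun y => by
    have e := Real.exp_pos y
    have h1 := HasDerivAt.comp y (h₂ := dilog) (h := fun y => -Real.exp y / ρ)
      (hasDerivAt_dilog (x := -Real.exp y / ρ)
        (by rw [neg_div]; exact neg_lt_zero.2 (by positivity)))
      ((Real.hasDerivAt_exp y).neg.div_const ρ)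
    have h2 := HasDerivAt.comp y (h₂ := dilog) (h := fun y => -ρ * Real.exp y)
      (hasDerivAt_dilog (x := -ρ * Real.exp y)
        (by rw [neg_mul]; exact neg_lt_zero.2 (by positivity)))
      ((Real.hasDerivAt_exp y).const_mul (-ρ))
    have h3 : HasDerivAt F _ y :=
      ((((((hasDerivAt_id y).mul_const (Real.log ρ)).sub h1).add h2).add_const
      (dilog (-1 / ρ))).sub_const (dilog (-ρ))).const_mul 2
    have h4 := (hasDerivAt_potential hρ y).sub h3
    refine h4.congr_deriv ?_
    have l1 : Real.log (1 - -Real.exp y / ρ) = Real.log (ρ + Real.exp y) - Real.log ρ := by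
      rw [← Real.log_div (by positivity) hρ.ne']
      congr 1; field_simp; ring
    have l2 : Real.log (1 - -ρ * Real.exp y) = Real.log (1 + ρ * Real.exp y) := by
      congr 1; ring
    have l3 : force ρ y = 2 * (Real.log (ρ + Real.exp y) - Real.log (1 + ρ * Real.exp y)) := by
      rw [force, Real.log_div (by positivity) (by positivity)]
    rw [l1, l2, l3]
    field_simp
    ring
  have h0 := is_const_of_deriv_eq_zero (fun y => (hd y).differentiableAt)
    (fun y => (hd y).deriv) x 0
  have hP : potential ρ 0 = 0 := by simp [potential]
  have hF0 : F 0 = 0 := by simp [hF]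
  simp only [hP, hF0] at h0
  linarith

/-! ### The invariant and its level curves -/

/-- The derivative `∂I/∂q` of the invariant. -/
def invariantQ (ρ : ℝ) (z : ℝ × ℝ) : ℝ :=
  -Real.exp (z.2 - z.1) + Real.exp (z.1 - z.2) + 2 * ρ * (Real.exp z.1 - Real.exp (-z.1))
    + ρ ^ 2 * (Real.exp (z.2 + z.1) - Real.exp (-(z.2 + z.1)))

/-- The derivative `∂I/∂p` of the invariant. -/
def invariantP (ρ : ℝ) (z : ℝ × ℝ) : ℝ :=
  Real.exp (z.2 - z.1) - Real.exp (z.1 - z.2) + 2 * ρ * (Real.exp z.2 - Real.exp (-z.2))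
    + ρ ^ 2 * (Real.exp (z.2 + z.1) - Real.exp (-(z.2 + z.1)))

lemma contDiff_invariant (ρ : ℝ) : ContDiff ℝ ∞ (invariant ρ) := by
  unfold invariant; fun_prop

lemma contDiff_invariantQ (ρ : ℝ) : ContDiff ℝ ∞ (invariantQ ρ) := by
  unfold invariantQ; fun_prop

lemma contDiff_invariantP (ρ : ℝ) : ContDiff ℝ ∞ (invariantP ρ) := by
  unfold invariantP; fun_prop

lemma hasDerivAt_invariant_comp (ρ : ℝ) {γ : ℝ → ℝ × ℝ} {t : ℝ} {v : ℝ × ℝ}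
    (h : HasDerivAt γ v t) :
    HasDerivAt (fun s => invariant ρ (γ s))
      (invariantQ ρ (γ t) * v.1 + invariantP ρ (γ t) * v.2) t := by
  have h1 : HasDerivAt (fun s => (γ s).1) v.1 t := h.fst
  have h2 : HasDerivAt (fun s => (γ s).2) v.2 t := h.snd
  have := (((h2.sub h1).exp.add (h1.sub h2).exp).add
    ((((h2.exp.add h1.exp).add h2.neg.exp).add h1.neg.exp).const_mul (2 * ρ))).add
    (((h2.add h1).exp.add (h2.add h1).neg.exp).const_mul (ρ ^ 2))
  refine this.congr_deriv ?_
  simp only [invariantQ, invariantP, Pi.neg_apply, Pi.sub_apply, Pi.add_apply]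
  ring

lemma fderiv_invariant (ρ : ℝ) (z u : ℝ × ℝ) :
    fderiv ℝ (invariant ρ) z u = invariantQ ρ z * u.1 + invariantP ρ z * u.2 := by
  have h : HasDerivAt (fun s : ℝ => z + s • u) u 0 := by
    simpa using ((hasDerivAt_id (0 : ℝ)).smul_const u).const_add z
  have h1 := hasDerivAt_invariant_comp ρ h
  have hd : DifferentiableAt ℝ (invariant ρ) (z + (0 : ℝ) • u) :=
    (contDiff_invariant ρ).differentiable (by simp) _
  have h2 := hd.hasFDerivAt.comp_hasDerivAt (0 : ℝ) h
  simpa using h2.unique h1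

lemma dp_invariant (ρ : ℝ) (z : ℝ × ℝ) : dp (invariant ρ) z = invariantP ρ z := by
  have h : HasDerivAt (fun s : ℝ => (z.1, s)) (0, 1) z.2 :=
    (hasDerivAt_const _ _).prodMk (hasDerivAt_id z.2)
  simpa [dp] using (hasDerivAt_invariant_comp ρ h).deriv

lemma invariant_neg (ρ : ℝ) (z : ℝ × ℝ) : invariant ρ (-z) = invariant ρ z := by
  simp only [invariant, Prod.fst_neg, Prod.snd_neg, neg_neg]
  rw [show -z.2 - -z.1 = z.1 - z.2 by ring, show -z.1 - -z.2 = z.2 - z.1 by ring,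
    show -(-z.2 + -z.1) = z.2 + z.1 by ring, show -z.2 + -z.1 = -(z.2 + z.1) by ring]
  ring

lemma invariant_swap (ρ q p : ℝ) : invariant ρ (p, q) = invariant ρ (q, p) := by
  simp only [invariant]
  rw [add_comm q p]
  ring

lemma invariantP_neg (ρ : ℝ) (z : ℝ × ℝ) : invariantP ρ (-z) = -invariantP ρ z := by
  simp only [invariantP, Prod.fst_neg, Prod.snd_neg, neg_neg]
  rw [show -z.2 - -z.1 = z.1 - z.2 by ring, show -z.1 - -z.2 = z.2 - z.1 by ring,
    show -(-z.2 + -z.1) = z.2 + z.1 by ring, show -z.2 + -z.1 = -(z.2 + z.1) by ring]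
  ring

lemma invariantQ_eq_invariantP_swap (ρ q p : ℝ) : invariantQ ρ (q, p) = invariantP ρ (p, q) := by
  simp only [invariantQ, invariantP]
  rw [add_comm q p]
  ring

/-- On a vertical line the two points of a level curve have ordinates with sum `force ρ q`;
the map is the composition of such an exchange with its analogue on horizontal lines, up to
central symmetries. -/
lemma invariant_halfStep {ρ : ℝ} (hρ : 0 < ρ) (q p : ℝ) :
    invariant ρ (q, force ρ q - p) = invariant ρ (q, p) := by
  have ha := Real.exp_pos q
  have hb := Real.exp_pos p
  simp only [invariant]
  simp only [neg_add, neg_sub, Real.exp_add, Real.exp_sub, Real.exp_neg, exp_force hρ]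
  field_simp
  ring

lemma invariant_map {ρ : ℝ} (hρ : 0 < ρ) (z : ℝ × ℝ) :
    invariant ρ (map ρ z) = invariant ρ z := by
  rw [map, newQ_eq]
  have h1 : invariant ρ (z.1, -newP ρ z) = invariant ρ z := by
    rw [newP_eq, neg_sub]; exact invariant_halfStep hρ _ _
  have h2 := invariant_halfStep hρ (newP ρ z) (-z.1)
  have h3 := invariant_neg ρ (z.1, -newP ρ z)
  simp only [Prod.neg_mk, neg_neg] at h3
  rw [← h1, ← h3, ← invariant_swap, ← invariant_swap ρ (-z.1), ← h2, sub_neg_eq_add, add_comm]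

lemma invariantP_eq {ρ : ℝ} (hρ : 0 < ρ) (q p : ℝ) :
    invariantP ρ (q, p) = (1 + ρ * Real.exp q) ^ 2 * Real.exp (-q) * Real.exp (-p) *
      (Real.exp (2 * p) - Real.exp (force ρ q)) := by
  have ha := Real.exp_pos q
  have hb := Real.exp_pos p
  simp only [invariantP]
  simp only [two_mul, neg_add, Real.exp_add, Real.exp_sub, Real.exp_neg, exp_force hρ]
  field_simp
  ring

lemma invariantP_neg_iff {ρ : ℝ} (hρ : 0 < ρ) (q p : ℝ) :
    invariantP ρ (q, p) < 0 ↔ 2 * p < force ρ q := by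
  have h : 0 < (1 + ρ * Real.exp q) ^ 2 * Real.exp (-q) * Real.exp (-p) := by positivity
  rw [invariantP_eq hρ, ← Real.exp_lt_exp (x := 2 * p), ← sub_neg (a := Real.exp (2 * p))]
  exact ⟨fun h' => by nlinarith, fun h' => by nlinarith⟩

lemma invariantP_pos_iff {ρ : ℝ} (hρ : 0 < ρ) (q p : ℝ) :
    0 < invariantP ρ (q, p) ↔ force ρ q < 2 * p := by
  have h : 0 < (1 + ρ * Real.exp q) ^ 2 * Real.exp (-q) * Real.exp (-p) := by positivity
  rw [invariantP_eq hρ, ← Real.exp_lt_exp (y := 2 * p), ← sub_pos (a := Real.exp (2 * p))]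
  exact ⟨fun h' => by nlinarith, fun h' => by nlinarith⟩

lemma invariantP_sq {ρ : ℝ} (z : ℝ × ℝ) :
    invariantP ρ z ^ 2 = radicand ρ (invariant ρ z) z.1 := by
  have ha := Real.exp_pos z.1
  have hb := Real.exp_pos z.2
  simp only [invariantP, radicand, invariant]
  simp only [neg_add, Real.exp_add, Real.exp_sub, Real.exp_neg]
  field_simp
  ring

lemma invariant_eq_cosh (ρ : ℝ) (z : ℝ × ℝ) : invariant ρ z =
    2 * Real.cosh (z.2 - z.1) + 4 * ρ * (Real.cosh z.2 + Real.cosh z.1)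
      + 2 * ρ ^ 2 * Real.cosh (z.2 + z.1) := by
  simp only [invariant, Real.cosh_eq, neg_sub]
  ring

lemma lt_invariant {ρ : ℝ} (hρ : 0 < ρ) {z : ℝ × ℝ} (hz : z ≠ 0) :
    2 * ρ ^ 2 + 8 * ρ + 2 < invariant ρ z := by
  rw [invariant_eq_cosh]
  have h1 := Real.one_le_cosh (z.2 - z.1)
  have h2 := Real.one_le_cosh (z.2 + z.1)
  have h3 := Real.one_le_cosh z.1
  have h4 := Real.one_le_cosh z.2
  have h5 : 2 < Real.cosh z.2 + Real.cosh z.1 := by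
    by_cases hq : z.1 = 0
    · have : z.2 ≠ 0 := fun hp => hz (Prod.ext hq hp)
      linarith [Real.one_lt_cosh.2 this]
    · linarith [Real.one_lt_cosh.2 hq]
  nlinarith [mul_lt_mul_of_pos_left h5 hρ, mul_le_mul_of_nonneg_left h2 (sq_nonneg ρ)]

lemma mem_energyDomain_of_lt {ρ P : ℝ} (hρ : 0 < ρ) (h6 : ρ + 1 / ρ ≤ 6)
    (hP : 2 * ρ ^ 2 + 8 * ρ + 2 < P) : P ∈ energyDomain ρ := by
  refine ⟨hP, ?_⟩
  have : (1 + ρ) ^ 2 * (ρ + 1 / ρ - 4) ≤ (1 + ρ) ^ 2 * 2 := by gcongr; linarith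
  nlinarith

lemma radicand_eq_cosh (ρ P q : ℝ) : radicand ρ P q =
    (2 * ρ ^ 2 + P + 2) * (P - 2 * ρ ^ 2 - 2 - 8 * ρ * Real.cosh q) := by
  rw [radicand, Real.cosh_eq]; ring

lemma radicand_neg (ρ P q : ℝ) : radicand ρ P (-q) = radicand ρ P q := by
  rw [radicand_eq_cosh, radicand_eq_cosh, Real.cosh_neg]

lemma radicand_anti {ρ P q x : ℝ} (hρ : 0 < ρ) (hP : 2 * ρ ^ 2 + 8 * ρ + 2 < P)
    (h : |q| ≤ |x|) : radicand ρ P x ≤ radicand ρ P q := by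
  rw [radicand_eq_cosh, radicand_eq_cosh]
  have := Real.cosh_le_cosh.2 h
  gcongr
  nlinarith [sq_nonneg ρ]

lemma continuous_radicand (ρ P : ℝ) : Continuous (radicand ρ P) := by
  unfold radicand; fun_prop

/-- The starting point `(0, log Δ)` on the level curve `invariant = P`. -/
def startPoint (ρ P : ℝ) : ℝ × ℝ := (0, Real.log (Delta ρ P))

section Start

variable {ρ P : ℝ} (hρ : 0 < ρ) (hP : 2 * ρ ^ 2 + 8 * ρ + 2 < P)
include hρ hP

lemma Delta_spec : 0 < Delta ρ P ∧ Delta ρ P < 1 ∧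
    (1 + ρ) ^ 2 * (Delta ρ P ^ 2 + 1) = (P - 4 * ρ) * Delta ρ P := by
  set S := √((2 * ρ ^ 2 + P + 2) * (P - 2 * ρ ^ 2 - 8 * ρ - 2)) with hS
  have hM : 0 < (1 + ρ) ^ 2 := by positivity
  have hpos : 0 < (2 * ρ ^ 2 + P + 2) * (P - 2 * ρ ^ 2 - 8 * ρ - 2) :=
    mul_pos (by nlinarith) (by linarith)
  have hSsq : S ^ 2 = (P - 4 * ρ) ^ 2 - 4 * ((1 + ρ) ^ 2) ^ 2 := by
    rw [hS, Real.sq_sqrt hpos.le]; ring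
  have hS0 : 0 < S := Real.sqrt_pos.2 hpos
  have hN : 2 * (1 + ρ) ^ 2 < P - 4 * ρ := by linarith
  have hD : Delta ρ P = (P - 4 * ρ - S) / (2 * (1 + ρ) ^ 2) := rfl
  have h2M : 0 < 2 * (1 + ρ) ^ 2 := by positivity
  refine ⟨?_, ?_, ?_⟩
  · rw [hD]
    refine div_pos ?_ h2M
    nlinarith [sq_nonneg ((1 + ρ) ^ 2)]
  · rw [hD, div_lt_one h2M]
    nlinarith
  · rw [hD]
    field_simp
    nlinarith

lemma invariant_startPoint : invariant ρ (startPoint ρ P) = P := by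
  obtain ⟨h0, -, h2⟩ := Delta_spec hρ hP
  simp only [startPoint, invariant, sub_zero, zero_sub, add_zero, neg_zero, Real.exp_zero,
    Real.exp_neg, Real.exp_log h0]
  field_simp
  nlinarith

lemma map_startPoint : map ρ (startPoint ρ P) = (qStep ρ P, Real.log (Delta ρ P)) := by
  obtain ⟨h0, -, -⟩ := Delta_spec hρ hP
  rw [startPoint, map_eq_iff, force_zero hρ, sub_zero, zero_add]
  refine ⟨rfl, ?_⟩
  rw [qStep, force, Real.exp_log h0]

lemma invariantP_startPoint_neg : invariantP ρ (startPoint ρ P) < 0 := by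
  obtain ⟨h0, h1, -⟩ := Delta_spec hρ hP
  rw [startPoint, invariantP_neg_iff hρ, force_zero hρ]
  linarith [Real.log_neg h0 h1]

end Start

/-- Inside the energy domain the step from `q = 0` stays on the lower branch. -/
lemma invariantP_map_startPoint_neg {ρ P : ℝ} (hρ : 0 < ρ) (hP : P ∈ energyDomain ρ) :
    invariantP ρ (map ρ (startPoint ρ P)) < 0 := by
  obtain ⟨h0, h1, h2⟩ := Delta_spec hρ hP.1
  have hD := hP.2
  rw [map_startPoint hρ hP.1, invariantP_neg_iff hρ]
  set D := Delta ρ P with hDd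
  have e1 : Real.exp (qStep ρ P) = ((ρ + D) / (1 + ρ * D)) ^ 2 := by
    have : qStep ρ P = force ρ (Real.log D) := by rw [qStep, force, Real.exp_log h0]
    rw [this, exp_force hρ, Real.exp_log h0]
  rw [force]
  refine mul_lt_mul_of_pos_left ?_ two_pos
  refine Real.log_lt_log h0 ?_
  rw [e1, lt_div_iff₀ (by positivity)]
  have key : 0 < D ^ 2 + 1 - (ρ + 1 / ρ - 4) * D := by
    have : 0 < (1 + ρ) ^ 2 * (D ^ 2 + 1 - (ρ + 1 / ρ - 4) * D) := by
      have := mul_lt_mul_of_pos_right hD h0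
      rw [mul_sub, h2]; nlinarith
    exact pos_of_mul_pos_right this (by positivity)
  have key2 : 0 < ρ * (D ^ 2 + 1) - (ρ ^ 2 + 1 - 4 * ρ) * D := by
    have := mul_pos hρ key
    have e : ρ * (D ^ 2 + 1 - (ρ + 1 / ρ - 4) * D)
        = ρ * (D ^ 2 + 1) - (ρ ^ 2 + 1 - 4 * ρ) * D := by field_simp
    rwa [e] at this
  have h3 := mul_pos (mul_pos (sub_pos.2 h1) (show 0 < 1 + ρ by positivity)) key2
  rw [← sub_pos]
  have : ρ + ((ρ + D) / (1 + ρ * D)) ^ 2 - D * (1 + ρ * ((ρ + D) / (1 + ρ * D)) ^ 2)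
      = (1 - D) * (1 + ρ) * (ρ * (D ^ 2 + 1) - (ρ ^ 2 + 1 - 4 * ρ) * D) / (1 + ρ * D) ^ 2 := by
    field_simp
    ring
  rw [this]
  positivity

lemma radicand_pos_of_invariantP_ne_zero {ρ : ℝ} {z : ℝ × ℝ} (h : invariantP ρ z ≠ 0) :
    0 < radicand ρ (invariant ρ z) z.1 := by
  rw [← invariantP_sq]; positivity

lemma radicand_pos_of_mem_uIcc {ρ P a b q : ℝ} (hρ : 0 < ρ) (hP : 2 * ρ ^ 2 + 8 * ρ + 2 < P)
    (ha : 0 < radicand ρ P a) (hb : 0 < radicand ρ P b) (hq : q ∈ Set.uIcc a b) :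
    0 < radicand ρ P q := by
  have : |q| ≤ |a| ∨ |q| ≤ |b| := by
    rcases Set.mem_uIcc.1 hq with ⟨h1, h2⟩ | ⟨h1, h2⟩ <;> rcases le_total 0 q with h0 | h0
    · right; rw [abs_of_nonneg h0, abs_of_nonneg (h0.trans h2)]; exact h2
    · left; rw [abs_of_nonpos h0, abs_of_nonpos (h1.trans h0)]; linarith
    · left; rw [abs_of_nonneg h0, abs_of_nonneg (h0.trans h2)]; exact h2
    · right; rw [abs_of_nonpos h0, abs_of_nonpos (h1.trans h0)]; linarith
  rcases this with h | h
  · exact ha.trans_le (radicand_anti hρ hP h)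
  · exact hb.trans_le (radicand_anti hρ hP h)

lemma radicand_pos_of_mem_step {ρ P q : ℝ} (hρ : 0 < ρ) (hP : P ∈ energyDomain ρ)
    (hq : q ∈ Set.uIcc 0 (qStep ρ P)) : 0 < radicand ρ P q := by
  have h1 := radicand_pos_of_invariantP_ne_zero (invariantP_startPoint_neg hρ hP.1).ne
  have h2 := radicand_pos_of_invariantP_ne_zero (invariantP_map_startPoint_neg hρ hP).ne
  rw [invariant_map hρ, invariant_startPoint hρ hP.1, map_startPoint hρ hP.1] at h2
  rw [invariant_startPoint hρ hP.1] at h1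
  exact radicand_pos_of_mem_uIcc hρ hP.1 h1 h2 hq

/-! ### The Hamiltonian flow of the invariant -/

/-- The Hamiltonian vector field of the invariant. -/
def hamField (ρ : ℝ) (z : ℝ × ℝ) : ℝ × ℝ := (invariantP ρ z, -invariantQ ρ z)

/-- A complete integral curve of the Hamiltonian vector field of the invariant. -/
def IsOrbit (ρ : ℝ) (γ : ℝ → ℝ × ℝ) : Prop := ∀ t, HasDerivAt γ (hamField ρ (γ t)) t

lemma contDiff_hamField (ρ : ℝ) : ContDiff ℝ ∞ (hamField ρ) :=
  (contDiff_invariantP ρ).prodMk (contDiff_invariantQ ρ).neg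

lemma hamField_neg (ρ : ℝ) (z : ℝ × ℝ) : hamField ρ (-z) = -hamField ρ z := by
  have h : invariantQ ρ (-z) = -invariantQ ρ z := by
    obtain ⟨q, p⟩ := z
    rw [Prod.neg_mk, invariantQ_eq_invariantP_swap, ← Prod.neg_mk, invariantP_neg,
      invariantQ_eq_invariantP_swap]
  simp [hamField, invariantP_neg, h]

lemma abs_le_invariant {ρ : ℝ} (hρ : 0 < ρ) (z : ℝ × ℝ) :
    2 * ρ * ‖z‖ ≤ invariant ρ z := by
  have h : ∀ x : ℝ, |x| ≤ Real.exp x + Real.exp (-x) := fun x => by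
    rcases abs_cases x with ⟨h, -⟩ | ⟨h, -⟩ <;> rw [h]
    · linarith [Real.add_one_le_exp x, Real.exp_pos (-x)]
    · linarith [Real.add_one_le_exp (-x), Real.exp_pos x]
  have h' : ‖z‖ ≤ Real.exp z.2 + Real.exp z.1 + Real.exp (-z.2) + Real.exp (-z.1) := by
    rw [Prod.norm_def, Real.norm_eq_abs, Real.norm_eq_abs]
    refine max_le ?_ ?_
    · linarith [h z.1, Real.exp_pos z.2, Real.exp_pos (-z.2)]
    · linarith [h z.2, Real.exp_pos z.1, Real.exp_pos (-z.1)]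
  have := mul_le_mul_of_nonneg_left h' (show 0 ≤ 2 * ρ by positivity)
  rw [invariant]
  have : 0 ≤ ρ ^ 2 * (Real.exp (z.2 + z.1) + Real.exp (-(z.2 + z.1))) := by positivity
  linarith [Real.exp_pos (z.2 - z.1), Real.exp_pos (z.1 - z.2)]

lemma mem_closedBall_of_invariant_le {ρ C : ℝ} (hρ : 0 < ρ) {z : ℝ × ℝ}
    (h : invariant ρ z ≤ C) : z ∈ Metric.closedBall (0 : ℝ × ℝ) (C / (2 * ρ)) := by
  rw [mem_closedBall_zero_iff, le_div_iff₀ (by positivity)]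
  linarith [abs_le_invariant hρ z]

lemma exists_bump (B : ℝ) : ∃ χ : ℝ × ℝ → ℝ, ContDiff ℝ ∞ χ ∧ HasCompactSupport χ ∧
    ∀ z ∈ Metric.closedBall (0 : ℝ × ℝ) B, χ z = 1 := by
  obtain ⟨f, hf⟩ : ∃ f : ContDiffBump (0 : ℝ × ℝ), B ≤ f.rIn :=
    ⟨⟨max B 1, max B 1 + 1, by positivity, by linarith⟩, le_max_left _ _⟩
  exact ⟨f, f.contDiff, f.hasCompactSupport,
    fun z hz => f.one_of_mem_closedBall (Metric.closedBall_subset_closedBall hf hz)⟩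

/-- A compactly supported modification of the Hamiltonian vector field, tangent to the same level
curves; it has complete integral curves. -/
lemma exists_cutoff_hamField (ρ B : ℝ) : ∃ (χ : ℝ × ℝ → ℝ) (K L : NNReal),
    LipschitzWith K (fun z => χ z • hamField ρ z) ∧ (∀ z, ‖χ z • hamField ρ z‖ ≤ L) ∧
      ∀ z ∈ Metric.closedBall (0 : ℝ × ℝ) B, χ z = 1 := by
  obtain ⟨χ, hχ, hχc, h1⟩ := exists_bump B
  have hs : ContDiff ℝ ∞ (fun z => χ z • hamField ρ z) := hχ.smul (contDiff_hamField ρ)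
  have hc : HasCompactSupport (fun z => χ z • hamField ρ z) := hχc.smul_right
  obtain ⟨K, hK⟩ := hs.lipschitzWith_of_hasCompactSupport hc (by simp)
  obtain ⟨L, hL⟩ := hc.exists_bound_of_continuous hs.continuous
  exact ⟨χ, K, L.toNNReal, hK, fun z => (hL z).trans (Real.le_coe_toNNReal L), h1⟩

lemma exists_global_solution {v : ℝ × ℝ → ℝ × ℝ} {K L : NNReal} (hK : LipschitzWith K v)
    (hL : ∀ z, ‖v z‖ ≤ L) (z : ℝ × ℝ) :
    ∃ γ : ℝ → ℝ × ℝ, γ 0 = z ∧ ∀ t, HasDerivAt γ (v (γ t)) t := by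
  have hloc : ∀ T : ℝ, ∃ α : ℝ → ℝ × ℝ, 0 < T → α 0 = z ∧
      ∀ t ∈ Set.Ioo (-T) T, HasDerivAt α (v (α t)) t := by
    intro T
    by_cases hT : 0 < T
    · have h0 : (0 : ℝ) ∈ Set.Icc (-T) T := ⟨by linarith, hT.le⟩
      have hPL : IsPicardLindelof (fun _ => v) (⟨0, h0⟩ : Set.Icc (-T) T) z
          (L * T.toNNReal) 0 L K :=
        IsPicardLindelof.of_time_independent (fun x _ => hL x) hK.lipschitzOnWith
          (by simp [hT.le])
      obtain ⟨α, h1, h2⟩ := hPL.exists_eq_forall_mem_Icc_hasDerivWithinAt₀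
      exact ⟨α, fun _ => ⟨h1, fun t ht => (h2 t (Set.Ioo_subset_Icc_self ht)).hasDerivAt
        (Icc_mem_nhds ht.1 ht.2)⟩⟩
    · exact ⟨fun _ => z, fun h => absurd h hT⟩
  choose α hα using hloc
  have heq : ∀ S T : ℝ, 0 < S → S ≤ T → Set.EqOn (α S) (α T) (Set.Ioo (-S) S) := by
    intro S T hS hST
    refine ODE_solution_unique_of_mem_Ioo (v := fun _ => v) (s := fun _ => Set.univ)
      (fun _ _ => hK.lipschitzOnWith) (t₀ := 0) ⟨by linarith, hS⟩
      (fun t ht => ⟨(hα S hS).2 t ht, trivial⟩)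
      (fun t ht => ⟨(hα T (hS.trans_le hST)).2 t ⟨by linarith [ht.1], by linarith [ht.2]⟩,
        trivial⟩) ?_
    rw [(hα S hS).1, (hα T (hS.trans_le hST)).1]
  refine ⟨fun t => α (|t| + 1) t, by simpa using (hα 1 one_pos).1, fun t => ?_⟩
  have hpos : 0 < |t| + 2 := by positivity
  have ht : t ∈ Set.Ioo (-(|t| + 1)) (|t| + 1) := abs_lt.1 (lt_add_one _)
  have hev : (fun t => α (|t| + 1) t) =ᶠ[𝓝 t] α (|t| + 2) := by
    have : ∀ᶠ s in 𝓝 t, |s| < |t| + 1 :=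
      continuous_abs.continuousAt.eventually_lt continuousAt_const (lt_add_one _)
    filter_upwards [this] with s hs
    exact heq (|s| + 1) (|t| + 2) (by positivity) (by linarith) (abs_lt.1 (lt_add_one _))
  have h1 := ((hα _ hpos).2 t ⟨by linarith [ht.1], by linarith [ht.2]⟩).congr_of_eventuallyEq hev
  have h2 : α (|t| + 2) t = α (|t| + 1) t := hev.self_of_nhds.symm
  rw [h2] at h1
  exact h1

lemma invariant_const_of_hasDerivAt {ρ : ℝ} {γ : ℝ → ℝ × ℝ} {c : ℝ → ℝ}
    (h : ∀ t, HasDerivAt γ (c t • hamField ρ (γ t)) t) (s t : ℝ) :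
    invariant ρ (γ s) = invariant ρ (γ t) := by
  have hd : ∀ t, HasDerivAt (fun s => invariant ρ (γ s)) 0 t := fun t =>
    (hasDerivAt_invariant_comp ρ (h t)).congr_deriv (by simp [hamField]; ring)
  exact is_const_of_deriv_eq_zero (fun t => (hd t).differentiableAt) (fun t => (hd t).deriv) s t

lemma IsOrbit.invariant_eq {ρ : ℝ} {γ : ℝ → ℝ × ℝ} (h : IsOrbit ρ γ) (s t : ℝ) :
    invariant ρ (γ s) = invariant ρ (γ t) :=
  invariant_const_of_hasDerivAt (c := fun _ => 1) (fun t => by simpa using h t) s t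

lemma exists_orbit {ρ : ℝ} (hρ : 0 < ρ) (z : ℝ × ℝ) : ∃ γ, IsOrbit ρ γ ∧ γ 0 = z := by
  obtain ⟨χ, K, L, hK, hL, h1⟩ := exists_cutoff_hamField ρ (invariant ρ z / (2 * ρ))
  obtain ⟨γ, h0, hγ⟩ := exists_global_solution hK hL z
  refine ⟨γ, fun t => ?_, h0⟩
  have hI := invariant_const_of_hasDerivAt (c := fun t => χ (γ t)) hγ t 0
  have := hγ t
  rwa [h1 (γ t) (mem_closedBall_of_invariant_le hρ (by rw [hI, h0])), one_smul] at this

lemma lipschitzOn_hamField (ρ B : ℝ) : ∃ K : NNReal,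
    LipschitzOnWith K (hamField ρ) (Metric.closedBall (0 : ℝ × ℝ) B) := by
  obtain ⟨χ, K, L, hK, -, h1⟩ := exists_cutoff_hamField ρ B
  refine ⟨K, fun x hx y hy => ?_⟩
  simpa [h1 x hx, h1 y hy] using hK x y

lemma IsOrbit.eq_of_eq {ρ : ℝ} (hρ : 0 < ρ) {γ δ : ℝ → ℝ × ℝ} (hγ : IsOrbit ρ γ)
    (hδ : IsOrbit ρ δ) {t₀ : ℝ} (h : γ t₀ = δ t₀) : γ = δ := by
  obtain ⟨K, hK⟩ := lipschitzOn_hamField ρ (invariant ρ (γ t₀) / (2 * ρ))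
  refine ODE_solution_unique_univ (v := fun _ => hamField ρ)
    (s := fun _ => Metric.closedBall 0 (invariant ρ (γ t₀) / (2 * ρ)))
    (fun _ => hK) (fun t => ⟨hγ t, ?_⟩) (fun t => ⟨hδ t, ?_⟩) h
  · exact mem_closedBall_of_invariant_le hρ (hγ.invariant_eq _ _).le
  · exact mem_closedBall_of_invariant_le hρ (by rw [h]; exact (hδ.invariant_eq _ _).le)

lemma IsOrbit.comp_add {ρ : ℝ} {γ : ℝ → ℝ × ℝ} (h : IsOrbit ρ γ) (a : ℝ) :
    IsOrbit ρ (fun t => γ (t + a)) := fun t => (h (t + a)).comp_add_const t a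

lemma IsOrbit.neg {ρ : ℝ} {γ : ℝ → ℝ × ℝ} (h : IsOrbit ρ γ) :
    IsOrbit ρ (fun t => -γ t) := fun t => by
  rw [hamField_neg]; exact (h t).neg

/-- The map is symplectic and preserves the invariant, so that it preserves the Hamiltonian
vector field of the invariant. -/
lemma fderiv_map_hamField {ρ : ℝ} (hρ : 0 < ρ) (z : ℝ × ℝ) :
    fderiv ℝ (map ρ) z (hamField ρ z) = hamField ρ (map ρ z) := by
  obtain ⟨a, b, A, hA, hu⟩ := hasFDerivAt_map hρ z
  have hI : ∀ u, invariantQ ρ (map ρ z) * (A u).1 + invariantP ρ (map ρ z) * (A u).2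
      = invariantQ ρ z * u.1 + invariantP ρ z * u.2 := fun u => by
    have h1 := ((contDiff_invariant ρ).differentiable (by simp) (map ρ z)).hasFDerivAt.comp z hA
    have h2 := ((contDiff_invariant ρ).differentiable (by simp) z).hasFDerivAt
    rw [show invariant ρ ∘ map ρ = invariant ρ from funext (invariant_map hρ)] at h1
    have h3 := congrArg (fun L : ℝ × ℝ →L[ℝ] ℝ => L u) (h1.unique h2)
    simpa [fderiv_invariant] using h3
  rw [hA.fderiv, hu]
  have h1 := hI (1, 0)
  have h2 := hI (0, 1)
  simp only [hu] at h1 h2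
  simp only [hamField]
  ext
  · simp only; linear_combination b * h1 + (a * b - 1) * h2
  · simp only; linear_combination h1 + a * h2

lemma IsOrbit.map {ρ : ℝ} (hρ : 0 < ρ) {γ : ℝ → ℝ × ℝ} (h : IsOrbit ρ γ) :
    IsOrbit ρ (fun t => MKdV.map ρ (γ t)) := fun t => by
  have hd := ((contDiff_map hρ).differentiable (by simp) (γ t)).hasFDerivAt
  have := hd.comp_hasDerivAt t (h t)
  rwa [fderiv_map_hamField hρ] at this

/-- Every orbit rotates around the origin with angular velocity at least `4 ρ`, so that it
meets the axis `q = 0`. -/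
lemma IsOrbit.exists_fst_eq_zero {ρ : ℝ} (hρ : 0 < ρ) {γ : ℝ → ℝ × ℝ} (h : IsOrbit ρ γ) :
    ∃ t, (γ t).1 = 0 := by
  by_contra! hne
  have hsinh : ∀ x : ℝ, x * x ≤ x * Real.sinh x := fun x => by
    rcases le_total 0 x with hx | hx
    · exact mul_le_mul_of_nonneg_left (Real.self_le_sinh_iff.2 hx) hx
    · exact mul_le_mul_of_nonpos_left (Real.sinh_le_self_iff.2 hx) hx
  have hconv : ∀ z : ℝ × ℝ, 4 * ρ * (z.1 ^ 2 + z.2 ^ 2) ≤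
      z.1 * invariantQ ρ z + z.2 * invariantP ρ z := fun z => by
    have e : z.1 * invariantQ ρ z + z.2 * invariantP ρ z =
        2 * ((z.2 - z.1) * Real.sinh (z.2 - z.1))
          + 4 * ρ * (z.1 * Real.sinh z.1 + z.2 * Real.sinh z.2)
          + 2 * ρ ^ 2 * ((z.2 + z.1) * Real.sinh (z.2 + z.1)) := by
      simp only [invariantQ, invariantP, Real.sinh_eq, neg_sub]; ring
    rw [e]
    have h1 := hsinh (z.2 - z.1)
    have h2 := hsinh (z.2 + z.1)
    have h3 := mul_le_mul_of_nonneg_left (add_le_add (hsinh z.1) (hsinh z.2))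
      (show 0 ≤ 4 * ρ by positivity)
    have h4 := mul_le_mul_of_nonneg_left h2 (show 0 ≤ 2 * ρ ^ 2 by positivity)
    nlinarith [mul_self_nonneg (z.2 - z.1), mul_nonneg (sq_nonneg ρ) (mul_self_nonneg (z.2 + z.1))]
  set θ : ℝ → ℝ := fun t => Real.arctan ((γ t).2 / (γ t).1) with hθ
  have hd : ∀ t, HasDerivAt θ (-((γ t).1 * invariantQ ρ (γ t) + (γ t).2 * invariantP ρ (γ t)) /
      ((γ t).1 ^ 2 + (γ t).2 ^ 2)) t := fun t => by
    have hq : HasDerivAt (fun s => (γ s).1) (hamField ρ (γ t)).1 t := (h t).fst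
    have hp : HasDerivAt (fun s => (γ s).2) (hamField ρ (γ t)).2 t := (h t).snd
    have := (hp.div hq (hne t)).arctan
    refine this.congr_deriv ?_
    have h0 := hne t
    have h1 : (γ t).1 ^ 2 + (γ t).2 ^ 2 ≠ 0 := by positivity
    simp only [hamField, Pi.div_apply]
    field_simp
    ring
  have hle : ∀ t, deriv θ t ≤ -(4 * ρ) := fun t => by
    rw [(hd t).deriv, div_le_iff₀ (by have := hne t; positivity)]
    linarith [hconv (γ t)]
  have hmv := (convex_univ (𝕜 := ℝ) (E := ℝ)).image_sub_le_mul_sub_of_deriv_le (f := θ)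
    (fun t _ => (hd t).continuousAt.continuousWithinAt)
    (fun t _ => (hd t).differentiableAt.differentiableWithinAt)
    (fun t _ => hle t) 0 trivial (Real.pi / (4 * ρ)) trivial (by positivity)
  have e : -(4 * ρ) * (Real.pi / (4 * ρ) - 0) = -Real.pi := by field_simp; ring
  rw [e] at hmv
  have := Real.arctan_lt_pi_div_two ((γ 0).2 / (γ 0).1)
  have := Real.neg_pi_div_two_lt_arctan ((γ (Real.pi / (4 * ρ))).2 / (γ (Real.pi / (4 * ρ))).1)
  simp only [hθ] at hmv
  linarith

/-! ### Time along a branch of a level curve -/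

/-- The lower branch `∂I/∂p < 0` of the level curve `invariant = P` as a graph over the
`q`-axis. -/
def lowerBranch (ρ P q : ℝ) : ℝ × ℝ :=
  (q, Real.log ((P - 2 * ρ * (Real.exp q + Real.exp (-q)) - √(radicand ρ P q)) /
    (2 * (Real.exp (-q) + 2 * ρ + ρ ^ 2 * Real.exp q))))

section Branch

variable {ρ P : ℝ} (hρ : 0 < ρ) (hP : 2 * ρ ^ 2 + 8 * ρ + 2 < P)
include hρ hP

omit hP in
lemma eq_lowerBranch {z : ℝ × ℝ} (hz : invariant ρ z = P) (h : invariantP ρ z < 0) :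
    z = lowerBranch ρ P z.1 := by
  have hs : √(radicand ρ P z.1) = -invariantP ρ z := by
    rw [← hz, ← invariantP_sq, Real.sqrt_sq_eq_abs, abs_of_neg h]
  ext
  · rfl
  · rw [lowerBranch, hs, ← hz]
    simp only
    nth_rw 1 [← Real.log_exp z.2]
    congr 1
    rw [eq_comm, div_eq_iff (by positivity)]
    simp only [invariant, invariantP]
    simp only [neg_add, Real.exp_add, Real.exp_sub, Real.exp_neg]
    field_simp
    ring

lemma lowerBranch_spec {q : ℝ} (hR : 0 < radicand ρ P q) :
    0 < P - 2 * ρ * (Real.exp q + Real.exp (-q)) - √(radicand ρ P q) ∧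
    invariant ρ (lowerBranch ρ P q) = P ∧
      invariantP ρ (lowerBranch ρ P q) = -√(radicand ρ P q) := by
  set S := √(radicand ρ P q) with hS
  have hS0 : 0 < S := Real.sqrt_pos.2 hR
  have hSsq : S ^ 2 = radicand ρ P q := Real.sq_sqrt hR.le
  set a := Real.exp q with ha
  have ha0 : 0 < a := Real.exp_pos q
  have hprod : (P - 2 * ρ * (a + a⁻¹)) ^ 2 - S ^ 2
      = 4 * ((a⁻¹ + 2 * ρ + ρ ^ 2 * a) * (a + 2 * ρ + ρ ^ 2 * a⁻¹)) := by
    rw [hSsq, radicand, Real.exp_neg, ← ha]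
    field_simp
    ring
  have hN : 0 < P - 2 * ρ * (a + a⁻¹) := by
    have h1 : 0 < 2 * ρ ^ 2 + P + 2 := by nlinarith
    have h2 : 0 < P - 2 * ρ ^ 2 - 4 * ρ * a - 4 * ρ * a⁻¹ - 2 := by
      rw [radicand, Real.exp_neg, ← ha] at hR
      exact pos_of_mul_pos_right hR h1.le
    have h3 : 0 < ρ * (a + a⁻¹) := by positivity
    nlinarith [sq_nonneg ρ]
  have hpos : 0 < P - 2 * ρ * (a + a⁻¹) - S := by
    have h4 : 0 < 4 * ((a⁻¹ + 2 * ρ + ρ ^ 2 * a) * (a + 2 * ρ + ρ ^ 2 * a⁻¹)) := by positivity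
    nlinarith
  have hA : 0 < a⁻¹ + 2 * ρ + ρ ^ 2 * a := by positivity
  have hlog := Real.exp_log (show 0 < (P - 2 * ρ * (a + a⁻¹) - S) /
    (2 * (a⁻¹ + 2 * ρ + ρ ^ 2 * a)) by positivity)
  have hinv : (Real.exp (Real.log ((P - 2 * ρ * (a + a⁻¹) - S) /
      (2 * (a⁻¹ + 2 * ρ + ρ ^ 2 * a)))))⁻¹ * (a + 2 * ρ + ρ ^ 2 * a⁻¹) =
      (P - 2 * ρ * (a + a⁻¹) + S) / 2 := by
    rw [hlog, inv_div, div_mul_eq_mul_div, div_eq_div_iff hpos.ne' two_ne_zero]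
    linear_combination -hprod
  have hdir : Real.exp (Real.log ((P - 2 * ρ * (a + a⁻¹) - S) /
      (2 * (a⁻¹ + 2 * ρ + ρ ^ 2 * a)))) * (a⁻¹ + 2 * ρ + ρ ^ 2 * a) =
      (P - 2 * ρ * (a + a⁻¹) - S) / 2 := by
    rw [hlog]; field_simp
  rw [Real.exp_neg, ← ha]
  refine ⟨hpos, ?_, ?_⟩
  · simp only [invariant, lowerBranch]
    simp only [neg_add, Real.exp_add, Real.exp_sub, Real.exp_neg, ← hS, ← ha, div_eq_mul_inv] at *
    linear_combination hinv + hdir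
  · simp only [invariantP, lowerBranch]
    simp only [neg_add, Real.exp_add, Real.exp_sub, Real.exp_neg, ← hS, ← ha, div_eq_mul_inv] at *
    linear_combination hdir - hinv

omit hP in
lemma lowerBranch_unique {z w : ℝ × ℝ} (hz : invariant ρ z = P) (h : invariantP ρ z < 0)
    (hw : invariant ρ w = P) (h' : invariantP ρ w < 0) (hzw : z.1 = w.1) : z = w := by
  rw [eq_lowerBranch hρ hz h, eq_lowerBranch hρ hw h', hzw]

lemma hasDerivAt_lowerBranch {q : ℝ} (hR : 0 < radicand ρ P q) :
    HasDerivAt (lowerBranch ρ P)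
      (-(1 / √(radicand ρ P q)) • hamField ρ (lowerBranch ρ P q)) q := by
  obtain ⟨hpos, -, hIp⟩ := lowerBranch_spec hρ hP hR
  have hd : DifferentiableAt ℝ (lowerBranch ρ P) q := by
    have h1 : DifferentiableAt ℝ (fun q => √(radicand ρ P q)) q := by
      refine DifferentiableAt.sqrt ?_ hR.ne'
      unfold radicand; fun_prop
    unfold lowerBranch
    refine differentiableAt_id.prodMk (DifferentiableAt.log (DifferentiableAt.div ?_ ?_ ?_) ?_)
    · exact DifferentiableAt.sub (by fun_prop) h1
    · fun_prop
    · positivity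
    · have : 0 < 2 * (Real.exp (-q) + 2 * ρ + ρ ^ 2 * Real.exp q) := by positivity
      positivity
  have h1 : deriv (lowerBranch ρ P) q = (1, (deriv (lowerBranch ρ P) q).2) := by
    have : HasDerivAt (fun q => (lowerBranch ρ P q).1) (deriv (lowerBranch ρ P) q).1 q :=
      hd.hasDerivAt.fst
    ext
    · exact this.unique (hasDerivAt_id q)
    · rfl
  have h2 := hasDerivAt_invariant_comp ρ hd.hasDerivAt
  have h3 : HasDerivAt (fun s => invariant ρ (lowerBranch ρ P s)) 0 q := by
    refine (hasDerivAt_const q P).congr_of_eventuallyEq ?_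
    filter_upwards [(continuous_radicand ρ P).continuousAt.eventually (lt_mem_nhds hR)] with s hs
    exact (lowerBranch_spec hρ hP hs).2.1
  have h4 := h2.unique h3
  have hS : √(radicand ρ P q) ≠ 0 := (Real.sqrt_pos.2 hR).ne'
  refine hd.hasDerivAt.congr_deriv ?_
  rw [h1] at h4 ⊢
  rw [hIp] at h4
  simp only [hamField, hIp, Prod.smul_mk, smul_eq_mul]
  ext
  · simp only; field_simp
  · simp only at h4 ⊢
    field_simp
    linarith

omit hρ hP in
lemma continuousAt_inv_sqrt_radicand {q : ℝ} (hR : 0 < radicand ρ P q) :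
    ContinuousAt (fun q => 1 / √(radicand ρ P q)) q :=
  continuousAt_const.div (continuous_radicand ρ P).continuousAt.sqrt (Real.sqrt_pos.2 hR).ne'

lemma hasDerivAt_time {a q : ℝ} (ha : 0 < radicand ρ P a) (hR : 0 < radicand ρ P q) :
    HasDerivAt (fun q => ∫ x in a..q, 1 / √(radicand ρ P x)) (1 / √(radicand ρ P q)) q := by
  refine intervalIntegral.integral_hasDerivAt_right ?_ ?_
    (continuousAt_inv_sqrt_radicand hR)
  · refine ContinuousOn.intervalIntegrable fun x hx => ?_
    exact (continuousAt_inv_sqrt_radicand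
      (radicand_pos_of_mem_uIcc hρ hP ha hR hx)).continuousWithinAt
  · have hm : Measurable (fun q => 1 / √(radicand ρ P q)) :=
      measurable_const.div (continuous_radicand ρ P).measurable.sqrt
    exact hm.stronglyMeasurable.stronglyMeasurableAtFilter

/-- Along the lower branch the flow of the invariant takes the time `-∫ dq / √R`, because
`q' = ∂I/∂p = -√R` there. -/
lemma IsOrbit.apply_time {γ : ℝ → ℝ × ℝ} (hγ : IsOrbit ρ γ) (h0 : invariant ρ (γ 0) = P)
    (hlow : invariantP ρ (γ 0) < 0) {q : ℝ} (hR : 0 < radicand ρ P q) :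
    γ (-∫ x in (γ 0).1..q, 1 / √(radicand ρ P x)) = lowerBranch ρ P q := by
  set a := (γ 0).1 with ha
  have hRa : 0 < radicand ρ P a := h0 ▸ radicand_pos_of_invariantP_ne_zero hlow.ne
  -- an interval around `a` and `q` on which the radicand is bounded below
  obtain ⟨Q, hQa, hQq, hRQ⟩ : ∃ Q, |a| < Q ∧ |q| < Q ∧ 0 < radicand ρ P Q := by
    have hm : 0 < radicand ρ P (max |a| |q|) := by
      rcases max_choice |a| |q| with h | h <;> rw [h]
      · exact hRa.trans_le (radicand_anti hρ hP (abs_abs a).le)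
      · exact hR.trans_le (radicand_anti hρ hP (abs_abs q).le)
    have hev := (continuous_radicand ρ P).continuousAt.eventually (lt_mem_nhds hm)
    obtain ⟨Q, hQ1, hQ2⟩ := ((hev.filter_mono nhdsWithin_le_nhds).and
      (self_mem_nhdsWithin (s := Set.Ioi (max |a| |q|)))).exists
    exact ⟨Q, (le_max_left _ _).trans_lt hQ2, (le_max_right _ _).trans_lt hQ2, hQ1⟩
  have hRJ : ∀ x ∈ Set.Ioo (-Q) Q, radicand ρ P Q ≤ radicand ρ P x := fun x hx =>
    radicand_anti hρ hP ((abs_lt.2 hx).le.trans (le_abs_self Q))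
  obtain ⟨K, hK⟩ := lipschitzOn_hamField ρ (P / (2 * ρ))
  have hLip : ∀ x ∈ Set.Ioo (-Q) Q, LipschitzOnWith ((1 / √(radicand ρ P Q)).toNNReal * K)
      (fun y => -(1 / √(radicand ρ P x)) • hamField ρ y)
      (Metric.closedBall (0 : ℝ × ℝ) (P / (2 * ρ))) := by
    intro x hx
    refine LipschitzOnWith.of_dist_le_mul fun y hy y' hy' => ?_
    rw [dist_smul₀, NNReal.coe_mul, mul_assoc]
    refine mul_le_mul ?_ (hK.dist_le_mul y hy y' hy') dist_nonneg (NNReal.coe_nonneg _)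
    rw [norm_neg, Real.norm_of_nonneg (by positivity), Real.coe_toNNReal _ (by positivity)]
    exact one_div_le_one_div_of_le (Real.sqrt_pos.2 hRQ) (Real.sqrt_le_sqrt (hRJ x hx))
  have hEq := ODE_solution_unique_of_mem_Ioo (t₀ := a) hLip (abs_lt.1 hQa)
    (f := fun q => γ (-∫ x in a..q, 1 / √(radicand ρ P x))) (g := lowerBranch ρ P)
    (fun x hx => ⟨?_, ?_⟩) (fun x hx => ⟨?_, ?_⟩) ?_
  · exact hEq (abs_lt.1 hQq)
  · exact (hγ _).scomp x (hasDerivAt_time hρ hP hRa (hRQ.trans_le (hRJ x hx))).neg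
  · exact mem_closedBall_of_invariant_le hρ (by rw [hγ.invariant_eq _ 0, h0])
  · exact hasDerivAt_lowerBranch hρ hP (hRQ.trans_le (hRJ x hx))
  · exact mem_closedBall_of_invariant_le hρ
      (lowerBranch_spec hρ hP (hRQ.trans_le (hRJ x hx))).2.1.le
  · simp only [intervalIntegral.integral_same, neg_zero]
    exact eq_lowerBranch hρ h0 hlow

end Branch

/-! ### The flow interpolates the map -/

section Frequency

variable {ρ : ℝ} (hρ : 0 < ρ)
include hρ

lemma IsOrbit.map_zero_of_start {P : ℝ} (hP : P ∈ energyDomain ρ) {γ : ℝ → ℝ × ℝ}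
    (hγ : IsOrbit ρ γ) (h0 : γ 0 = startPoint ρ P) (t : ℝ) :
    MKdV.map ρ (γ t) = γ (t + frequency ρ P) := by
  have hI : invariant ρ (γ 0) = P := by rw [h0, invariant_startPoint hρ hP.1]
  have h1 := hγ.apply_time hρ hP.1 hI (by rw [h0]; exact invariantP_startPoint_neg hρ hP.1)
    (radicand_pos_of_mem_step hρ hP Set.right_mem_uIcc)
  have h2 : MKdV.map ρ (startPoint ρ P) = lowerBranch ρ P (qStep ρ P) := by
    have := eq_lowerBranch hρ
      ((invariant_map hρ _).trans (invariant_startPoint hρ hP.1))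
      (invariantP_map_startPoint_neg hρ hP)
    rwa [map_startPoint hρ hP.1] at this ⊢
  refine congrFun (IsOrbit.eq_of_eq hρ (hγ.map hρ) (hγ.comp_add (frequency ρ P)) (t₀ := 0) ?_) t
  rw [zero_add, h0, h2, ← h1, h0]
  rfl

/-- The time-`ν(P)` flow of the invariant is the map: this holds at the starting point and
propagates along the level curve, since the map commutes with the flow. -/
theorem IsOrbit.map_eq {P : ℝ} (hP : P ∈ energyDomain ρ) {γ : ℝ → ℝ × ℝ}
    (hγ : IsOrbit ρ γ) (h0 : invariant ρ (γ 0) = P) (t : ℝ) :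
    MKdV.map ρ (γ t) = γ (t + frequency ρ P) := by
  obtain ⟨t₀, ht₀⟩ := hγ.exists_fst_eq_zero hρ
  have hI : invariant ρ (γ t₀) = P := (hγ.invariant_eq _ _).trans h0
  have hR : radicand ρ P 0 ≠ 0 :=
    (radicand_pos_of_mem_step hρ hP Set.left_mem_uIcc).ne'
  have hne : invariantP ρ (γ t₀) ≠ 0 := fun h => hR (by
    have := invariantP_sq (ρ := ρ) (γ t₀)
    rw [h, hI, ht₀] at this
    simpa using this.symm)
  rcases hne.lt_or_gt with h | h
  · have e : γ t₀ = startPoint ρ P := lowerBranch_unique hρ hI h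
      (invariant_startPoint hρ hP.1) (invariantP_startPoint_neg hρ hP.1) ht₀
    have := (hγ.comp_add t₀).map_zero_of_start hρ hP (by simpa using e) (t - t₀)
    simpa [add_right_comm] using this
  · have e : -γ t₀ = startPoint ρ P := lowerBranch_unique hρ
      (by rw [invariant_neg, hI]) (by rw [invariantP_neg]; linarith)
      (invariant_startPoint hρ hP.1) (invariantP_startPoint_neg hρ hP.1) (by simp [ht₀, startPoint])
    have := (hγ.neg.comp_add t₀).map_zero_of_start hρ hP (by simpa using e) (t - t₀)
    simpa [add_right_comm, map_neg hρ] using this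

theorem exists_trajectory {h : ℝ → ℝ} (hh : IsFrequencyAntiderivative ρ h) (z : ℝ × ℝ)
    (hz : invariant ρ z ∈ energyDomain ρ) :
    ∃ γ : ℝ → ℝ × ℝ, IsHamiltonianTrajectory (fun w => h (invariant ρ w)) γ ∧
      γ 0 = z ∧ ∀ t, γ (t + 1) = map ρ (γ t) := by
  obtain ⟨γ, hγ, h0⟩ := exists_orbit hρ z
  set ν := frequency ρ (invariant ρ z) with hν
  have hI : ∀ t, invariant ρ (γ t) = invariant ρ z := fun t => by rw [hγ.invariant_eq t 0, h0]
  refine ⟨fun t => γ (ν * t), fun t => ⟨?_, ?_, ?_⟩, by simpa using h0, fun t => ?_⟩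
  · have h1 := hh _ hz
    rw [← hI (ν * t)] at h1
    exact h1.differentiableAt.comp (γ (ν * t))
      ((contDiff_invariant ρ).differentiable (by simp) (γ (ν * t)))
  · have h1 := hh _ hz
    rw [← hI (ν * t)] at h1
    have hs : HasDerivAt (fun s : ℝ => ((γ (ν * t)).1, s)) (0, 1) (γ (ν * t)).2 :=
      (hasDerivAt_const _ _).prodMk (hasDerivAt_id _)
    have h2 := HasDerivAt.comp (γ (ν * t)).2 (h₂ := h) (by exact h1)
      (hasDerivAt_invariant_comp ρ hs)
    have h4 : HasDerivAt (fun s => (γ s).1) _ (ν * t) := (hγ (ν * t)).fst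
    have h3 := h4.scomp t ((hasDerivAt_id t).const_mul ν)
    refine h3.congr_deriv ?_
    rw [dp, show (fun s => h (invariant ρ ((γ (ν * t)).1, s))) =
      h ∘ fun s => invariant ρ ((γ (ν * t)).1, s) from rfl, h2.deriv, hI]
    simp [hamField, hν]
  · have h1 := hh _ hz
    rw [← hI (ν * t)] at h1
    have hs : HasDerivAt (fun s : ℝ => (s, (γ (ν * t)).2)) (1, 0) (γ (ν * t)).1 :=
      (hasDerivAt_id _).prodMk (hasDerivAt_const _ _)
    have h2 := HasDerivAt.comp (γ (ν * t)).1 (h₂ := h) (by exact h1)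
      (hasDerivAt_invariant_comp ρ hs)
    have h4 : HasDerivAt (fun s => (γ s).2) _ (ν * t) := (hγ (ν * t)).snd
    have h3 := h4.scomp t ((hasDerivAt_id t).const_mul ν)
    refine h3.congr_deriv ?_
    rw [dq, show (fun s => h (invariant ρ (s, (γ (ν * t)).2))) =
      h ∘ fun s => invariant ρ (s, (γ (ν * t)).2) from rfl, h2.deriv, hI]
    simp [hamField, hν]
  · have := hγ.map_eq hρ hz (by rw [h0]) (ν * t)
    simp only
    rw [this, mul_add, mul_one]

end Frequency

/-! ### Independence of the frequency from the starting point -/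

/-- The invariant is strictly convex. -/
lemma invariant_gradient_lt {ρ : ℝ} (hρ : 0 < ρ) {v w : ℝ × ℝ} (h : v ≠ w) :
    invariant ρ v + invariantQ ρ v * (w.1 - v.1) + invariantP ρ v * (w.2 - v.2)
      < invariant ρ w := by
  have hexp : ∀ x y : ℝ, Real.exp x * (1 + (y - x)) ≤ Real.exp y := fun x y => by
    have h1 := mul_le_mul_of_nonneg_left (Real.add_one_le_exp (y - x)) (Real.exp_pos x).le
    rw [← Real.exp_add, add_sub_cancel] at h1
    linarith
  have hexp' : ∀ x y : ℝ, x ≠ y → Real.exp x * (1 + (y - x)) < Real.exp y := fun x y hxy => by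
    have h1 := mul_lt_mul_of_pos_left (Real.add_one_lt_exp (sub_ne_zero.2 hxy.symm))
      (Real.exp_pos x)
    rw [← Real.exp_add, add_sub_cancel] at h1
    linarith
  have h3 : Real.exp v.2 * (1 + (w.2 - v.2)) + Real.exp v.1 * (1 + (w.1 - v.1)) <
      Real.exp w.2 + Real.exp w.1 := by
    by_cases hq : v.1 = w.1
    · have hp : v.2 ≠ w.2 := fun hp => h (Prod.ext hq hp)
      exact add_lt_add_of_lt_of_le (hexp' _ _ hp) (hexp _ _)
    · exact add_lt_add_of_le_of_lt (hexp _ _) (hexp' _ _ hq)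
  have h1 := hexp (v.2 - v.1) (w.2 - w.1)
  have h2 := hexp (v.1 - v.2) (w.1 - w.2)
  have h4 := hexp (-v.2) (-w.2)
  have h5 := hexp (-v.1) (-w.1)
  have h6 := hexp (v.2 + v.1) (w.2 + w.1)
  have h7 := hexp (-(v.2 + v.1)) (-(w.2 + w.1))
  have h8 := mul_lt_mul_of_pos_left (add_lt_add_of_lt_of_le h3 (add_le_add h4 h5))
    (show 0 < 2 * ρ by positivity)
  have h9 := mul_le_mul_of_nonneg_left (add_le_add h6 h7) (sq_nonneg ρ)
  simp only [invariant, invariantQ, invariantP]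
  nlinarith

section

variable {ρ : ℝ} (hρ : 0 < ρ)
include hρ

lemma invariant_partner (q p : ℝ) : invariant ρ (force ρ p - q, p) = invariant ρ (q, p) := by
  rw [← invariant_swap, invariant_halfStep hρ, invariant_swap]

lemma invariantP_map_neg_iff (q p : ℝ) : invariantP ρ (map ρ (q, p)) < 0 ↔
    0 < invariantP ρ (force ρ (force ρ q - p) - q, force ρ q - p) := by
  have h : map ρ (q, p) = -(force ρ (force ρ q - p) - q, force ρ q - p) := by
    rw [Prod.neg_mk, map_eq_iff]
    refine ⟨by ring, ?_⟩
    rw [force_neg hρ]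
    ring
  rw [h, invariantP_neg, neg_lt_zero]

lemma invariantP_halfStep_pos {q p : ℝ} (h : invariantP ρ (q, p) < 0) :
    0 < invariantP ρ (q, force ρ q - p) := by
  rw [invariantP_neg_iff hρ] at h
  rw [invariantP_pos_iff hρ]
  linarith

/-- The condition that a point `(q, a)` of the upper branch and its partner on the same
horizontal line both lie on the upper branch defines an arc of the level curve. -/
lemma partner_pos_of_between {P q₀ a₀ q₁ a₁ q a : ℝ}
    (hI₀ : invariant ρ (q₀, a₀) = P) (hI₁ : invariant ρ (q₁, a₁) = P)
    (hI : invariant ρ (q, a) = P)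
    (h₀ : 0 < invariantP ρ (q₀, a₀)) (h₀' : 0 < invariantP ρ (force ρ a₀ - q₀, a₀))
    (h₁ : 0 < invariantP ρ (q₁, a₁)) (h₁' : 0 < invariantP ρ (force ρ a₁ - q₁, a₁))
    (h : 0 < invariantP ρ (q, a)) (hq : q ∈ Set.uIcc q₀ q₁) :
    0 < invariantP ρ (force ρ a - q, a) := by
  -- the upper branch is concave, so that one of the two given points is not higher than `(q, a)`
  have hlow : ∃ b r, b ≤ a ∧ invariant ρ (r, b) = P ∧ 0 < invariantP ρ (r, b) ∧
      0 < invariantP ρ (force ρ b - r, b) := by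
    by_cases c₀ : a₀ ≤ a
    · exact ⟨a₀, q₀, c₀, hI₀, h₀, h₀'⟩
    by_cases c₁ : a₁ ≤ a
    · exact ⟨a₁, q₁, c₁, hI₁, h₁, h₁'⟩
    exfalso
    push Not at c₀ c₁
    have g₀ := invariant_gradient_lt hρ (v := (q, a)) (w := (q₀, a₀))
      (fun e => by rw [Prod.mk.injEq] at e; linarith [e.2])
    have g₁ := invariant_gradient_lt hρ (v := (q, a)) (w := (q₁, a₁))
      (fun e => by rw [Prod.mk.injEq] at e; linarith [e.2])
    simp only [hI, hI₀, hI₁] at g₀ g₁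
    have m₀ := mul_pos h (sub_pos.2 c₀)
    have m₁ := mul_pos h (sub_pos.2 c₁)
    have n₀ : invariantQ ρ (q, a) * (q₀ - q) < 0 := by linarith
    have n₁ : invariantQ ρ (q, a) * (q₁ - q) < 0 := by linarith
    rcases Set.mem_uIcc.1 hq with ⟨u, v⟩ | ⟨u, v⟩ <;>
      rcases le_total 0 (invariantQ ρ (q, a)) with s | s <;> nlinarith
  obtain ⟨b, r, hb, hIr, hr, hr'⟩ := hlow
  by_contra hv
  push Not at hv
  set x := force ρ a - q with hx
  set r' := force ρ b - r with hr'd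
  have hIx : invariant ρ (x, a) = P := by rw [hx, invariant_partner hρ, hI]
  have hIr' : invariant ρ (r', b) = P := by rw [hr'd, invariant_partner hρ, hIr]
  have g := invariant_gradient_lt hρ (v := (r, b)) (w := (x, a))
    (fun e => by rw [e] at hr; linarith)
  have g' := invariant_gradient_lt hρ (v := (r', b)) (w := (x, a))
    (fun e => by rw [e] at hr'; linarith)
  simp only [hIr, hIr', hIx] at g g'
  have m := mul_nonneg hr.le (sub_nonneg.2 hb)
  have m' := mul_nonneg hr'.le (sub_nonneg.2 hb)
  have n : invariantQ ρ (r, b) * (x - r) < 0 := by linarith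
  have n' : invariantQ ρ (r', b) * (x - r') < 0 := by linarith
  have s1 : r' < r → 0 < invariantQ ρ (r, b) ∧ invariantQ ρ (r', b) < 0 := fun hlt => by
    rw [invariantQ_eq_invariantP_swap, invariantQ_eq_invariantP_swap, invariantP_pos_iff hρ,
      invariantP_neg_iff hρ]
    constructor <;> linarith
  have s2 : r < r' → invariantQ ρ (r, b) < 0 ∧ 0 < invariantQ ρ (r', b) := fun hlt => by
    rw [invariantQ_eq_invariantP_swap, invariantQ_eq_invariantP_swap, invariantP_pos_iff hρ,
      invariantP_neg_iff hρ]
    constructor <;> linarith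
  have s3 : r' = r → invariantQ ρ (r, b) = 0 := fun he => by
    have k1 : ¬ 0 < invariantQ ρ (r, b) := by
      rw [invariantQ_eq_invariantP_swap, invariantP_pos_iff hρ]; linarith
    have k2 : ¬ invariantQ ρ (r, b) < 0 := by
      rw [invariantQ_eq_invariantP_swap, invariantP_neg_iff hρ]; linarith
    exact le_antisymm (not_lt.1 k1) (not_lt.1 k2)
  -- hence `x` lies strictly between `r` and `r'`, inside the level curve at the height `b`
  have hbtw : (r' < x ∧ x < r) ∨ (r < x ∧ x < r') := by
    rcases lt_trichotomy r' r with hlt | heq | hlt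
    · obtain ⟨k1, k2⟩ := s1 hlt
      left
      constructor <;> nlinarith
    · rw [s3 heq] at n; linarith
    · obtain ⟨k1, k2⟩ := s2 hlt
      right
      constructor <;> nlinarith
  have hge : P ≤ invariant ρ (x, b) := by
    rcases hb.eq_or_lt with e | hlt
    · rw [e, hIx]
    · have := invariant_gradient_lt hρ (v := (x, a)) (w := (x, b))
        (fun e => by rw [Prod.mk.injEq] at e; linarith [e.2])
      simp only [hIx, sub_self, mul_zero, add_zero] at this
      nlinarith [mul_nonneg_of_nonpos_of_nonpos hv (sub_nonpos.2 hlt.le)]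
  have k := invariant_gradient_lt hρ (v := (x, b)) (w := (r, b))
    (fun e => by rw [Prod.mk.injEq] at e; rcases hbtw with c | c <;> linarith [e.1])
  have k' := invariant_gradient_lt hρ (v := (x, b)) (w := (r', b))
    (fun e => by rw [Prod.mk.injEq] at e; rcases hbtw with c | c <;> linarith [e.1])
  simp only [hIr, hIr', sub_self, mul_zero, add_zero] at k k'
  rcases hbtw with ⟨c, c'⟩ | ⟨c, c'⟩ <;> nlinarith

lemma time_eq_frequency_of_neg {z : ℝ × ℝ} (hz : invariant ρ z ∈ energyDomain ρ)
    (hlow : invariantP ρ z < 0) (hlow' : invariantP ρ (map ρ z) < 0) :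
    -∫ q in z.1..(map ρ z).1, 1 / √(radicand ρ (invariant ρ z) q) =
      frequency ρ (invariant ρ z) := by
  set P := invariant ρ z with hP
  have hmin := hz.1
  obtain ⟨δ, hδ, h0⟩ := exists_orbit hρ (startPoint ρ P)
  have hI0 : invariant ρ (δ 0) = P := by rw [h0, invariant_startPoint hρ hmin]
  have hlow0 : invariantP ρ (δ 0) < 0 := by rw [h0]; exact invariantP_startPoint_neg hρ hmin
  have hδ1 : (δ 0).1 = 0 := by rw [h0]; rfl
  have hR0 : 0 < radicand ρ P 0 := radicand_pos_of_mem_step hρ hz Set.left_mem_uIcc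
  have hRz : 0 < radicand ρ P z.1 := radicand_pos_of_invariantP_ne_zero hlow.ne
  have hR : ∀ q ∈ Set.uIcc 0 z.1, 0 < radicand ρ P q := fun q hq =>
    radicand_pos_of_mem_uIcc hρ hmin hR0 hRz hq
  set w : ℝ → ℝ × ℝ := fun q =>
    δ (-(∫ x in (0 : ℝ)..q, 1 / √(radicand ρ P x)) + frequency ρ P) with hw
  have hwmap : ∀ q ∈ Set.uIcc 0 z.1, w q = map ρ (lowerBranch ρ P q) := fun q hq => by
    have := hδ.apply_time hρ hmin hI0 hlow0 (hR q hq)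
    rw [hδ1] at this
    rw [hw, ← this, hδ.map_eq hρ hz hI0]
  have hwI : ∀ q, invariant ρ (w q) = P := fun q => (hδ.invariant_eq _ _).trans hI0
  have hzl : lowerBranch ρ P z.1 = z := (eq_lowerBranch hρ rfl hlow).symm
  have h0l : lowerBranch ρ P 0 = startPoint ρ P :=
    (eq_lowerBranch hρ (invariant_startPoint hρ hmin) (invariantP_startPoint_neg hρ hmin)).symm
  -- the images of the points of the lower branch between `q = 0` and `z` are on the lower branch
  have hwlow : ∀ q ∈ Set.uIcc 0 z.1, invariantP ρ (w q) < 0 := fun q hq => by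
    rw [hwmap q hq]
    have b : ∀ x, 0 < radicand ρ P x →
        invariant ρ (x, force ρ x - (lowerBranch ρ P x).2) = P ∧
        0 < invariantP ρ (x, force ρ x - (lowerBranch ρ P x).2) := fun x hx => by
      obtain ⟨-, e1, e2⟩ := lowerBranch_spec hρ hmin hx
      refine ⟨?_, invariantP_halfStep_pos hρ ?_⟩
      · rw [invariant_halfStep hρ]; exact e1
      · have : invariantP ρ (lowerBranch ρ P x) < 0 := by
          rw [e2]; exact neg_lt_zero.2 (Real.sqrt_pos.2 hx)
        exact this
    refine (invariantP_map_neg_iff hρ _ _).2 ?_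
    refine partner_pos_of_between hρ (b 0 hR0).1 (b z.1 hRz).1 (b q (hR q hq)).1 (b 0 hR0).2
      ?_ (b z.1 hRz).2 ?_ (b q (hR q hq)).2 hq
    · refine (invariantP_map_neg_iff hρ _ _).1 ?_
      have := invariantP_map_startPoint_neg hρ hz
      rwa [← h0l] at this
    · refine (invariantP_map_neg_iff hρ _ _).1 ?_
      rwa [← hzl] at hlow'
  have hRw : ∀ q ∈ Set.uIcc 0 z.1, 0 < radicand ρ P (w q).1 := fun q hq => by
    have := radicand_pos_of_invariantP_ne_zero (hwlow q hq).ne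
    rwa [hwI] at this
  -- so along this arc the times to `q` and from the image of `0` to the image grow alike
  have hder : ∀ q ∈ Set.uIcc 0 z.1, HasDerivAt
      (fun q => ∫ x in (0 : ℝ)..(w q).1, 1 / √(radicand ρ P x)) (1 / √(radicand ρ P q)) q := by
    intro q hq
    have h1 : HasDerivAt w (-(1 / √(radicand ρ P q)) • hamField ρ (w q)) q :=
      (hδ _).scomp q ((hasDerivAt_time hρ hmin hR0 (hR q hq)).neg.add_const _)
    have h2 : HasDerivAt (fun q => (w q).1) (-(1 / √(radicand ρ P q)) • hamField ρ (w q)).1 q :=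
      h1.fst
    have h3 := (hasDerivAt_time hρ hmin hR0 (hRw q hq)).comp q h2
    refine h3.congr_deriv ?_
    have h4 : √(radicand ρ P (w q).1) = -invariantP ρ (w q) := by
      rw [← hwI q, ← invariantP_sq, Real.sqrt_sq_eq_abs, abs_of_neg (hwlow q hq)]
    have h5 := (hwlow q hq).ne
    have h6 := (Real.sqrt_pos.2 (hR q hq)).ne'
    rw [h4]
    simp only [hamField, Prod.smul_mk, smul_eq_mul]
    field_simp
  have hint := intervalIntegral.integral_eq_sub_of_hasDerivAt hder
    (ContinuousOn.intervalIntegrable fun x hx =>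
      (continuousAt_inv_sqrt_radicand (hR x hx)).continuousWithinAt)
  have e1 : w z.1 = map ρ z := by rw [hwmap _ Set.right_mem_uIcc, hzl]
  have e0 : (w 0).1 = qStep ρ P := by
    rw [hwmap _ Set.left_mem_uIcc, h0l, map_startPoint hρ hmin]
  rw [e0, e1] at hint
  have ii : ∀ a b, 0 < radicand ρ P a → 0 < radicand ρ P b →
      IntervalIntegrable (fun x => 1 / √(radicand ρ P x)) MeasureTheory.volume a b :=
    fun a b ha hb => ContinuousOn.intervalIntegrable fun x hx =>
      (continuousAt_inv_sqrt_radicand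
        (radicand_pos_of_mem_uIcc hρ hmin ha hb hx)).continuousWithinAt
  have hRm : 0 < radicand ρ P (map ρ z).1 := by
    have := hRw _ Set.right_mem_uIcc
    rwa [e1] at this
  have hadd := intervalIntegral.integral_add_adjacent_intervals (ii 0 z.1 hR0 hRz)
    (ii z.1 (map ρ z).1 hRz hRm)
  rw [frequency]
  linarith

theorem sign_mul_time_eq_frequency (z : ℝ × ℝ) (hz : invariant ρ z ∈ energyDomain ρ)
    (h : 0 < dp (invariant ρ) z * dp (invariant ρ) (map ρ z)) :
    Real.sign (dp (invariant ρ) z) *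
        ∫ q in z.1..(map ρ z).1, 1 / √(radicand ρ (invariant ρ z) q) =
      frequency ρ (invariant ρ z) := by
  rw [dp_invariant, dp_invariant] at h
  rw [dp_invariant]
  rcases pos_and_pos_or_neg_and_neg_of_mul_pos h with ⟨h1, h2⟩ | ⟨h1, h2⟩
  · have := time_eq_frequency_of_neg hρ (z := -z) (by rwa [invariant_neg])
      (by rw [invariantP_neg]; linarith) (by rw [map_neg hρ, invariantP_neg]; linarith)
    rw [Real.sign_of_pos h1, one_mul, ← invariant_neg ρ z, ← this, invariant_neg, map_neg hρ,
      Prod.fst_neg, Prod.fst_neg]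
    have := intervalIntegral.integral_comp_neg (a := z.1) (b := (map ρ z).1)
      (fun q => 1 / √(radicand ρ (invariant ρ z) q))
    simp only [radicand_neg] at this
    rw [this, intervalIntegral.integral_symm]
  · rw [Real.sign_of_neg h1, neg_one_mul, time_eq_frequency_of_neg hρ hz h1 h2]

end

/-! ### The Baker-Campbell-Hausdorff series in an associative algebra -/

section Generic

variable {L L' : Type*} [AddCommGroup L] [Module ℝ L] [AddCommGroup L'] [Module ℝ L']

/-- The recursion of `adPow` for an arbitrary bracket. -/
def adPowOf (br : L → L → L) (Z : ℕ → L) (W : L) : ℕ → ℕ → L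
  | 0, n => if n = 0 then W else 0
  | j + 1, n => ∑ k ∈ Finset.Icc 1 n, br (adPowOf br Z W j (n - k)) (Z k)

/-- The recursion of `bchSeq` for an arbitrary bracket. -/
def bchSeqOf (br : L → L → L) (X Y : L) : ℕ → ℕ → L
  | 0 => fun _ => 0
  | n + 1 => Function.update (bchSeqOf br X Y n) (n + 1)
      ((1 / ((n : ℝ) + 1)) • ∑ j ∈ Finset.range (n + 1), (1 / (j.factorial : ℝ)) •
        ((bernoulli j : ℝ) • adPowOf br (bchSeqOf br X Y n) X j n
          + (bernoulli' j : ℝ) • adPowOf br (bchSeqOf br X Y n) Y j n))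

/-- The terms of the Baker-Campbell-Hausdorff series for an arbitrary bracket. -/
def bchTermOf (br : L → L → L) (X Y : L) (n : ℕ) : L := bchSeqOf br X Y n n

lemma adPow_eq_adPowOf (Z : ℕ → ℝ × ℝ → ℝ) (W : ℝ × ℝ → ℝ) (j n : ℕ) :
    adPow Z W j n = adPowOf poisson Z W j n := by
  induction j generalizing n with
  | zero => rfl
  | succ j ih => simp only [adPow, adPowOf, ih]

lemma bchTerm_eq_bchTermOf (X Y : ℝ × ℝ → ℝ) (n : ℕ) :
    bchTerm X Y n = bchTermOf poisson X Y n := by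
  have : ∀ n, bchSeq X Y n = bchSeqOf poisson X Y n := fun n => by
    induction n with
    | zero => rfl
    | succ n ih => simp only [bchSeq, bchSeqOf, ih, adPow_eq_adPowOf]
  rw [bchTerm, bchTermOf, this]

lemma map_adPowOf {br : L → L → L} {br' : L' → L' → L'} (φ : L →ₗ[ℝ] L')
    (hφ : ∀ a b, φ (br a b) = br' (φ a) (φ b)) (Z : ℕ → L) (W : L) (j n : ℕ) :
    φ (adPowOf br Z W j n) = adPowOf br' (fun k => φ (Z k)) (φ W) j n := by
  induction j generalizing n with
  | zero => simp only [adPowOf]; split_ifs <;> simp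
  | succ j ih => simp only [adPowOf, map_sum, hφ, ih]

lemma map_bchTermOf {br : L → L → L} {br' : L' → L' → L'} (φ : L →ₗ[ℝ] L')
    (hφ : ∀ a b, φ (br a b) = br' (φ a) (φ b)) (X Y : L) (n : ℕ) :
    φ (bchTermOf br X Y n) = bchTermOf br' (φ X) (φ Y) n := by
  have : ∀ n, (fun k => φ (bchSeqOf br X Y n k)) = bchSeqOf br' (φ X) (φ Y) n := fun n => by
    induction n with
    | zero => funext k; simp [bchSeqOf]
    | succ n ih =>
      funext k
      rw [bchSeqOf, bchSeqOf, ← ih]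
      by_cases h : k = n + 1
      · subst h
        simp only [Function.update_self, map_smul, map_sum, map_add, map_adPowOf φ hφ]
      · simp only [Function.update_of_ne h]
  exact congrFun (this n) n

omit [Module ℝ L] in
lemma adPowOf_congr (br : L → L → L) {Z Z' : ℕ → L} (W : L) (j : ℕ) {n : ℕ}
    (h : ∀ k ≤ n, Z k = Z' k) : adPowOf br Z W j n = adPowOf br Z' W j n := by
  induction j generalizing n with
  | zero => rfl
  | succ j ih =>
    refine Finset.sum_congr rfl fun k hk => ?_
    rw [h k (Finset.mem_Icc.1 hk).2, ih fun i hi => h i (hi.trans (Nat.sub_le _ _))]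

lemma bchTermOf_zero (br : L → L → L) (X Y : L) : bchTermOf br X Y 0 = 0 := rfl

lemma bchTermOf_succ (br : L → L → L) (X Y : L) (n : ℕ) :
    bchTermOf br X Y (n + 1) =
      (1 / ((n : ℝ) + 1)) • ∑ j ∈ Finset.range (n + 1), (1 / (j.factorial : ℝ)) •
        ((bernoulli j : ℝ) • adPowOf br (bchTermOf br X Y) X j n
          + (bernoulli' j : ℝ) • adPowOf br (bchTermOf br X Y) Y j n) := by
  have hst : ∀ n k, k ≤ n → bchSeqOf br X Y n k = bchTermOf br X Y k := fun n => by
    induction n with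
    | zero => intro k hk; rw [Nat.le_zero.1 hk]; rfl
    | succ n ih =>
      intro k hk
      rcases hk.eq_or_lt with rfl | hlt
      · rfl
      · rw [bchSeqOf, Function.update_of_ne hlt.ne, ih k (Nat.lt_succ_iff.1 hlt)]
  have e : ∀ W j, adPowOf br (bchSeqOf br X Y n) W j n = adPowOf br (bchTermOf br X Y) W j n :=
    fun W j => adPowOf_congr br W j (hst n)
  rw [bchTermOf, bchSeqOf, Function.update_self]
  simp only [e]

end Generic

section Assoc

open PowerSeries Finset

variable {R : Type*} [Ring R]

lemma sum_triangle {M : Type*} [AddCommMonoid M] (n : ℕ) (f : ℕ → ℕ → M)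
    (hf : ∀ m l, n < m + l → f m l = 0) :
    ∑ m ∈ range (n + 1), ∑ l ∈ range (n + 1), f m l =
      ∑ k ∈ range (n + 1), ∑ x ∈ antidiagonal k, f x.1 x.2 := by
  rw [← sum_product' (f := f)]
  have h1 : ∑ x ∈ range (n + 1) ×ˢ range (n + 1), f x.1 x.2 =
      ∑ x ∈ (range (n + 1) ×ˢ range (n + 1)).filter (fun x => x.1 + x.2 ≤ n), f x.1 x.2 := by
    refine (sum_subset (filter_subset _ _) fun x hx hx' => hf _ _ ?_).symm
    by_contra hc
    exact hx' (mem_filter.2 ⟨hx, not_lt.1 hc⟩)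
  rw [h1, ← sum_fiberwise_of_maps_to (g := fun x : ℕ × ℕ => x.1 + x.2) (t := range (n + 1))
    (fun x hx => mem_range.2 (Nat.lt_succ_of_le (mem_filter.1 hx).2))]
  refine sum_congr rfl fun k hk => sum_congr ?_ fun _ _ => rfl
  ext x
  simp only [mem_filter, mem_product, mem_range, HasAntidiagonal.mem_antidiagonal] at hk ⊢
  omega

/-- The sum of a family of power series, formed coefficientwise. It is meaningful when the `k`th
series has order at least `k`. -/
def diagSum (a : ℕ → R⟦X⟧) : R⟦X⟧ :=
  PowerSeries.mk fun n => ∑ k ∈ range (n + 1), coeff n (a k)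

/-- The `k`th series of the family has order at least `k`. -/
def HasDiagOrder (a : ℕ → R⟦X⟧) : Prop := ∀ k n, n < k → coeff n (a k) = 0

lemma diagSum_mul {a b : ℕ → R⟦X⟧} (ha : HasDiagOrder a) (hb : HasDiagOrder b) :
    diagSum a * diagSum b = diagSum fun k => ∑ x ∈ antidiagonal k, a x.1 * b x.2 := by
  ext n
  have hext : ∀ {c : ℕ → R⟦X⟧}, HasDiagOrder c → ∀ x ≤ n,
      ∑ k ∈ range (x + 1), coeff x (c k) = ∑ k ∈ range (n + 1), coeff x (c k) :=
    fun hc x hx => sum_subset (range_subset_range.2 (by omega)) fun k _ hk =>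
      hc k x (by simpa [Nat.lt_succ_iff] using hk)
  simp only [diagSum, coeff_mk, coeff_mul, map_sum]
  have hv : ∀ m l, n < m + l →
      ∑ x ∈ antidiagonal n, coeff x.1 (a m) * coeff x.2 (b l) = 0 := fun m l hml =>
    sum_eq_zero fun x hx => by
      rw [HasAntidiagonal.mem_antidiagonal] at hx
      by_cases h : x.1 < m
      · rw [ha m x.1 h, zero_mul]
      · rw [hb l x.2 (by omega), mul_zero]
  rw [← sum_triangle n (fun m l => ∑ x ∈ antidiagonal n, coeff x.1 (a m) * coeff x.2 (b l)) hv]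
  calc _ = ∑ x ∈ antidiagonal n, ∑ m ∈ range (n + 1), ∑ l ∈ range (n + 1),
        coeff x.1 (a m) * coeff x.2 (b l) := by
        refine sum_congr rfl fun x hx => ?_
        rw [HasAntidiagonal.mem_antidiagonal] at hx
        rw [hext ha x.1 (by omega), hext hb x.2 (by omega), sum_mul_sum]
    _ = _ := by
        rw [sum_comm]
        exact sum_congr rfl fun m _ => sum_comm

lemma hasDiagOrder_mul_left {a : ℕ → R⟦X⟧} (Z : R⟦X⟧) (ha : HasDiagOrder a) :
    HasDiagOrder fun k => Z * a k := fun k n hn => by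
  rw [coeff_mul]
  refine sum_eq_zero fun x hx => ?_
  rw [HasAntidiagonal.mem_antidiagonal] at hx
  rw [ha k x.2 (by omega), mul_zero]

lemma hasDiagOrder_mul_right {a : ℕ → R⟦X⟧} (Z : R⟦X⟧) (ha : HasDiagOrder a) :
    HasDiagOrder fun k => a k * Z := fun k n hn => by
  rw [coeff_mul]
  refine sum_eq_zero fun x hx => ?_
  rw [HasAntidiagonal.mem_antidiagonal] at hx
  rw [ha k x.1 (by omega), zero_mul]

lemma diagSum_single (Z : R⟦X⟧) : diagSum (fun k => if k = 0 then Z else 0) = Z := by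
  ext n
  simp [diagSum, apply_ite (coeff n), Finset.sum_ite_eq']

lemma hasDiagOrder_single (Z : R⟦X⟧) : HasDiagOrder (fun k => if k = 0 then Z else 0) :=
  fun k n hn => by simp [show k ≠ 0 by omega]

lemma diagSum_mul_left {a : ℕ → R⟦X⟧} (Z : R⟦X⟧) (ha : HasDiagOrder a) :
    diagSum (fun k => Z * a k) = Z * diagSum a := by
  conv_rhs => rw [← diagSum_single Z, diagSum_mul (hasDiagOrder_single Z) ha]
  congr 1
  funext k
  rw [sum_eq_single (0, k)]
  · simp
  · intro x hx hne
    have : x.1 ≠ 0 := fun h => hne (by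
      rw [HasAntidiagonal.mem_antidiagonal] at hx
      ext <;> simp <;> omega)
    simp [this]
  · intro h; simp at h

lemma diagSum_mul_right {a : ℕ → R⟦X⟧} (Z : R⟦X⟧) (ha : HasDiagOrder a) :
    diagSum (fun k => a k * Z) = diagSum a * Z := by
  conv_rhs => rw [← diagSum_single Z, diagSum_mul ha (hasDiagOrder_single Z)]
  congr 1
  funext k
  rw [sum_eq_single (k, 0)]
  · simp
  · intro x hx hne
    have : x.2 ≠ 0 := fun h => hne (by
      rw [HasAntidiagonal.mem_antidiagonal] at hx
      ext <;> simp <;> omega)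
    simp [this]
  · intro h; simp at h

lemma diagSum_sub (a b : ℕ → R⟦X⟧) :
    diagSum (fun k => a k - b k) = diagSum a - diagSum b := by
  ext n; simp [diagSum]

lemma diagSum_add (a b : ℕ → R⟦X⟧) :
    diagSum (fun k => a k + b k) = diagSum a + diagSum b := by
  ext n; simp [diagSum, sum_add_distrib]

lemma diagSum_diagSum {b : ℕ → ℕ → R⟦X⟧} (hb : ∀ m j n, n < m + j → coeff n (b m j) = 0) :
    diagSum (fun m => diagSum (b m)) =
      diagSum fun i => ∑ x ∈ antidiagonal i, b x.1 x.2 := by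
  ext n
  simp only [diagSum, coeff_mk, map_sum]
  exact sum_triangle n (fun m l => coeff n (b m l)) fun m l h => hb m l n h

/-- The Euler derivation `X d/dX`. -/
def euler (F : R⟦X⟧) : R⟦X⟧ := PowerSeries.mk fun n => n • coeff n F

lemma euler_mul (F G : R⟦X⟧) : euler (F * G) = euler F * G + F * euler G := by
  ext n
  simp only [euler, coeff_mk, coeff_mul, map_add, smul_sum]
  rw [← sum_add_distrib]
  refine sum_congr rfl fun x hx => ?_
  rw [← HasAntidiagonal.mem_antidiagonal.1 hx, add_smul, smul_mul_assoc, mul_smul_comm]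

variable [Algebra ℝ R]

lemma euler_smul (c : ℝ) (F : R⟦X⟧) : euler (c • F) = c • euler F := by
  ext n
  simp only [euler, coeff_mk, LinearMap.map_smul_of_tower]
  rw [smul_comm]

/-- `F ↦ [Z, F]`. -/
def adSeries (Z : R⟦X⟧) : R⟦X⟧ →ₗ[ℝ] R⟦X⟧ :=
  LinearMap.mulLeft ℝ Z - LinearMap.mulRight ℝ Z

lemma adSeries_apply (Z F : R⟦X⟧) : adSeries Z F = Z * F - F * Z := rfl

/-- The `k`th term of the exponential series. -/
def expTerm (Z : R⟦X⟧) (k : ℕ) : R⟦X⟧ := (1 / (k.factorial : ℝ)) • Z ^ k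

lemma succ_smul_expTerm (Z : R⟦X⟧) (k : ℕ) :
    ((k : ℝ) + 1) • expTerm Z (k + 1) = Z * expTerm Z k := by
  rw [expTerm, expTerm, smul_smul, mul_smul_comm, ← pow_succ', Nat.factorial_succ]
  congr 1
  push_cast
  have : (k.factorial : ℝ) ≠ 0 := by positivity
  field_simp

/-- A reindexing used in the inductions on the degree below. -/
lemma sum_antidiagonal_shift {c : ℝ} {Z : R⟦X⟧} {u : ℕ → R⟦X⟧}
    (hu : ∀ m : ℕ, adSeries Z (u m) = ((m : ℝ) + 1 + c) • u (m + 1)) (k : ℕ) :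
    ((k : ℝ) + 1 + c) • ∑ x ∈ antidiagonal (k + 1), u x.1 * expTerm Z x.2 =
      Z * (∑ x ∈ antidiagonal k, u x.1 * expTerm Z x.2) + c • (u 0 * expTerm Z (k + 1)) := by
  have h1 : ∀ x ∈ antidiagonal (k + 1), ((k : ℝ) + 1 + c) • (u x.1 * expTerm Z x.2) =
      ((x.1 : ℝ) + c) • (u x.1 * expTerm Z x.2) + (x.2 : ℝ) • (u x.1 * expTerm Z x.2) :=
    fun x hx => by
      rw [← add_smul]
      congr 1
      have := HasAntidiagonal.mem_antidiagonal.1 hx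
      have : (x.1 : ℝ) + x.2 = k + 1 := by exact_mod_cast this
      linarith
  rw [smul_sum, sum_congr rfl h1, sum_add_distrib]
  rw [Nat.sum_antidiagonal_succ (n := k) (f := fun x => ((x.1 : ℝ) + c) • (u x.1 * expTerm Z x.2)),
    Nat.sum_antidiagonal_succ' (n := k) (f := fun x => (x.2 : ℝ) • (u x.1 * expTerm Z x.2))]
  have h2 : ∀ x ∈ antidiagonal k, Z * (u x.1 * expTerm Z x.2) =
      (((x.1 + 1 : ℕ) : ℝ) + c) • (u (x.1 + 1) * expTerm Z x.2) +
        ((x.2 + 1 : ℕ) : ℝ) • (u x.1 * expTerm Z (x.2 + 1)) := fun x _ => by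
    rw [← mul_smul_comm ((x.2 + 1 : ℕ) : ℝ), Nat.cast_add_one x.2, succ_smul_expTerm,
      ← smul_mul_assoc, Nat.cast_add_one x.1, ← hu, adSeries_apply]
    noncomm_ring
  rw [mul_sum, sum_congr rfl h2, sum_add_distrib]
  simp only [Nat.cast_zero, zero_smul, zero_add]
  abel

lemma euler_expTerm_succ (Z : R⟦X⟧) (k : ℕ) : euler (expTerm Z (k + 1)) =
    ∑ x ∈ antidiagonal k, ((1 / ((x.1 + 1).factorial : ℝ)) •
      ((adSeries Z) ^ x.1) (euler Z)) * expTerm Z x.2 := by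
  set u : ℕ → R⟦X⟧ := fun m => (1 / ((m + 1).factorial : ℝ)) • ((adSeries Z) ^ m) (euler Z) with hu
  have hu' : ∀ m : ℕ, adSeries Z (u m) = ((m : ℝ) + 1 + 1) • u (m + 1) := fun m => by
    simp only [hu]
    rw [map_smul, smul_smul, Nat.factorial_succ (m + 1), pow_succ', Module.End.mul_apply]
    congr 1
    push_cast
    have : ((m + 1).factorial : ℝ) ≠ 0 := by positivity
    have : (m : ℝ) + 1 + 1 ≠ 0 := by positivity
    field_simp
  induction k with
  | zero => simp [expTerm]
  | succ k ih =>
    have hk : ((k : ℝ) + 1 + 1) ≠ 0 := by positivity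
    rw [← sub_eq_zero, ← smul_eq_zero_iff_right hk, smul_sub, sum_antidiagonal_shift hu' k, ← ih,
      ← euler_smul, ← Nat.cast_add_one, succ_smul_expTerm, euler_mul, one_smul]
    simp only [hu, pow_zero, Module.End.one_apply, zero_add, Nat.factorial_one, Nat.cast_one,
      div_one, one_smul]
    abel

lemma expTerm_mul (Z Y : R⟦X⟧) (k : ℕ) : expTerm Z k * Y =
    ∑ x ∈ antidiagonal k, ((1 / (x.1.factorial : ℝ)) •
      ((adSeries Z) ^ x.1) Y) * expTerm Z x.2 := by
  set u : ℕ → R⟦X⟧ := fun m => (1 / (m.factorial : ℝ)) • ((adSeries Z) ^ m) Y with hu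
  have hu' : ∀ m : ℕ, adSeries Z (u m) = ((m : ℝ) + 1 + 0) • u (m + 1) := fun m => by
    simp only [hu]
    rw [map_smul, smul_smul, Nat.factorial_succ m, pow_succ', Module.End.mul_apply]
    congr 1
    push_cast
    have : (m.factorial : ℝ) ≠ 0 := by positivity
    have : (m : ℝ) + 1 + 0 ≠ 0 := by positivity
    field_simp
    ring
  induction k with
  | zero => simp [expTerm]
  | succ k ih =>
    have hk : ((k : ℝ) + 1 + 0) ≠ 0 := by positivity
    rw [← sub_eq_zero, ← smul_eq_zero_iff_right hk, smul_sub, sum_antidiagonal_shift hu' k, ← ih,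
      add_zero, ← smul_mul_assoc, succ_smul_expTerm, zero_smul, mul_assoc]
    simp

lemma hasDiagOrder_adSeries {a : ℕ → R⟦X⟧} (Z : R⟦X⟧) (ha : HasDiagOrder a) (m : ℕ) :
    HasDiagOrder fun k => ((adSeries Z) ^ m) (a k) := by
  induction m with
  | zero => simpa using ha
  | succ m ih =>
    intro k n hn
    simp only [pow_succ' _ m, Module.End.mul_apply, adSeries_apply]
    rw [map_sub, hasDiagOrder_mul_left Z ih k n hn, hasDiagOrder_mul_right Z ih k n hn, sub_zero]

lemma diagSum_adSeries {a : ℕ → R⟦X⟧} (Z : R⟦X⟧) (ha : HasDiagOrder a) (m : ℕ) :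
    diagSum (fun k => ((adSeries Z) ^ m) (a k)) = ((adSeries Z) ^ m) (diagSum a) := by
  induction m with
  | zero => simp
  | succ m ih =>
    have h := hasDiagOrder_adSeries Z ha m
    simp only [pow_succ' _ m, Module.End.mul_apply, adSeries_apply]
    rw [diagSum_sub, diagSum_mul_left Z h, diagSum_mul_right Z h, ih]

/-- If `Z` has no constant term then `adᵐ` raises orders by `m`. -/
lemma coeff_adSeries_pow {Z : R⟦X⟧} (hZ : coeff 0 Z = 0) {F : R⟦X⟧} {i : ℕ}
    (hF : ∀ n < i, coeff n F = 0) (m n : ℕ) (hn : n < i + m) :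
    coeff n (((adSeries Z) ^ m) F) = 0 := by
  induction m generalizing n with
  | zero => simpa using hF n hn
  | succ m ih =>
    rw [pow_succ', Module.End.mul_apply, adSeries_apply, map_sub, coeff_mul, coeff_mul,
      sum_eq_zero, sum_eq_zero, sub_zero]
    · intro x hx
      rw [HasAntidiagonal.mem_antidiagonal] at hx
      by_cases h : x.2 = 0
      · rw [h, hZ, mul_zero]
      · rw [ih x.1 (by omega), zero_mul]
    · intro x hx
      rw [HasAntidiagonal.mem_antidiagonal] at hx
      by_cases h : x.1 = 0
      · rw [h, hZ, zero_mul]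
      · rw [ih x.2 (by omega), mul_zero]

lemma hasDiagOrder_expTerm {Z : R⟦X⟧} (hZ : coeff 0 Z = 0) : HasDiagOrder (expTerm Z) := by
  intro k
  induction k with
  | zero => intro n hn; omega
  | succ k ih =>
    intro n hn
    have h : ((k : ℝ) + 1) • coeff n (expTerm Z (k + 1)) = 0 := by
      rw [← LinearMap.map_smul_of_tower, succ_smul_expTerm, coeff_mul]
      refine sum_eq_zero fun x hx => ?_
      rw [HasAntidiagonal.mem_antidiagonal] at hx
      by_cases h : x.1 = 0
      · rw [h, hZ, zero_mul]
      · rw [ih x.2 (by omega), mul_zero]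
    exact (smul_eq_zero_iff_right (by positivity)).1 h

lemma sum_antidiagonal_div_factorial (B : ℕ → ℚ) (i : ℕ) : ∑ x ∈ antidiagonal i,
    (1 / ((x.1 + 1).factorial : ℝ)) * ((1 / (x.2.factorial : ℝ)) * (B x.2 : ℝ)) =
      ((∑ k ∈ antidiagonal i, ((k.1 + k.2).choose k.2 : ℚ) / (k.2 + 1) * B k.1 : ℚ) : ℝ) /
        (i.factorial : ℝ) := by
  rw [← Nat.sum_antidiagonal_swap]
  simp only [Rat.cast_sum, sum_div]
  refine sum_congr rfl fun x hx => ?_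
  rw [HasAntidiagonal.mem_antidiagonal] at hx
  subst hx
  have h2 : (((x.1 + x.2).choose x.2 : ℕ) : ℝ) * (x.1.factorial : ℝ) * (x.2.factorial : ℝ)
      = ((x.1 + x.2).factorial : ℝ) := by
    exact_mod_cast Nat.add_choose_mul_factorial_mul_factorial x.1 x.2
  have h3 : (((x.1 + x.2).choose x.2 : ℕ) : ℝ) ≠ 0 := by
    exact_mod_cast (Nat.choose_pos (Nat.le_add_left _ _)).ne'
  have h4 : (x.1.factorial : ℝ) ≠ 0 := by positivity
  have h5 : (x.2.factorial : ℝ) ≠ 0 := by positivity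
  have h6 : (x.2 : ℝ) + 1 ≠ 0 := by positivity
  simp only [Prod.fst_swap, Prod.snd_swap]
  rw [← h2]
  push_cast [Nat.factorial_succ]
  field_simp

/-- Multiplying the generating functions `(eᵘ - 1) / u` and `u / (eᵘ - 1)`. -/
lemma sum_bernoulli (i : ℕ) : ∑ x ∈ antidiagonal i,
    (1 / ((x.1 + 1).factorial : ℝ)) * ((1 / (x.2.factorial : ℝ)) * (bernoulli x.2 : ℝ)) =
      if i = 0 then 1 else 0 := by
  rw [sum_antidiagonal_div_factorial, bernoulli_spec']
  split_ifs with h0 <;> simp [h0]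

/-- Multiplying the generating functions `(eᵘ - 1) / u` and `u / (1 - e⁻ᵘ)`. -/
lemma sum_bernoulli' (i : ℕ) : ∑ x ∈ antidiagonal i,
    (1 / ((x.1 + 1).factorial : ℝ)) * ((1 / (x.2.factorial : ℝ)) * (bernoulli' x.2 : ℝ)) =
      1 / (i.factorial : ℝ) := by
  rw [sum_antidiagonal_div_factorial, bernoulli'_spec', Rat.cast_one]

/-- The commutator `[b, a]`, with the order of arguments of `poisson`. -/
def opBracket (a b : R) : R := b * a - a * b

omit [Algebra ℝ R] in
lemma opBracket_def (a b : R) : opBracket a b = b * a - a * b := rfl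

/-- The Baker-Campbell-Hausdorff series as a power series. -/
def bchSeries (x y : R) : R⟦X⟧ := PowerSeries.mk (bchTermOf opBracket x y)

lemma coeff_zero_bchSeries (x y : R) : coeff 0 (bchSeries x y) = 0 := by
  rw [bchSeries, coeff_mk, bchTermOf_zero]

lemma adPowOf_eq_coeff (x y w : R) (j n : ℕ) :
    adPowOf opBracket (bchTermOf opBracket x y) w j n =
      coeff n (((adSeries (bchSeries x y)) ^ j) (C w)) := by
  induction j generalizing n with
  | zero => simp [adPowOf, coeff_C]
  | succ j ih =>
    have h0 : bchTermOf opBracket x y 0 = 0 := rfl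
    rw [pow_succ', Module.End.mul_apply, adSeries_apply, map_sub, coeff_mul, coeff_mul,
      ← Nat.sum_antidiagonal_swap (f := fun p => coeff p.1 _ * coeff p.2 (bchSeries x y)),
      ← sum_sub_distrib, adPowOf]
    rw [Nat.sum_antidiagonal_eq_sum_range_succ_mk]
    symm
    rw [sum_range_eq_add_Ico _ (Nat.succ_pos n)]
    simp only [Prod.swap_prod_mk, bchSeries, coeff_mk, h0, zero_mul, mul_zero, sub_zero, zero_add,
      ih, opBracket_def]
    rfl

/-- The coefficients of the right-hand side of the recursion of the series. -/
def bchRhs (x y : R) (j : ℕ) : R⟦X⟧ :=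
  (1 / (j.factorial : ℝ)) • ((bernoulli j : ℝ) • ((adSeries (bchSeries x y)) ^ j) (C x)
    + (bernoulli' j : ℝ) • ((adSeries (bchSeries x y)) ^ j) (C y))

lemma coeff_ad_C_eq_zero (x y w : R) {j n : ℕ} (h : n < j) :
    coeff n (((adSeries (bchSeries x y)) ^ j) (C w)) = 0 :=
  coeff_adSeries_pow (coeff_zero_bchSeries x y) (i := 0) (fun _ h => absurd h (Nat.not_lt_zero _))
    j n (by simpa using h)

lemma hasDiagOrder_bchRhs (x y : R) : HasDiagOrder (bchRhs x y) := fun j n h => by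
  simp only [bchRhs, LinearMap.map_smul_of_tower, map_add, coeff_ad_C_eq_zero x y _ h, smul_zero,
    add_zero]

lemma euler_bchSeries (x y : R) :
    euler (bchSeries x y) = PowerSeries.X * diagSum (bchRhs x y) := by
  ext n
  cases n with
  | zero => simp [euler]
  | succ n =>
    rw [coeff_succ_X_mul, euler, coeff_mk, bchSeries, coeff_mk, bchTermOf_succ, diagSum, coeff_mk,
      ← Nat.cast_smul_eq_nsmul ℝ, smul_smul]
    have : ((n + 1 : ℕ) : ℝ) * (1 / ((n : ℝ) + 1)) = 1 := by
      push_cast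
      field_simp
    rw [this, one_smul]
    refine sum_congr rfl fun j _ => ?_
    simp only [adPowOf_eq_coeff, bchRhs, LinearMap.map_smul_of_tower, map_add]

lemma adSeries_pow_X_mul (Z F : R⟦X⟧) (m : ℕ) :
    ((adSeries Z) ^ m) (PowerSeries.X * F) = PowerSeries.X * ((adSeries Z) ^ m) F := by
  induction m with
  | zero => simp
  | succ m ih =>
    rw [pow_succ', Module.End.mul_apply, Module.End.mul_apply, ih, adSeries_apply, adSeries_apply,
      mul_sub, ← mul_assoc, ← PowerSeries.X_mul (φ := Z), mul_assoc, mul_assoc]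

/-- The series of the exponential of the series. -/
def bchExp (x y : R) : R⟦X⟧ := diagSum (expTerm (bchSeries x y))

lemma euler_bchExp (x y : R) : euler (bchExp x y) =
    PowerSeries.X * (C x * bchExp x y + bchExp x y * C y) := by
  set Z := bchSeries x y with hZ
  have hZ0 : coeff 0 Z = 0 := coeff_zero_bchSeries x y
  have hE : HasDiagOrder (expTerm Z) := hasDiagOrder_expTerm hZ0
  set w : ℕ → R⟦X⟧ := fun m =>
    (1 / ((m + 1).factorial : ℝ)) • ((adSeries Z) ^ m) (euler Z) with hw
  set w' : ℕ → R⟦X⟧ := fun k => Nat.casesOn k 0 w with hw'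
  set v : ℕ → R⟦X⟧ := fun m => (1 / (m.factorial : ℝ)) • ((adSeries Z) ^ m) (C y) with hv
  have hvO : HasDiagOrder v := fun m n h => by
    simp only [hv, LinearMap.map_smul_of_tower]
    rw [hZ, coeff_ad_C_eq_zero x y _ h, smul_zero]
  have hw'O : HasDiagOrder w' := fun k n h => by
    cases k with
    | zero => omega
    | succ m =>
      change coeff n (w m) = 0
      simp only [hw, LinearMap.map_smul_of_tower]
      rw [coeff_adSeries_pow hZ0 (i := 1) (fun n hn => by
        rw [Nat.lt_one_iff.1 hn]; simp [euler]) m n (by omega), smul_zero]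
  -- the derivative of the exponential
  have h1 : euler (bchExp x y) = diagSum w' * bchExp x y := by
    rw [bchExp, diagSum_mul hw'O hE]
    have : euler (diagSum (expTerm Z)) = diagSum fun k => euler (expTerm Z k) := by
      ext n
      simp [euler, diagSum, smul_sum]
    rw [this]
    congr 1
    funext k
    cases k with
    | zero =>
      have : euler (expTerm Z 0) = 0 := by
        ext n
        simp only [euler, expTerm, pow_zero, Nat.factorial_zero, Nat.cast_one, div_one, one_smul,
          coeff_mk, coeff_one, map_zero]
        split_ifs with h <;> simp [h]
      rw [this]
      simp [hw']
    | succ k =>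
      rw [Nat.sum_antidiagonal_succ, euler_expTerm_succ]
      change _ = 0 * expTerm Z (k + 1) + _
      rw [zero_mul, zero_add]
  -- the Bernoulli series of `ad` inverts the series which occurs there
  have h2 : diagSum w' = PowerSeries.X * (C x + diagSum v) := by
    ext n
    cases n with
    | zero => simp [diagSum, hw']
    | succ n =>
      rw [coeff_succ_X_mul, diagSum, coeff_mk, sum_range_succ']
      have e0 : coeff (n + 1) (w' 0) = 0 := by simp [hw']
      have e1 : ∀ m, coeff (n + 1) (w' (m + 1)) = coeff n (diagSum fun j =>
          (1 / ((m + 1).factorial : ℝ)) • ((adSeries Z) ^ m) (bchRhs x y j)) := fun m => by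
        change coeff (n + 1) (w m) = _
        have e2 : (diagSum fun j => (1 / ((m + 1).factorial : ℝ)) •
            ((adSeries Z) ^ m) (bchRhs x y j)) =
            (1 / ((m + 1).factorial : ℝ)) • ((adSeries Z) ^ m) (diagSum (bchRhs x y)) := by
          rw [← diagSum_adSeries Z (hasDiagOrder_bchRhs x y) m]
          ext i
          simp only [diagSum, coeff_mk, LinearMap.map_smul_of_tower, smul_sum]
        rw [e2, hw]
        simp only [LinearMap.map_smul_of_tower]
        rw [hZ, euler_bchSeries, adSeries_pow_X_mul, coeff_succ_X_mul]
      rw [e0, add_zero, sum_congr rfl fun m _ => e1 m]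
      have e3 : ∑ m ∈ range (n + 1), coeff n (diagSum fun j =>
          (1 / ((m + 1).factorial : ℝ)) • ((adSeries Z) ^ m) (bchRhs x y j)) =
          coeff n (diagSum fun m => diagSum fun j =>
          (1 / ((m + 1).factorial : ℝ)) • ((adSeries Z) ^ m) (bchRhs x y j)) := by
        conv_rhs => rw [diagSum, coeff_mk]
      rw [e3, diagSum_diagSum]
      · congr 1
        rw [← diagSum_single (C x), ← diagSum_add]
        congr 1
        funext i
        have e4 : ∀ p ∈ antidiagonal i, (1 / ((p.1 + 1).factorial : ℝ)) •
            ((adSeries Z) ^ p.1) (bchRhs x y p.2) =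
            ((1 / ((p.1 + 1).factorial : ℝ)) * ((1 / (p.2.factorial : ℝ)) *
              (bernoulli p.2 : ℝ))) • ((adSeries Z) ^ i) (C x) +
            ((1 / ((p.1 + 1).factorial : ℝ)) * ((1 / (p.2.factorial : ℝ)) *
              (bernoulli' p.2 : ℝ))) • ((adSeries Z) ^ i) (C y) := fun p hp => by
          rw [← HasAntidiagonal.mem_antidiagonal.1 hp, pow_add]
          simp only [bchRhs, map_smul, map_add, Module.End.mul_apply, smul_add, smul_smul, ← hZ]
        rw [sum_congr rfl e4, sum_add_distrib, ← sum_smul, ← sum_smul, sum_bernoulli,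
          sum_bernoulli']
        congr 1
        split_ifs with h0
        · rw [h0, one_smul, pow_zero, Module.End.one_apply]
        · rw [zero_smul]
      · intro m j k hk
        rw [LinearMap.map_smul_of_tower, coeff_adSeries_pow hZ0 (i := j)
          (fun n hn => hasDiagOrder_bchRhs x y j n hn) m k (by omega), smul_zero]
  have h3 : diagSum v * bchExp x y = bchExp x y * C y := by
    rw [bchExp, diagSum_mul hvO hE, ← diagSum_mul_right _ hE]
    congr 1
    funext k
    rw [expTerm_mul]
  rw [h1, h2, mul_assoc, add_mul, h3]

/-- The Baker-Campbell-Hausdorff formula `exp Z(t) = exp(t x) exp(t y)`, coefficient by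
coefficient. Both sides solve `F' = x F + F y`, `F(0) = 1`. -/
theorem coeff_bchExp (x y : R) (n : ℕ) : coeff n (bchExp x y) =
    ∑ p ∈ antidiagonal n, ((1 / (p.1.factorial : ℝ)) • x ^ p.1) *
      ((1 / (p.2.factorial : ℝ)) • y ^ p.2) := by
  have hs : ∀ (z : R) (k : ℕ), ((k : ℝ) + 1) • ((1 / ((k + 1).factorial : ℝ)) • z ^ (k + 1)) =
      (1 / (k.factorial : ℝ)) • (z ^ (k + 1)) := fun z k => by
    rw [smul_smul, Nat.factorial_succ]
    congr 1
    push_cast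
    have : (k.factorial : ℝ) ≠ 0 := by positivity
    field_simp
  induction n with
  | zero => simp [bchExp, diagSum, expTerm]
  | succ n ih =>
    have hn : (n : ℝ) + 1 ≠ 0 := by positivity
    have h := congrArg (coeff (n + 1)) (euler_bchExp x y)
    rw [coeff_succ_X_mul, euler, coeff_mk, map_add, coeff_C_mul, coeff_mul_C, ih,
      ← Nat.cast_smul_eq_nsmul ℝ, Nat.cast_add_one] at h
    rw [← sub_eq_zero, ← smul_eq_zero_iff_right hn, smul_sub, h, sub_eq_zero, smul_sum]
    have h1 : ∀ p ∈ antidiagonal (n + 1), ((n : ℝ) + 1) •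
        (((1 / (p.1.factorial : ℝ)) • x ^ p.1) * ((1 / (p.2.factorial : ℝ)) • y ^ p.2)) =
        ((p.1 : ℝ) • ((1 / (p.1.factorial : ℝ)) • x ^ p.1)) *
          ((1 / (p.2.factorial : ℝ)) • y ^ p.2) +
        ((1 / (p.1.factorial : ℝ)) • x ^ p.1) *
          ((p.2 : ℝ) • ((1 / (p.2.factorial : ℝ)) • y ^ p.2)) := fun p hp => by
      have := HasAntidiagonal.mem_antidiagonal.1 hp
      have : (n : ℝ) + 1 = p.1 + p.2 := by exact_mod_cast this.symm
      rw [this, add_smul, smul_mul_assoc (p.1 : ℝ), mul_smul_comm (p.2 : ℝ)]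
    rw [sum_congr rfl h1, sum_add_distrib, Nat.sum_antidiagonal_succ, Nat.sum_antidiagonal_succ']
    simp only [Nat.cast_zero, zero_smul, zero_mul, mul_zero, zero_add, Nat.cast_add_one, hs,
      mul_sum, sum_mul]
    congr 1
    · exact sum_congr rfl fun p _ => by rw [← mul_assoc, mul_smul_comm _ x, ← pow_succ']
    · exact sum_congr rfl fun p _ => by rw [mul_assoc, smul_mul_assoc _ (y ^ p.2) y, ← pow_succ]

end Assoc

/-! ### Smooth families of functions on phase space -/

/-- Smooth functions of `(σ, z)`, where `σ = log ρ` is the logarithm of the parameter and `z` is a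
point of phase space. -/
def smoothFamily : Subalgebra ℝ (ℝ × ℝ × ℝ → ℝ) where
  carrier := {F | ContDiff ℝ ∞ F}
  mul_mem' {F G} (hF : ContDiff ℝ ∞ F) (hG : ContDiff ℝ ∞ G) := hF.mul hG
  add_mem' {F G} (hF : ContDiff ℝ ∞ F) (hG : ContDiff ℝ ∞ G) := hF.add hG
  algebraMap_mem' c := show ContDiff ℝ ∞ fun _ => c from contDiff_const

/-- The type of smooth families. -/
def Fam : Type := smoothFamily

instance : CommRing Fam := inferInstanceAs (CommRing smoothFamily)

instance : Algebra ℝ Fam := inferInstanceAs (Algebra ℝ smoothFamily)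

/-- The underlying function of a smooth family. -/
def Fam.toFun (F : Fam) : ℝ × ℝ × ℝ → ℝ := Subtype.val F

instance : CoeFun Fam fun _ => ℝ × ℝ × ℝ → ℝ := ⟨Fam.toFun⟩

namespace Fam

lemma contDiff (F : Fam) : ContDiff ℝ ∞ F := F.2

lemma differentiable (F : Fam) : Differentiable ℝ F := F.contDiff.differentiable (by simp)

lemma continuous (F : Fam) : Continuous F := F.contDiff.continuous

@[ext] lemma ext {F G : Fam} (h : ∀ w, F w = G w) : F = G := Subtype.ext (funext h)

lemma add_apply (F G : Fam) (w : ℝ × ℝ × ℝ) : (F + G) w = F w + G w := rfl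
lemma sub_apply (F G : Fam) (w : ℝ × ℝ × ℝ) : (F - G) w = F w - G w := rfl
lemma neg_apply (F : Fam) (w : ℝ × ℝ × ℝ) : (-F) w = -F w := rfl
lemma mul_apply (F G : Fam) (w : ℝ × ℝ × ℝ) : (F * G) w = F w * G w := rfl
lemma smul_apply (c : ℝ) (F : Fam) (w : ℝ × ℝ × ℝ) : (c • F) w = c * F w := rfl
lemma zero_apply (w : ℝ × ℝ × ℝ) : (0 : Fam) w = 0 := rfl
lemma pow_apply (F : Fam) (n : ℕ) (w : ℝ × ℝ × ℝ) : (F ^ n) w = F w ^ n := by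
  induction n with
  | zero => rw [pow_zero, pow_zero]; rfl
  | succ n ih => rw [pow_succ, pow_succ, mul_apply, ih]
lemma sum_apply {ι : Type*} (s : Finset ι) (F : ι → Fam) (w : ℝ × ℝ × ℝ) :
    (∑ i ∈ s, F i) w = ∑ i ∈ s, F i w := by
  classical
  induction s using Finset.induction_on with
  | empty => simp [zero_apply]
  | insert a s ha ih => rw [Finset.sum_insert ha, Finset.sum_insert ha, add_apply, ih]

/-- The derivative of a smooth family in a fixed direction. -/
def dirDeriv (v : ℝ × ℝ × ℝ) : Fam →ₗ[ℝ] Fam where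
  toFun F := ⟨fun w => fderiv ℝ F w v, show ContDiff ℝ ∞ _ from
    (F.contDiff.fderiv_right (m := ∞) (by simp)).clm_apply contDiff_const⟩
  map_add' F G := Fam.ext fun w => by
    change fderiv ℝ (fun w => F w + G w) w v = fderiv ℝ F w v + fderiv ℝ G w v
    rw [fderiv_fun_add (F.differentiable w) (G.differentiable w)]; rfl
  map_smul' c F := Fam.ext fun w => by
    change fderiv ℝ (fun w => c * F w) w v = c * fderiv ℝ F w v
    rw [fderiv_const_mul (F.differentiable w)]; rfl

lemma dirDeriv_apply (v : ℝ × ℝ × ℝ) (F : Fam) (w : ℝ × ℝ × ℝ) :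
    dirDeriv v F w = fderiv ℝ F w v := rfl

lemma dirDeriv_mul (v : ℝ × ℝ × ℝ) (F G : Fam) :
    dirDeriv v (F * G) = F * dirDeriv v G + G * dirDeriv v F := Fam.ext fun w => by
  change fderiv ℝ (fun w => F w * G w) w v = F w * fderiv ℝ G w v + G w * fderiv ℝ F w v
  rw [fderiv_fun_mul (F.differentiable w) (G.differentiable w)]
  rfl

lemma dirDeriv_comm (u v : ℝ × ℝ × ℝ) (F : Fam) :
    dirDeriv u (dirDeriv v F) = dirDeriv v (dirDeriv u F) := Fam.ext fun w => by
  have h2 : DifferentiableAt ℝ (fderiv ℝ F) w :=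
    ((F.contDiff.fderiv_right (m := ∞) (by simp)).differentiable (by simp)) w
  have key : ∀ a b : ℝ × ℝ × ℝ, dirDeriv a (dirDeriv b F) w = fderiv ℝ (fderiv ℝ F) w a b := by
    intro a b
    change fderiv ℝ (fun w => fderiv ℝ F w b) w a = _
    rw [fderiv_clm_apply h2 (differentiableAt_const _)]
    simp
  rw [key, key]
  exact ((contDiff_infty.1 F.contDiff 2).contDiffAt.isSymmSndFDerivAt (by simp)) u v

/-- The derivative in the parameter. -/
abbrev dS : Fam →ₗ[ℝ] Fam := dirDeriv (1, 0, 0)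
/-- The derivative in `q`. -/
abbrev dQ : Fam →ₗ[ℝ] Fam := dirDeriv (0, 1, 0)
/-- The derivative in `p`. -/
abbrev dP : Fam →ₗ[ℝ] Fam := dirDeriv (0, 0, 1)

lemma hasDerivAt_comp (F : Fam) {c : ℝ → ℝ × ℝ × ℝ} {c' : ℝ × ℝ × ℝ} {t : ℝ}
    (hc : HasDerivAt c c' t) : HasDerivAt (fun s => F (c s)) (dirDeriv c' F (c t)) t :=
  (F.differentiable (c t)).hasFDerivAt.comp_hasDerivAt t hc

lemma dirDeriv_decomp (F : Fam) (a b c : ℝ) (w : ℝ × ℝ × ℝ) :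
    dirDeriv (a, b, c) F w = a * dS F w + b * dQ F w + c * dP F w := by
  have : ((a, b, c) : ℝ × ℝ × ℝ) = a • (1, 0, 0) + b • (0, 1, 0) + c • (0, 0, 1) := by
    simp
  simp only [dirDeriv_apply, this, map_add, map_smul, smul_eq_mul]

lemma hasDerivAt_dS (F : Fam) (σ : ℝ) (z : ℝ × ℝ) :
    HasDerivAt (fun s => F (s, z)) (dS F (σ, z)) σ := by
  have h : HasDerivAt (fun s : ℝ => (s, z)) ((1 : ℝ), ((0 : ℝ), (0 : ℝ))) σ :=
    (hasDerivAt_id σ).prodMk (hasDerivAt_const σ z)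
  exact F.hasDerivAt_comp h

lemma hasDerivAt_dQ (F : Fam) (σ q p : ℝ) :
    HasDerivAt (fun s => F (σ, s, p)) (dQ F (σ, q, p)) q := by
  have h : HasDerivAt (fun s : ℝ => (σ, s, p)) ((0 : ℝ), ((1 : ℝ), (0 : ℝ))) q :=
    (hasDerivAt_const q σ).prodMk ((hasDerivAt_id q).prodMk (hasDerivAt_const q p))
  exact F.hasDerivAt_comp h

lemma hasDerivAt_dP (F : Fam) (σ q p : ℝ) :
    HasDerivAt (fun s => F (σ, q, s)) (dP F (σ, q, p)) p := by
  have h : HasDerivAt (fun s : ℝ => (σ, q, s)) ((0 : ℝ), ((0 : ℝ), (1 : ℝ))) p :=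
    (hasDerivAt_const p σ).prodMk ((hasDerivAt_const p q).prodMk (hasDerivAt_id p))
  exact F.hasDerivAt_comp h

lemma dS_apply_eq {F : Fam} {σ : ℝ} {z : ℝ × ℝ} {y : ℝ}
    (h : HasDerivAt (fun s => F (s, z)) y σ) : dS F (σ, z) = y := (F.hasDerivAt_dS σ z).unique h

lemma dQ_apply_eq {F : Fam} {σ q p y : ℝ}
    (h : HasDerivAt (fun s => F (σ, s, p)) y q) : dQ F (σ, q, p) = y :=
  (F.hasDerivAt_dQ σ q p).unique h

lemma dP_apply_eq {F : Fam} {σ q p y : ℝ}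
    (h : HasDerivAt (fun s => F (σ, q, s)) y p) : dP F (σ, q, p) = y :=
  (F.hasDerivAt_dP σ q p).unique h

/-- The member of a family at parameter `σ`. -/
def slice (σ : ℝ) : Fam →ₗ[ℝ] (ℝ × ℝ → ℝ) where
  toFun F z := F (σ, z)
  map_add' _ _ := rfl
  map_smul' _ _ := rfl

/-- The fibrewise Poisson bracket. -/
def bracket (F G : Fam) : Fam := dQ F * dP G - dP F * dQ G

lemma slice_bracket (σ : ℝ) (F G : Fam) :
    slice σ (bracket F G) = poisson (slice σ F) (slice σ G) := by
  funext z
  have hq : ∀ F : Fam, dq (slice σ F) z = dQ F (σ, z) := fun F =>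
    (F.hasDerivAt_dQ σ z.1 z.2).deriv
  have hp : ∀ F : Fam, dp (slice σ F) z = dP F (σ, z) := fun F =>
    (F.hasDerivAt_dP σ z.1 z.2).deriv
  rw [poisson, hq, hq, hp, hp]
  rfl

/-- The operator `D_G F = {F, G}`. -/
def ham (G : Fam) : Module.End ℝ Fam where
  toFun F := bracket F G
  map_add' F F' := by simp only [bracket, map_add]; ring
  map_smul' c F := by simp [bracket, smul_sub]

lemma ham_apply (G F : Fam) : ham G F = dQ F * dP G - dP F * dQ G := rfl

lemma ham_apply_apply (G F : Fam) (w : ℝ × ℝ × ℝ) :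
    ham G F w = dQ F w * dP G w - dP F w * dQ G w := rfl

/-- `G ↦ D_G` as a linear map. -/
def hamₗ : Fam →ₗ[ℝ] Module.End ℝ Fam where
  toFun := ham
  map_add' G G' := by
    ext1 F; simp only [ham_apply, LinearMap.add_apply, map_add]; ring
  map_smul' c G := by
    ext1 F; simp [ham_apply, smul_sub]

lemma hamₗ_apply (G : Fam) : hamₗ G = ham G := rfl

/-- The Jacobi identity: `G ↦ D_G` carries the bracket to the commutator of operators. -/
lemma hamₗ_bracket (F G : Fam) : hamₗ (bracket F G) = opBracket (hamₗ F) (hamₗ G) := by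
  ext1 H
  simp only [opBracket_def, LinearMap.sub_apply, Module.End.mul_apply, hamₗ_apply, ham_apply,
    bracket, map_sub, dirDeriv_mul, dirDeriv_comm (0, 0, 1) (0, 1, 0)]
  ring

/-! ### The order of vanishing at `σ = 0` -/

/-- The families that vanish to order `m` at `σ = 0`, identically in the phase space point. -/
def vanish : ℕ → Submodule ℝ Fam
  | 0 => ⊤
  | m + 1 =>
    { carrier := {F | (∀ z, F (0, z) = 0) ∧ dS F ∈ vanish m}
      add_mem' := fun hF hG => ⟨fun z => by rw [add_apply, hF.1, hG.1, add_zero], by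
        rw [map_add]; exact add_mem hF.2 hG.2⟩
      zero_mem' := ⟨fun _ => rfl, by rw [map_zero]; exact zero_mem _⟩
      smul_mem' := fun c F hF => ⟨fun z => by rw [smul_apply, hF.1, mul_zero], by
        rw [map_smul]; exact Submodule.smul_mem _ _ hF.2⟩ }

lemma mem_vanish_zero (F : Fam) : F ∈ vanish 0 := Submodule.mem_top

lemma vanish_antitone : Antitone vanish := by
  refine antitone_nat_of_succ_le fun m => ?_
  induction m with
  | zero => exact fun F _ => mem_vanish_zero F
  | succ m ih => exact fun F hF => ⟨hF.1, ih hF.2⟩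

lemma mul_mem_vanish {m n : ℕ} {F G : Fam} (hF : F ∈ vanish m) (hG : G ∈ vanish n) :
    F * G ∈ vanish (m + n) := by
  have key : ∀ k m n (F G : Fam), m + n = k → F ∈ vanish m → G ∈ vanish n → F * G ∈ vanish k := by
    intro k
    induction k with
    | zero => exact fun _ _ _ _ _ _ _ => mem_vanish_zero _
    | succ k ih =>
      have step : ∀ n (F G : Fam) m, m + n = k + 1 → F ∈ vanish m → G ∈ vanish n →
          F * dS G ∈ vanish k := by
        intro n F G m h hF hG
        cases n with
        | zero => exact ih k 0 _ _ rfl (vanish_antitone (by omega) hF) (mem_vanish_zero _)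
        | succ n => exact ih m n _ _ (by omega) hF hG.2
      intro m n F G h hF hG
      refine ⟨fun z => ?_, ?_⟩
      · rw [mul_apply]
        cases n with
        | succ n => rw [hG.1, mul_zero]
        | zero =>
          obtain rfl : m = k + 1 := by omega
          rw [hF.1, zero_mul]
      · rw [dirDeriv_mul]
        exact add_mem (step n F G m h hF hG) (step m G F n (by omega) hG hF)
  exact key _ m n F G rfl hF hG

lemma dirDeriv_mem_vanish {m : ℕ} {F : Fam} (hF : F ∈ vanish m) (b c : ℝ) :
    dirDeriv (0, b, c) F ∈ vanish m := by
  induction m generalizing F with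
  | zero => exact mem_vanish_zero _
  | succ m ih =>
    refine ⟨fun z => ?_, ?_⟩
    · have h : HasDerivAt (fun s : ℝ => ((0 : ℝ), z + s • (b, c))) ((0 : ℝ), b, c) 0 := by
        refine (hasDerivAt_const _ _).prodMk ?_
        simpa using ((hasDerivAt_id (0 : ℝ)).smul_const (b, c)).const_add z
      have h2 := F.hasDerivAt_comp h
      simp only [hF.1, zero_smul, add_zero] at h2
      exact h2.unique (hasDerivAt_const _ _)
    · rw [dirDeriv_comm]
      exact ih hF.2

lemma bracket_mem_vanish {m n : ℕ} {F G : Fam} (hF : F ∈ vanish m) (hG : G ∈ vanish n) :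
    bracket F G ∈ vanish (m + n) :=
  sub_mem (mul_mem_vanish (dirDeriv_mem_vanish hF _ _) (dirDeriv_mem_vanish hG _ _))
    (mul_mem_vanish (dirDeriv_mem_vanish hF _ _) (dirDeriv_mem_vanish hG _ _))

lemma isBigO_of_mem_vanish {m : ℕ} {F : Fam} (hF : F ∈ vanish m) (z : ℝ × ℝ) :
    F =O[𝓝 ((0 : ℝ), z)] fun w => w.1 ^ m := by
  induction m generalizing F with
  | zero =>
    simpa using (F.continuous.continuousAt (x := ((0 : ℝ), z))).isBigO_one ℝ
  | succ m ih =>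
    obtain ⟨C, hC, hC1⟩ := (ih hF.2).exists_nonneg
    obtain ⟨r, hr, hb⟩ := Metric.eventually_nhds_iff_ball.1 hC1.bound
    refine IsBigO.of_bound C ?_
    filter_upwards [Metric.ball_mem_nhds _ hr] with w hw
    rw [← ball_prod_same, Set.mem_prod] at hw
    have hC0 : ∀ s ∈ Set.uIcc 0 w.1, ‖dS F (s, w.2)‖ ≤ C * ‖w.1‖ ^ m := fun s hs => by
      have hs' : |s| ≤ |w.1| := by
        have := Set.abs_sub_left_of_mem_uIcc hs
        simpa using this
      have hC1 : ‖dS F (s, w.2)‖ ≤ C * ‖s ^ m‖ := by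
        refine hb (s, w.2) ?_
        rw [← ball_prod_same]
        refine ⟨?_, hw.2⟩
        have := hw.1
        simp only [mem_ball_zero_iff, Real.norm_eq_abs] at this ⊢
        exact hs'.trans_lt this
      refine hC1.trans ?_
      rw [norm_pow]
      gcongr
      simpa using hs'
    have := Convex.norm_image_sub_le_of_norm_hasDerivWithin_le (f := fun s => F (s, w.2))
      (s := Set.uIcc 0 w.1) (fun s _ => (F.hasDerivAt_dS s w.2).hasDerivWithinAt) hC0
      (convex_uIcc _ _) Set.left_mem_uIcc Set.right_mem_uIcc
    simpa [hF.1, pow_succ, mul_assoc] using this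

/-- The operators that raise the order of vanishing by `i`. -/
def opOrder (i : ℕ) : Submodule ℝ (Module.End ℝ Fam) where
  carrier := {A | ∀ m, ∀ F ∈ vanish m, A F ∈ vanish (m + i)}
  add_mem' hA hB m F hF := add_mem (hA m F hF) (hB m F hF)
  zero_mem' _ _ _ := zero_mem _
  smul_mem' c _ hA m F hF := Submodule.smul_mem _ c (hA m F hF)

lemma opOrder_antitone : Antitone opOrder := fun _ _ h _ hA m F hF =>
  vanish_antitone (by omega) (hA m F hF)

lemma mul_mem_opOrder {i j : ℕ} {A B : Module.End ℝ Fam} (hA : A ∈ opOrder i)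
    (hB : B ∈ opOrder j) : A * B ∈ opOrder (i + j) := fun m F hF => by
  have := hA _ _ (hB m F hF)
  rwa [add_assoc, add_comm j i] at this

lemma one_mem_opOrder : (1 : Module.End ℝ Fam) ∈ opOrder 0 := fun _ _ hF => hF

lemma pow_mem_opOrder {A : Module.End ℝ Fam} (hA : A ∈ opOrder 1) (n : ℕ) : A ^ n ∈ opOrder n := by
  induction n with
  | zero => exact one_mem_opOrder
  | succ n ih => rw [pow_succ]; exact mul_mem_opOrder ih hA

lemma ham_mem_opOrder {n : ℕ} {G : Fam} (hG : G ∈ vanish n) : ham G ∈ opOrder n :=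
  fun _ _ hF => bracket_mem_vanish hF hG

lemma apply_mem_vanish {i : ℕ} {A : Module.End ℝ Fam} (hA : A ∈ opOrder i) (F : Fam) :
    A F ∈ vanish i := by
  simpa using hA 0 F (mem_vanish_zero F)

end Fam

namespace Fam

/-! ### Truncated exponentials of operators -/

section Trunc

open PowerSeries Finset

lemma sum_mul_sum_sub_mem_opOrder (N : ℕ) {A B : ℕ → Module.End ℝ Fam}
    (hA : ∀ i, A i ∈ opOrder i) (hB : ∀ i, B i ∈ opOrder i) :
    (∑ i ∈ range (N + 1), A i) * (∑ j ∈ range (N + 1), B j) -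
      ∑ n ∈ range (N + 1), ∑ x ∈ antidiagonal n, A x.1 * B x.2 ∈ opOrder (N + 1) := by
  have h1 := sum_triangle N (fun i j => if i + j ≤ N then A i * B j else 0)
    (fun m l h => if_neg (by omega))
  have h2 : ∑ n ∈ range (N + 1), ∑ x ∈ antidiagonal n,
      (if x.1 + x.2 ≤ N then A x.1 * B x.2 else 0) =
      ∑ n ∈ range (N + 1), ∑ x ∈ antidiagonal n, A x.1 * B x.2 :=
    sum_congr rfl fun n hn => sum_congr rfl fun x hx => if_pos (by
      rw [HasAntidiagonal.mem_antidiagonal] at hx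
      rw [mem_range] at hn
      omega)
  rw [← h2, ← h1, sum_mul_sum, ← sum_sub_distrib]
  refine sum_mem fun i _ => ?_
  rw [← sum_sub_distrib]
  refine sum_mem fun j _ => ?_
  split_ifs with h
  · rw [sub_self]; exact zero_mem _
  · rw [sub_zero]
    exact opOrder_antitone (by omega) (mul_mem_opOrder (hA i) (hB j))

/-- The exponential series of an operator, cut off after degree `N`. -/
def expTrunc (N : ℕ) (A : Module.End ℝ Fam) : Module.End ℝ Fam :=
  ∑ k ∈ range (N + 1), (1 / (k.factorial : ℝ)) • A ^ k

lemma expTrunc_mem_opOrder (N : ℕ) {A : Module.End ℝ Fam} (hA : A ∈ opOrder 1) :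
    expTrunc N A ∈ opOrder 0 :=
  sum_mem fun k _ => Submodule.smul_mem _ _
    (opOrder_antitone (Nat.zero_le k) (pow_mem_opOrder hA k))

lemma sub_mem_opOrder_trans {i : ℕ} {A B C : Module.End ℝ Fam} (h : A - B ∈ opOrder i)
    (h' : B - C ∈ opOrder i) : A - C ∈ opOrder i := by
  have := add_mem h h'
  rwa [sub_add_sub_cancel] at this

lemma coeff_pow_mem_opOrder {Z : (Module.End ℝ Fam)⟦X⟧} (hZ : ∀ n, coeff n Z ∈ opOrder n)
    (k n : ℕ) : coeff n (Z ^ k) ∈ opOrder n := by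
  induction k generalizing n with
  | zero =>
    rw [pow_zero, coeff_one]
    split_ifs with h
    · rw [h]; exact one_mem_opOrder
    · exact zero_mem _
  | succ k ih =>
    rw [pow_succ, coeff_mul]
    refine sum_mem fun x hx => ?_
    rw [HasAntidiagonal.mem_antidiagonal] at hx
    rw [← hx]
    exact mul_mem_opOrder (ih _) (hZ _)

lemma pow_sum_coeff_sub_mem_opOrder (N : ℕ) {Z : (Module.End ℝ Fam)⟦X⟧}
    (hZ : ∀ n, coeff n Z ∈ opOrder n) (k : ℕ) :
    (∑ n ∈ range (N + 1), coeff n Z) ^ k - ∑ n ∈ range (N + 1), coeff n (Z ^ k) ∈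
      opOrder (N + 1) := by
  induction k with
  | zero =>
    simp only [pow_zero, coeff_one]
    rw [sum_ite_eq' (range (N + 1)), if_pos (by simp), sub_self]
    exact zero_mem _
  | succ k ih =>
    have h0 : ∑ n ∈ range (N + 1), coeff n Z ∈ opOrder 0 :=
      sum_mem fun n _ => opOrder_antitone (Nat.zero_le n) (hZ n)
    have h1 := mul_mem_opOrder ih h0
    have h2 := sum_mul_sum_sub_mem_opOrder N (coeff_pow_mem_opOrder hZ k) hZ
    rw [sub_mul, ← pow_succ, add_zero] at h1
    refine sub_mem_opOrder_trans h1 ?_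
    simpa only [pow_succ, coeff_mul] using h2

lemma expTrunc_sum_coeff_sub_mem_opOrder (N : ℕ) {Z : (Module.End ℝ Fam)⟦X⟧}
    (hZ : ∀ n, coeff n Z ∈ opOrder n) (hO : HasDiagOrder (expTerm Z)) :
    expTrunc N (∑ n ∈ range (N + 1), coeff n Z) -
      ∑ n ∈ range (N + 1), coeff n (diagSum (expTerm Z)) ∈ opOrder (N + 1) := by
  have h1 : ∑ n ∈ range (N + 1), coeff n (diagSum (expTerm Z)) =
      ∑ k ∈ range (N + 1), (1 / (k.factorial : ℝ)) • ∑ n ∈ range (N + 1), coeff n (Z ^ k) := by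
    simp only [diagSum, coeff_mk, smul_sum]
    rw [sum_comm]
    refine sum_congr rfl fun n hn => ?_
    rw [mem_range] at hn
    refine (sum_subset (range_subset_range.2 (show n + 1 ≤ N + 1 by omega)) fun k _ hk =>
      hO k n (by simpa [Nat.lt_succ_iff] using hk)).trans ?_
    exact sum_congr rfl fun k _ => by rw [expTerm, LinearMap.map_smul_of_tower]
  rw [h1, expTrunc, ← sum_sub_distrib]
  refine sum_mem fun k _ => ?_
  rw [← smul_sub (1 / (k.factorial : ℝ)) ((∑ n ∈ range (N + 1), coeff n Z) ^ k)]
  exact Submodule.smul_mem _ _ (pow_sum_coeff_sub_mem_opOrder N hZ k)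

/-- The Baker-Campbell-Hausdorff formula for truncated exponentials, up to operators of order
`N + 1`. -/
lemma expTrunc_mul_expTrunc_sub_mem_opOrder (N : ℕ) {x y : Module.End ℝ Fam}
    (hx : x ∈ opOrder 1) (hy : y ∈ opOrder 1)
    (hZ : ∀ n, bchTermOf opBracket x y n ∈ opOrder n) :
    expTrunc N x * expTrunc N y -
      expTrunc N (∑ n ∈ range (N + 1), bchTermOf opBracket x y n) ∈ opOrder (N + 1) := by
  have h1 := sum_mul_sum_sub_mem_opOrder N
    (A := fun k => (1 / (k.factorial : ℝ)) • x ^ k) (B := fun k => (1 / (k.factorial : ℝ)) • y ^ k)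
    (fun k => Submodule.smul_mem _ _ (pow_mem_opOrder hx k))
    (fun k => Submodule.smul_mem _ _ (pow_mem_opOrder hy k))
  have h2 := expTrunc_sum_coeff_sub_mem_opOrder N (Z := bchSeries x y)
    (fun n => by rw [bchSeries, coeff_mk]; exact hZ n)
    (hasDiagOrder_expTerm (by simp [bchSeries, bchTermOf_zero]))
  simp only [← coeff_bchExp] at h1
  refine sub_mem_opOrder_trans h1 ?_
  rw [← neg_sub]
  refine neg_mem ?_
  simpa only [bchSeries, coeff_mk, bchExp] using h2

lemma expTrunc_pow_sub_mem_opOrder (N : ℕ) {A : Module.End ℝ Fam} (hA : A ∈ opOrder 1) (j : ℕ) :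
    expTrunc N A ^ j - expTrunc N ((j : ℝ) • A) ∈ opOrder (N + 1) := by
  induction j with
  | zero =>
    have : expTrunc N ((0 : ℕ) • A : Module.End ℝ Fam) = 1 := by
      rw [expTrunc, sum_range_succ', zero_smul]
      simp
    rw [Nat.cast_zero, zero_smul]
    rw [zero_smul] at this
    rw [this, pow_zero, sub_self]
    exact zero_mem _
  | succ j ih =>
    have h1 := mul_mem_opOrder ih (expTrunc_mem_opOrder N hA)
    rw [sub_mul, ← pow_succ, add_zero] at h1
    refine sub_mem_opOrder_trans h1 ?_
    have h2 := sum_mul_sum_sub_mem_opOrder N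
      (A := fun k => (1 / (k.factorial : ℝ)) • ((j : ℝ) • A) ^ k)
      (B := fun k => (1 / (k.factorial : ℝ)) • A ^ k)
      (fun k => Submodule.smul_mem _ _ (pow_mem_opOrder (Submodule.smul_mem _ _ hA) k))
      (fun k => Submodule.smul_mem _ _ (pow_mem_opOrder hA k))
    have h3 : ∀ n : ℕ, ∀ x ∈ antidiagonal n, ((1 / (x.1.factorial : ℝ)) • ((j : ℝ) • A) ^ x.1) *
        ((1 / (x.2.factorial : ℝ)) • A ^ x.2) =
        (1 / (n.factorial : ℝ) * ((j : ℝ) ^ x.1 * 1 ^ x.2 * n.choose x.1)) • A ^ n := by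
      intro n x hx
      have hx := HasAntidiagonal.mem_antidiagonal.1 hx
      rw [← hx, smul_pow, smul_mul_smul_comm, smul_mul_assoc, ← pow_add, smul_smul,
        Nat.choose_symm_add, Nat.add_choose]
      congr 1
      rw [Nat.cast_div (Nat.factorial_mul_factorial_dvd_factorial_add _ _) (by positivity)]
      push_cast
      have : ((x.1 + x.2).factorial : ℝ) ≠ 0 := by positivity
      field_simp
      simp
    have h4 : expTrunc N (((j + 1 : ℕ) : ℝ) • A) = ∑ n ∈ range (N + 1), ∑ x ∈ antidiagonal n,
        ((1 / (x.1.factorial : ℝ)) • ((j : ℝ) • A) ^ x.1) * ((1 / (x.2.factorial : ℝ)) • A ^ x.2) :=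
      sum_congr rfl fun n _ => by
        rw [sum_congr rfl (h3 n), ← sum_smul, ← mul_sum, smul_pow, smul_smul, Nat.cast_add_one,
          add_pow, Nat.sum_antidiagonal_eq_sum_range_succ
            (fun a b => (j : ℝ) ^ a * 1 ^ b * (n.choose a : ℝ)) n]
    rw [h4]
    exact h2

/-- Weights that extract the linear coefficient of a polynomial of degree at most `N` from its
values at `0, …, N`. -/
lemma exists_weights (N : ℕ) : ∃ w : ℕ → ℝ, ∀ k ≤ N,
    ∑ j ∈ range (N + 1), w j * (j : ℝ) ^ k = if k = 1 then 1 else 0 := by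
  let M : Matrix (Fin (N + 1)) (Fin (N + 1)) ℝ :=
    Matrix.vandermonde fun j : Fin (N + 1) => ((j : ℕ) : ℝ)
  have hM : IsUnit M.det := by
    rw [isUnit_iff_ne_zero]
    exact Matrix.det_vandermonde_ne_zero_iff.2 fun a b h => Fin.ext (by exact_mod_cast h)
  let e : Fin (N + 1) → ℝ := fun k => if (k : ℕ) = 1 then 1 else 0
  let v : Fin (N + 1) → ℝ := Matrix.vecMul e M⁻¹
  have hv : Matrix.vecMul v M = e := by
    rw [Matrix.vecMul_vecMul, Matrix.nonsing_inv_mul M hM, Matrix.vecMul_one]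
  refine ⟨fun j => if h : j < N + 1 then v ⟨j, h⟩ else 0, fun k hk => ?_⟩
  have := congrFun hv ⟨k, by omega⟩
  rw [Matrix.vecMul, dotProduct] at this
  rw [← Fin.sum_univ_eq_sum_range
    (fun j => (if h : j < N + 1 then v ⟨j, h⟩ else 0) * (j : ℝ) ^ k) (N + 1)]
  simpa only [M, e, Matrix.vandermonde_apply, Fin.is_lt, dite_true, Fin.eta] using this

/-- Weights that extract linear coefficients recover an operator from the truncated exponentials
of its multiples. -/
lemma sum_weights_expTrunc {N : ℕ} (hN : 1 ≤ N) {w : ℕ → ℝ} (hw : ∀ k ≤ N,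
    ∑ j ∈ range (N + 1), w j * (j : ℝ) ^ k = if k = 1 then 1 else 0) (A : Module.End ℝ Fam) :
    ∑ j ∈ range (N + 1), w j • expTrunc N ((j : ℝ) • A) = A := by
  simp only [expTrunc, smul_sum, smul_pow, smul_smul]
  rw [sum_comm]
  have : ∀ k ∈ range (N + 1), ∑ j ∈ range (N + 1),
      (w j * (1 / (k.factorial : ℝ) * (j : ℝ) ^ k)) • A ^ k = if k = 1 then A else 0 := by
    intro k hk
    rw [← sum_smul]
    have : ∑ j ∈ range (N + 1), w j * (1 / (k.factorial : ℝ) * (j : ℝ) ^ k) =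
        (1 / (k.factorial : ℝ)) * ∑ j ∈ range (N + 1), w j * (j : ℝ) ^ k := by
      rw [mul_sum]; exact sum_congr rfl fun j _ => by ring
    rw [this, hw k (by rw [mem_range] at hk; omega)]
    split_ifs with h
    · simp [h]
    · simp
  rw [sum_congr rfl this, sum_ite_eq' (range (N + 1)), if_pos (by simp; omega)]

end Trunc

/-! ### Taylor expansion along the two half steps -/

/-- Taylor's formula for a chain of successive derivatives, with a two-sided remainder bound. -/
lemma abs_sub_taylor_le {u : ℕ → ℝ → ℝ} (hu : ∀ k s, HasDerivAt (u k) (u (k + 1) s) s)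
    (N : ℕ) {C r : ℝ} (hC : 0 ≤ C) (hb : ∀ s, |s| ≤ r → |u (N + 1) s| ≤ C) :
    ∀ s, |s| ≤ r → |u 0 s - ∑ k ∈ Finset.range (N + 1), s ^ k / k.factorial * u k 0| ≤
      C * |s| ^ (N + 1) := by
  have mvt : ∀ (f f' : ℝ → ℝ) (m : ℕ), (∀ s, HasDerivAt f (f' s) s) → f 0 = 0 →
      (∀ s, |s| ≤ r → |f' s| ≤ C * |s| ^ m) → ∀ s, |s| ≤ r → |f s| ≤ C * |s| ^ (m + 1) := by
    intro f f' m hf h0 hb s hs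
    have hmem : ∀ t ∈ Set.uIcc 0 s, |t| ≤ |s| := fun t ht => by
      simpa using Set.abs_sub_left_of_mem_uIcc ht
    have := Convex.norm_image_sub_le_of_norm_hasDerivWithin_le (f := f) (f' := f')
      (C := C * |s| ^ m) (s := Set.uIcc 0 s) (fun t _ => (hf t).hasDerivWithinAt)
      (fun t ht => (hb t ((hmem t ht).trans hs)).trans (by have := hmem t ht; gcongr))
      (convex_uIcc _ _) Set.left_mem_uIcc Set.right_mem_uIcc
    simpa [h0, pow_succ, mul_assoc] using this
  induction N generalizing u with
  | zero =>
    intro s hs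
    have := mvt (fun s => u 0 s - u 0 0) (u 1) 0 (fun s => (hu 0 s).sub_const _) (sub_self _)
      (fun s hs => by simpa using hb s hs) s hs
    simpa using this
  | succ N ih =>
    have hsum : ∀ s, HasDerivAt
        (fun s => ∑ k ∈ Finset.range (N + 1 + 1), s ^ k / k.factorial * u k 0)
        (∑ k ∈ Finset.range (N + 1), s ^ k / k.factorial * u (k + 1) 0) s := by
      intro s
      have h1 : HasDerivAt (fun s => ∑ k ∈ Finset.range (N + 1 + 1), s ^ k / k.factorial * u k 0)
          (∑ k ∈ Finset.range (N + 1 + 1), (k * s ^ (k - 1)) / k.factorial * u k 0) s :=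
        HasDerivAt.fun_sum fun k _ => ((hasDerivAt_pow k s).div_const _).mul_const _
      convert h1 using 1
      rw [Finset.sum_range_succ' _ (N + 1)]
      simp only [Nat.cast_zero, zero_mul, zero_div, add_zero]
      refine Finset.sum_congr rfl fun k _ => ?_
      rw [Nat.factorial_succ, Nat.add_sub_cancel]
      push_cast
      have : (k.factorial : ℝ) ≠ 0 := by positivity
      field_simp
    refine mvt _ _ (N + 1) (fun s => (hu 0 s).sub (hsum s)) ?_
      (ih (u := fun k => u (k + 1)) (fun k => hu (k + 1)) hb)
    rw [Finset.sum_range_succ']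
    simp

lemma isBigO_taylor (v : ℝ × ℝ × ℝ) (N : ℕ) (F : Fam) {g : Fam} (hg : g ∈ vanish 1) (z : ℝ × ℝ) :
    (fun w => F (w + g w • v) - ∑ k ∈ Finset.range (N + 1),
      g w ^ k / k.factorial * (dirDeriv v ^ k : Module.End ℝ Fam) F w)
      =O[𝓝 ((0 : ℝ), z)] fun w => w.1 ^ (N + 1) := by
  have hg1 := isBigO_of_mem_vanish hg z
  have hg0 : g ((0 : ℝ), z) = 0 := hg.1 z
  set G : Fam := (dirDeriv v ^ (N + 1) : Module.End ℝ Fam) F with hG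
  obtain ⟨C, hC⟩ := ((isCompact_closedBall ((0 : ℝ), z) (1 + ‖v‖)).exists_bound_of_continuousOn
    G.continuous.continuousOn)
  have hC0 : 0 ≤ C := (norm_nonneg _).trans (hC (0, z) (Metric.mem_closedBall_self (by positivity)))
  have hmain : (fun w => F (w + g w • v) - ∑ k ∈ Finset.range (N + 1),
      g w ^ k / k.factorial * (dirDeriv v ^ k : Module.End ℝ Fam) F w)
      =O[𝓝 ((0 : ℝ), z)] fun w => g w ^ (N + 1) := by
    refine IsBigO.of_bound C ?_
    have h1 : ∀ᶠ w in 𝓝 ((0 : ℝ), z), |g w| ≤ 1 := by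
      have := (g.continuous.abs).continuousAt (x := ((0 : ℝ), z))
      exact (this.eventually (gt_mem_nhds (by simp [hg0]))).mono fun w hw => le_of_lt hw
    filter_upwards [h1, Metric.closedBall_mem_nhds ((0 : ℝ), z) one_pos] with w hw hwz
    have hu : ∀ (k : ℕ) (s : ℝ), HasDerivAt
        (fun s => (dirDeriv v ^ k : Module.End ℝ Fam) F (w + s • v))
        ((dirDeriv v ^ (k + 1) : Module.End ℝ Fam) F (w + s • v)) s := fun k s => by
      have hl : HasDerivAt (fun s : ℝ => w + s • v) v s := by
        simpa using ((hasDerivAt_id s).smul_const v).const_add w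
      rw [pow_succ', Module.End.mul_apply]
      exact hasDerivAt_comp _ hl
    have hb : ∀ s : ℝ, |s| ≤ 1 → |(dirDeriv v ^ (N + 1) : Module.End ℝ Fam) F (w + s • v)| ≤ C :=
      fun s hs => hC _ (by
        rw [mem_closedBall_iff_norm] at hwz ⊢
        calc ‖w + s • v - (0, z)‖ = ‖(w - (0, z)) + s • v‖ := by congr 1; abel
          _ ≤ ‖w - (0, z)‖ + ‖s • v‖ := norm_add_le _ _
          _ ≤ 1 + ‖v‖ := by
            rw [norm_smul]
            have : ‖s‖ * ‖v‖ ≤ 1 * ‖v‖ := by gcongr; exact hs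
            linarith)
    have := abs_sub_taylor_le hu N hC0 hb (g w) hw
    simpa using this
  refine hmain.trans ?_
  have := hg1.pow (N + 1)
  simpa using this

end Fam

/-! ### The families attached to the map -/

lemma hasDerivAt_dilog_neg_exp (y : ℝ) :
    HasDerivAt (fun y => dilog (-Real.exp y)) (-Real.log (1 + Real.exp y)) y := by
  have h := HasDerivAt.comp y (h₂ := dilog) (h := fun y => -Real.exp y)
    (hasDerivAt_dilog (x := -Real.exp y) (neg_lt_zero.2 (Real.exp_pos y)))
    (Real.hasDerivAt_exp y).neg
  refine h.congr_deriv ?_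
  have := (Real.exp_pos y).ne'
  rw [sub_neg_eq_add]
  field_simp

lemma contDiff_dilog_neg_exp : ContDiff ℝ ∞ fun y => dilog (-Real.exp y) := by
  rw [contDiff_infty_iff_deriv]
  refine ⟨fun y => (hasDerivAt_dilog_neg_exp y).differentiableAt, ?_⟩
  rw [show deriv (fun y => dilog (-Real.exp y)) = fun y => -Real.log (1 + Real.exp y) from
    funext fun y => (hasDerivAt_dilog_neg_exp y).deriv]
  exact ((contDiff_const.add Real.contDiff_exp).log fun y => by positivity).neg

lemma potential_exp_eq (σ x : ℝ) : potential (Real.exp σ) x =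
    2 * (x * σ - dilog (-Real.exp (x - σ)) + dilog (-Real.exp (x + σ))
      + dilog (-Real.exp (-σ)) - dilog (-Real.exp σ)) := by
  rw [potential_eq_dilog (Real.exp_pos σ), Real.log_exp, Real.exp_sub, Real.exp_add, Real.exp_neg,
    neg_div, neg_div, one_div, neg_mul, mul_comm (Real.exp σ)]

lemma contDiff_potential_exp : ContDiff ℝ ∞ fun y : ℝ × ℝ => potential (Real.exp y.1) y.2 := by
  have h := contDiff_dilog_neg_exp
  have h1 : ContDiff ℝ ∞ fun y : ℝ × ℝ => dilog (-Real.exp (y.2 - y.1)) :=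
    h.comp (contDiff_snd.sub contDiff_fst)
  have h2 : ContDiff ℝ ∞ fun y : ℝ × ℝ => dilog (-Real.exp (y.2 + y.1)) :=
    h.comp (contDiff_snd.add contDiff_fst)
  have h3 : ContDiff ℝ ∞ fun y : ℝ × ℝ => dilog (-Real.exp (-y.1)) := h.comp contDiff_fst.neg
  have h4 : ContDiff ℝ ∞ fun y : ℝ × ℝ => dilog (-Real.exp y.1) := h.comp contDiff_fst
  simp only [potential_exp_eq]
  exact contDiff_const.mul
    (((((contDiff_snd.mul contDiff_fst).sub h1).add h2).add h3).sub h4)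

lemma potential_one (x : ℝ) : potential 1 x = 0 := by
  have := potential_exp_eq 0 x
  simpa using this

lemma force_one (x : ℝ) : force 1 x = 0 := by
  have : (1 + Real.exp x) / (1 + 1 * Real.exp x) = 1 := by
    rw [one_mul]; exact div_self (by positivity)
  rw [force, this, Real.log_one, mul_zero]

lemma contDiff_force_exp : ContDiff ℝ ∞ fun y : ℝ × ℝ => force (Real.exp y.1) y.2 := by
  have h1 : ContDiff ℝ ∞ fun y : ℝ × ℝ => Real.exp y.1 := Real.contDiff_exp.comp contDiff_fst
  have h2 : ContDiff ℝ ∞ fun y : ℝ × ℝ => Real.exp y.2 := Real.contDiff_exp.comp contDiff_snd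
  exact contDiff_const.mul (((h1.add h2).div (contDiff_const.add (h1.mul h2))
    (fun y => (by positivity : (1 + Real.exp y.1 * Real.exp y.2) ≠ 0))).log fun y =>
      (by positivity : (Real.exp y.1 + Real.exp y.2) / (1 + Real.exp y.1 * Real.exp y.2) ≠ 0))

namespace Fam

/-- The family of a smooth function of `(σ, q)`. -/
def ofQ (f : ℝ × ℝ → ℝ) (hf : ContDiff ℝ ∞ f) : Fam :=
  ⟨fun w => f (w.1, w.2.1), hf.comp (contDiff_fst.prodMk (contDiff_fst.comp contDiff_snd))⟩

/-- The family of a smooth function of `(σ, p)`. -/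
def ofP (f : ℝ × ℝ → ℝ) (hf : ContDiff ℝ ∞ f) : Fam :=
  ⟨fun w => f (w.1, w.2.2), hf.comp (contDiff_fst.prodMk (contDiff_snd.comp contDiff_snd))⟩

lemma dP_ofQ {f : ℝ × ℝ → ℝ} (hf : ContDiff ℝ ∞ f) : dP (ofQ f hf) = 0 :=
  ext fun ⟨σ, q, _⟩ => dP_apply_eq (F := ofQ f hf) (hasDerivAt_const _ (f (σ, q)))

lemma dQ_ofP {f : ℝ × ℝ → ℝ} (hf : ContDiff ℝ ∞ f) : dQ (ofP f hf) = 0 :=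
  ext fun ⟨σ, _, p⟩ => dQ_apply_eq (F := ofP f hf) (hasDerivAt_const _ (f (σ, p)))

lemma dQ_ofQ {f f' : ℝ × ℝ → ℝ} (hf : ContDiff ℝ ∞ f) (hf' : ContDiff ℝ ∞ f')
    (h : ∀ σ x, HasDerivAt (fun s => f (σ, s)) (f' (σ, x)) x) : dQ (ofQ f hf) = ofQ f' hf' :=
  ext fun ⟨σ, q, _⟩ => dQ_apply_eq (F := ofQ f hf) (h σ q)

lemma dP_ofP {f f' : ℝ × ℝ → ℝ} (hf : ContDiff ℝ ∞ f) (hf' : ContDiff ℝ ∞ f')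
    (h : ∀ σ x, HasDerivAt (fun s => f (σ, s)) (f' (σ, x)) x) : dP (ofP f hf) = ofP f' hf' :=
  ext fun ⟨σ, _, p⟩ => dP_apply_eq (F := ofP f hf) (h σ p)

lemma dS_ofQ {f f' : ℝ × ℝ → ℝ} (hf : ContDiff ℝ ∞ f) (hf' : ContDiff ℝ ∞ f')
    (h : ∀ σ x, HasDerivAt (fun s => f (s, x)) (f' (σ, x)) σ) : dS (ofQ f hf) = ofQ f' hf' :=
  ext fun ⟨σ, q, _⟩ => dS_apply_eq (F := ofQ f hf) (h σ q)

lemma dS_ofP {f f' : ℝ × ℝ → ℝ} (hf : ContDiff ℝ ∞ f) (hf' : ContDiff ℝ ∞ f')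
    (h : ∀ σ x, HasDerivAt (fun s => f (s, x)) (f' (σ, x)) σ) : dS (ofP f hf) = ofP f' hf' :=
  ext fun ⟨σ, _, p⟩ => dS_apply_eq (F := ofP f hf) (h σ p)

/-- The potential energy `V(q)` at `ρ = exp σ`. -/
def potQ : Fam := ofQ _ contDiff_potential_exp
/-- The kinetic energy `T(p)` at `ρ = exp σ`. -/
def potP : Fam := ofP _ contDiff_potential_exp
/-- The derivative `V'(q)` at `ρ = exp σ`. -/
def forceQ : Fam := ofQ _ contDiff_force_exp
/-- The derivative `T'(p)` at `ρ = exp σ`. -/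
def forceP : Fam := ofP _ contDiff_force_exp

lemma forceQ_apply (w : ℝ × ℝ × ℝ) : forceQ w = force (Real.exp w.1) w.2.1 := rfl
lemma forceP_apply (w : ℝ × ℝ × ℝ) : forceP w = force (Real.exp w.1) w.2.2 := rfl

lemma dQ_potQ : dQ potQ = forceQ :=
  dQ_ofQ _ _ fun σ x => hasDerivAt_potential (Real.exp_pos σ) x
lemma dP_potP : dP potP = forceP :=
  dP_ofP _ _ fun σ x => hasDerivAt_potential (Real.exp_pos σ) x
lemma dP_potQ : dP potQ = 0 := dP_ofQ _
lemma dQ_potP : dQ potP = 0 := dQ_ofP _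
lemma dP_forceQ : dP forceQ = 0 := dP_ofQ _
lemma dQ_forceP : dQ forceP = 0 := dQ_ofP _

lemma potQ_mem_vanish : potQ ∈ vanish 1 :=
  ⟨fun z => by
    change potential (Real.exp 0) z.1 = 0
    rw [Real.exp_zero, potential_one], mem_vanish_zero _⟩

lemma potP_mem_vanish : potP ∈ vanish 1 :=
  ⟨fun z => by
    change potential (Real.exp 0) z.2 = 0
    rw [Real.exp_zero, potential_one], mem_vanish_zero _⟩

lemma forceQ_mem_vanish : forceQ ∈ vanish 1 := by
  rw [← dQ_potQ]; exact dirDeriv_mem_vanish potQ_mem_vanish _ _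

lemma forceP_mem_vanish : forceP ∈ vanish 1 := by
  rw [← dP_potP]; exact dirDeriv_mem_vanish potP_mem_vanish _ _

/-- The terms of the Baker-Campbell-Hausdorff series of the two half steps. -/
def bchFam (n : ℕ) : Fam := bchTermOf bracket potQ potP n

lemma bchFam_apply (n : ℕ) (σ : ℝ) (z : ℝ × ℝ) :
    bchFam n (σ, z) = bchTerm (Vpart (Real.exp σ - 1)) (Tpart (Real.exp σ - 1)) n z := by
  have h := map_bchTermOf (slice σ) (slice_bracket σ) potQ potP n
  have hV : slice σ potQ = Vpart (Real.exp σ - 1) := by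
    funext z; rw [Vpart, add_sub_cancel]; rfl
  have hT : slice σ potP = Tpart (Real.exp σ - 1) := by
    funext z; rw [Tpart, add_sub_cancel]; rfl
  rw [bchTerm_eq_bchTermOf, ← hV, ← hT, ← h]
  rfl

lemma adPowOf_mem_vanish {Z : ℕ → Fam} {W : Fam} (n : ℕ) (hZ : ∀ k ≤ n, Z k ∈ vanish k)
    (hW : W ∈ vanish 1) (j : ℕ) : adPowOf bracket Z W j n ∈ vanish (n + 1) := by
  induction j generalizing n with
  | zero =>
    rw [adPowOf]
    split_ifs with h
    · rw [h]; exact hW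
    · exact zero_mem _
  | succ j ih =>
    refine sum_mem fun k hk => ?_
    have hk' := (Finset.mem_Icc.1 hk).2
    have := bracket_mem_vanish (ih (n - k) fun i hi => hZ i (by omega)) (hZ k hk')
    rwa [show n - k + 1 + k = n + 1 by omega] at this

lemma bchFam_mem_vanish (n : ℕ) : bchFam n ∈ vanish n := by
  induction n using Nat.strong_induction_on with
  | _ n ih =>
    cases n with
    | zero => exact mem_vanish_zero _
    | succ n =>
      rw [bchFam, bchTermOf_succ]
      have hZ : ∀ k ≤ n, bchTermOf bracket potQ potP k ∈ vanish k := fun k hk => ih k (by omega)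
      refine Submodule.smul_mem _ _ (sum_mem fun j _ => Submodule.smul_mem _ _ (add_mem
        (Submodule.smul_mem _ _ (adPowOf_mem_vanish n hZ potQ_mem_vanish j))
        (Submodule.smul_mem _ _ (adPowOf_mem_vanish n hZ potP_mem_vanish j))))

lemma hamₗ_bchFam (n : ℕ) :
    hamₗ (bchFam n) = bchTermOf opBracket (hamₗ potQ) (hamₗ potP) n :=
  map_bchTermOf hamₗ hamₗ_bracket potQ potP n

/-- The Baker-Campbell-Hausdorff series up to degree `N`. -/
def bchSum (N : ℕ) : Fam := ∑ n ∈ Finset.range (N + 1), bchFam n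

lemma bchSum_apply (N : ℕ) (σ : ℝ) (z : ℝ × ℝ) :
    bchSum N (σ, z) = bchPartialSum N (Real.exp σ - 1) z := by
  rw [bchSum, sum_apply, bchPartialSum, Finset.sum_range_succ', bchFam_apply,
    Finset.range_eq_Ico, Finset.sum_Ico_add' (fun n => bchFam n (σ, z)) 0 N 1]
  have : bchTerm (Vpart (Real.exp σ - 1)) (Tpart (Real.exp σ - 1)) 0 z = 0 := rfl
  rw [this, add_zero]
  refine Finset.sum_congr ?_ fun n _ => bchFam_apply n σ z
  ext k
  simp only [Finset.mem_Ico, Finset.mem_Icc]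
  omega

lemma bchSum_mem_vanish (N : ℕ) : bchSum N ∈ vanish 1 := by
  rw [bchSum, Finset.sum_range_succ']
  exact add_mem (sum_mem fun n _ => vanish_antitone (by omega) (bchFam_mem_vanish (n + 1)))
    (by rw [bchFam, bchTermOf_zero]; exact zero_mem _)

lemma ham_bchSum_mem_opOrder (N : ℕ) : ham (bchSum N) ∈ opOrder 1 :=
  ham_mem_opOrder (bchSum_mem_vanish N)

lemma ham_potP_pow (k : ℕ) (F : Fam) : (ham potP ^ k) F = forceP ^ k * (dQ ^ k) F := by
  have hc : ∀ k, dQ (forceP ^ k) = 0 := fun k => by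
    induction k with
    | zero => exact ext fun ⟨σ, q, p⟩ => dQ_apply_eq (F := (1 : Fam)) (hasDerivAt_const q 1)
    | succ k ih => rw [pow_succ, dirDeriv_mul, ih, dQ_forceP, mul_zero, mul_zero, add_zero]
  induction k with
  | zero => simp
  | succ k ih =>
    rw [pow_succ', Module.End.mul_apply, ih, ham_apply, dP_potP, dQ_potP, dirDeriv_mul, hc,
      mul_zero, mul_zero, add_zero, sub_zero, pow_succ', pow_succ', Module.End.mul_apply]
    ring

lemma ham_potQ_pow (k : ℕ) (F : Fam) : (ham potQ ^ k) F = (-forceQ) ^ k * (dP ^ k) F := by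
  have hc : ∀ k, dP ((-forceQ) ^ k) = 0 := fun k => by
    induction k with
    | zero => exact ext fun ⟨σ, q, p⟩ => dP_apply_eq (F := (1 : Fam)) (hasDerivAt_const p 1)
    | succ k ih =>
      rw [pow_succ, dirDeriv_mul, ih, _root_.map_neg, dP_forceQ, neg_zero, mul_zero, mul_zero,
        add_zero]
  induction k with
  | zero => simp
  | succ k ih =>
    rw [pow_succ', Module.End.mul_apply, ih, ham_apply, dP_potQ, dQ_potQ, mul_zero, dirDeriv_mul,
      hc, mul_zero, add_zero, zero_sub, pow_succ', pow_succ', Module.End.mul_apply]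
    ring

lemma expTrunc_apply_apply (N : ℕ) (A : Module.End ℝ Fam) (F : Fam) (w : ℝ × ℝ × ℝ) :
    expTrunc N A F w = ∑ k ∈ Finset.range (N + 1), 1 / (k.factorial : ℝ) * (A ^ k) F w := by
  rw [expTrunc, LinearMap.sum_apply, sum_apply]
  rfl

/-! ### The map as a product of truncated exponentials -/

/-- Pullback by the shift of `q` is the exponential of the operator of the kinetic energy. -/
lemma isBigO_stepP (N : ℕ) (F : Fam) (z : ℝ × ℝ) :
    (fun w => F (w + forceP w • ((0 : ℝ), (1 : ℝ), (0 : ℝ))) - expTrunc N (ham potP) F w)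
      =O[𝓝 ((0 : ℝ), z)] fun w => w.1 ^ (N + 1) := by
  refine (isBigO_taylor (0, 1, 0) N F forceP_mem_vanish z).congr_left fun w => ?_
  rw [expTrunc_apply_apply]
  congr 1
  refine Finset.sum_congr rfl fun k _ => ?_
  rw [ham_potP_pow, mul_apply, pow_apply]
  ring

/-- Pullback by the shift of `p` is the exponential of the operator of the potential energy. -/
lemma isBigO_stepQ (N : ℕ) (F : Fam) (z : ℝ × ℝ) :
    (fun w => F (w + (-forceQ) w • ((0 : ℝ), (0 : ℝ), (1 : ℝ))) - expTrunc N (ham potQ) F w)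
      =O[𝓝 ((0 : ℝ), z)] fun w => w.1 ^ (N + 1) := by
  refine (isBigO_taylor (0, 0, 1) N F (neg_mem forceQ_mem_vanish) z).congr_left fun w => ?_
  rw [expTrunc_apply_apply]
  congr 1
  refine Finset.sum_congr rfl fun k _ => ?_
  rw [ham_potQ_pow, mul_apply, pow_apply]
  ring

/-- The map at `ρ = exp σ` on the product of the parameter line and phase space. -/
def famMap (w : ℝ × ℝ × ℝ) : ℝ × ℝ × ℝ := (w.1, MKdV.map (Real.exp w.1) w.2)

lemma famMap_eq (w : ℝ × ℝ × ℝ) : famMap w =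
    (w + (-forceQ) w • ((0 : ℝ), (0 : ℝ), (1 : ℝ))) +
      forceP (w + (-forceQ) w • ((0 : ℝ), (0 : ℝ), (1 : ℝ))) • ((0 : ℝ), (1 : ℝ), (0 : ℝ)) := by
  obtain ⟨σ, q, p⟩ := w
  simp [famMap, MKdV.map, newQ_eq, newP_eq, neg_apply, forceP_apply, forceQ_apply, sub_eq_add_neg]

lemma continuous_halfStep :
    Continuous fun w : ℝ × ℝ × ℝ => w + (-forceQ) w • ((0 : ℝ), (0 : ℝ), (1 : ℝ)) :=
  continuous_id.add ((-forceQ).continuous.smul continuous_const)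

lemma continuous_famMap : Continuous famMap := by
  rw [show famMap = _ from funext famMap_eq]
  exact continuous_halfStep.add
    ((forceP.continuous.comp continuous_halfStep).smul continuous_const)

lemma famMap_zero (z : ℝ × ℝ) : famMap (0, z) = (0, z) := by
  rw [famMap_eq, neg_apply, forceQ_mem_vanish.1, neg_zero, zero_smul, add_zero,
    forceP_mem_vanish.1, zero_smul, add_zero]

lemma tendsto_famMap (z : ℝ × ℝ) : Tendsto famMap (𝓝 ((0 : ℝ), z)) (𝓝 ((0 : ℝ), z)) := by
  have := continuous_famMap.tendsto ((0 : ℝ), z)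
  rwa [famMap_zero] at this

/-- Pullback by one step of the map is the exponential of the operator of the
Baker-Campbell-Hausdorff sum, up to order `N + 1`. The shift of `p` acts first on points, hence the
operator of the potential energy stands on the left. -/
theorem isBigO_comp_famMap (N : ℕ) (F : Fam) (z : ℝ × ℝ) :
    (fun w => F (famMap w) - expTrunc N (ham (bchSum N)) F w)
      =O[𝓝 ((0 : ℝ), z)] fun w => w.1 ^ (N + 1) := by
  have ht : Tendsto (fun w : ℝ × ℝ × ℝ => w + (-forceQ) w • ((0 : ℝ), (0 : ℝ), (1 : ℝ)))
      (𝓝 ((0 : ℝ), z)) (𝓝 ((0 : ℝ), z)) := by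
    have := continuous_halfStep.tendsto ((0 : ℝ), z)
    rwa [neg_apply, forceQ_mem_vanish.1, neg_zero, zero_smul, add_zero] at this
  have h1 := (isBigO_stepP N F z).comp_tendsto ht
  have h2 := isBigO_stepQ N (expTrunc N (ham potP) F) z
  have hK : ham (bchSum N) =
      ∑ n ∈ Finset.range (N + 1), bchTermOf opBracket (ham potQ) (ham potP) n := by
    rw [← hamₗ_apply, bchSum, map_sum]
    exact Finset.sum_congr rfl fun n _ => hamₗ_bchFam n
  have h3 := isBigO_of_mem_vanish (apply_mem_vanish (expTrunc_mul_expTrunc_sub_mem_opOrder N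
    (ham_mem_opOrder potQ_mem_vanish) (ham_mem_opOrder potP_mem_vanish) (fun n => by
      have := hamₗ_bchFam n
      rw [hamₗ_apply, hamₗ_apply, hamₗ_apply] at this
      rw [← this]
      exact ham_mem_opOrder (bchFam_mem_vanish n))) F) z
  rw [← hK] at h3
  refine ((h1.congr_right (fun w => ?_)).add (h2.add h3)).congr_left fun w => ?_
  · simp
  · simp only [Function.comp_apply, ← famMap_eq, LinearMap.sub_apply, sub_apply,
      Module.End.mul_apply]
    ring

lemma isBigO_comp_famMap_iterate (N : ℕ) (F : Fam) (z : ℝ × ℝ) (j : ℕ) :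
    (fun w => F (famMap^[j] w) - (expTrunc N (ham (bchSum N)) ^ j) F w)
      =O[𝓝 ((0 : ℝ), z)] fun w => w.1 ^ (N + 1) := by
  induction j with
  | zero => simpa using isBigO_zero _ _
  | succ j ih =>
    have h1 := ih.comp_tendsto (tendsto_famMap z)
    have h2 := isBigO_comp_famMap N ((expTrunc N (ham (bchSum N)) ^ j) F) z
    refine ((h1.congr_right (fun w => ?_)).add h2).congr_left fun w => ?_
    · rfl
    · simp only [Function.comp_apply, pow_succ', Module.End.mul_apply, Function.iterate_succ_apply]
      ring

/-- The derivation of the Baker-Campbell-Hausdorff sum is a linear combination of iterates of the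
map, up to order `N + 1`. -/
lemma isBigO_ham_bchSum_sub_iterates {N : ℕ} (hN : 1 ≤ N) {a : ℕ → ℝ} (ha : ∀ k ≤ N,
    ∑ j ∈ Finset.range (N + 1), a j * (j : ℝ) ^ k = if k = 1 then 1 else 0) (F : Fam)
    (z : ℝ × ℝ) :
    (fun w => ham (bchSum N) F w - ∑ j ∈ Finset.range (N + 1), a j * F (famMap^[j] w))
      =O[𝓝 ((0 : ℝ), z)] fun w => w.1 ^ (N + 1) := by
  have h : ∀ j, (fun w => a j * (expTrunc N ((j : ℝ) • ham (bchSum N)) F w - F (famMap^[j] w)))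
      =O[𝓝 ((0 : ℝ), z)] fun w => w.1 ^ (N + 1) := fun j => by
    have h1 := isBigO_comp_famMap_iterate N F z j
    have h2 := isBigO_of_mem_vanish (apply_mem_vanish
      (expTrunc_pow_sub_mem_opOrder N (ham_bchSum_mem_opOrder N) j) F) z
    refine (((h1.add h2).const_mul_left (-a j))).congr_left fun w => ?_
    simp only [LinearMap.sub_apply, sub_apply]
    ring
  have hs : (fun w => ∑ j ∈ Finset.range (N + 1),
      a j * (expTrunc N ((j : ℝ) • ham (bchSum N)) F w - F (famMap^[j] w)))
      =O[𝓝 ((0 : ℝ), z)] fun w => w.1 ^ (N + 1) := IsBigO.fun_sum fun j _ => h j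
  refine hs.congr_left fun w => ?_
  conv_rhs => rw [← sum_weights_expTrunc hN ha (ham (bchSum N))]
  rw [LinearMap.sum_apply, sum_apply, ← Finset.sum_sub_distrib]
  refine Finset.sum_congr rfl fun j _ => ?_
  rw [LinearMap.smul_apply, smul_apply, mul_sub]

end Fam

namespace Fam

/-! ### Comparison with the flow of the invariant -/

/-- The invariant at `ρ = exp σ`. -/
def energy : Fam := ⟨fun w => invariant (Real.exp w.1) w.2, by
  change ContDiff ℝ ∞ _
  unfold invariant
  fun_prop⟩

lemma energy_apply (w : ℝ × ℝ × ℝ) : energy w = invariant (Real.exp w.1) w.2 := rfl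

lemma dQ_energy_apply (w : ℝ × ℝ × ℝ) : dQ energy w = invariantQ (Real.exp w.1) w.2 := by
  obtain ⟨σ, q, p⟩ := w
  refine dQ_apply_eq ?_
  have h : HasDerivAt (fun s : ℝ => (s, p)) (1, 0) q :=
    (hasDerivAt_id q).prodMk (hasDerivAt_const _ _)
  have := hasDerivAt_invariant_comp (Real.exp σ) h
  simp only [mul_one, mul_zero, add_zero] at this
  exact this

lemma dP_energy_apply (w : ℝ × ℝ × ℝ) : dP energy w = invariantP (Real.exp w.1) w.2 := by
  obtain ⟨σ, q, p⟩ := w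
  refine dP_apply_eq ?_
  have h : HasDerivAt (fun s : ℝ => (q, s)) (0, 1) p :=
    (hasDerivAt_const _ _).prodMk (hasDerivAt_id p)
  have := hasDerivAt_invariant_comp (Real.exp σ) h
  simp only [mul_one, mul_zero, zero_add] at this
  exact this

lemma hasDerivAt_comp_orbit (F : Fam) {σ : ℝ} {γ : ℝ → ℝ × ℝ} (hγ : IsOrbit (Real.exp σ) γ)
    (s : ℝ) : HasDerivAt (fun s => F (σ, γ s)) (ham energy F (σ, γ s)) s := by
  have h := F.hasDerivAt_comp ((hasDerivAt_const s σ).prodMk (hγ s))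
  refine h.congr_deriv ?_
  rw [hamField, dirDeriv_decomp, ham_apply_apply, dQ_energy_apply, dP_energy_apply]
  ring

end Fam

lemma abs_force_exp_le (σ x : ℝ) : |force (Real.exp σ) x| ≤ 2 * |σ| := by
  have h1 : ∀ σ x : ℝ, force (Real.exp σ) x ≤ 2 * |σ| := fun σ x => by
    have e1 := Real.exp_pos σ
    have e2 := Real.exp_pos x
    have e3 : (1 : ℝ) ≤ Real.exp |σ| := Real.one_le_exp (abs_nonneg σ)
    have e4 : Real.exp σ ≤ Real.exp |σ| := Real.exp_le_exp.2 (le_abs_self σ)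
    have e5 : 1 ≤ Real.exp |σ| * Real.exp σ := by
      rw [← Real.exp_add]; exact Real.one_le_exp (by linarith [neg_abs_le σ])
    rw [force]
    gcongr
    rw [Real.log_le_iff_le_exp (by positivity), div_le_iff₀ (by positivity)]
    nlinarith
  have h2 := h1 σ (-x)
  rw [force_neg (Real.exp_pos σ)] at h2
  exact abs_le.2 ⟨by linarith, h1 σ x⟩

lemma qStep_eq_force {ρ P : ℝ} (hρ : 0 < ρ) (hP : 2 * ρ ^ 2 + 8 * ρ + 2 < P) :
    qStep ρ P = force ρ (Real.log (Delta ρ P)) := by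
  rw [qStep, force, Real.exp_log (Delta_spec hρ hP).1]

namespace Fam

lemma twelve_lt_energy {z : ℝ × ℝ} (hz : z ≠ 0) : 12 < energy (0, z) := by
  have := lt_invariant one_pos hz
  rw [energy_apply, Real.exp_zero]
  linarith

lemma eventually_energy_mem {z : ℝ × ℝ} (hz : z ≠ 0) :
    ∀ᶠ w in 𝓝 ((0 : ℝ), z), energy w ∈ energyDomain (Real.exp w.1) := by
  have h1 : ∀ᶠ w : ℝ × ℝ × ℝ in 𝓝 ((0 : ℝ), z), w.2 ≠ 0 :=
    continuous_snd.continuousAt.eventually_ne hz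
  have h2 : ∀ᶠ w : ℝ × ℝ × ℝ in 𝓝 ((0 : ℝ), z), Real.exp w.1 + 1 / Real.exp w.1 < 6 := by
    have hc : Continuous fun w : ℝ × ℝ × ℝ => Real.exp w.1 + 1 / Real.exp w.1 := by
      have := fun w : ℝ × ℝ × ℝ => (Real.exp_pos w.1).ne'
      fun_prop (disch := assumption)
    exact hc.continuousAt.eventually (gt_mem_nhds (by norm_num))
  filter_upwards [h1, h2] with w hw1 hw2
  exact mem_energyDomain_of_lt (Real.exp_pos _) hw2.le (lt_invariant (Real.exp_pos _) hw1)

/-- The frequency is of the order of the parameter, because the step `qStep` is. -/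
lemma isBigO_frequency {z : ℝ × ℝ} (hz : z ≠ 0) :
    (fun w : ℝ × ℝ × ℝ => frequency (Real.exp w.1) (energy w)) =O[𝓝 ((0 : ℝ), z)]
      fun w => w.1 := by
  let R : (ℝ × ℝ × ℝ) × ℝ → ℝ := fun y => radicand (Real.exp y.1.1) (energy y.1) y.2
  have hR : Continuous R := by
    have := energy.continuous
    unfold R radicand
    fun_prop
  have hR0 : 0 < R ((0, z), 0) := by
    have := twelve_lt_energy hz
    simp only [R, radicand, Real.exp_zero, neg_zero]
    exact mul_pos (by linarith) (by linarith)
  have hev : ∀ᶠ y in 𝓝 (((0 : ℝ), z), (0 : ℝ)), R ((0, z), 0) / 2 < R y :=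
    hR.continuousAt.eventually (lt_mem_nhds (by linarith))
  rw [nhds_prod_eq] at hev
  obtain ⟨pa, ha, pb, hb, hab⟩ := eventually_prod_iff.1 hev
  obtain ⟨r, hr, hrb⟩ := Metric.eventually_nhds_iff.1 hb
  have hσ : ∀ᶠ w : ℝ × ℝ × ℝ in 𝓝 ((0 : ℝ), z), 2 * |w.1| < r := by
    have hc : Continuous fun w : ℝ × ℝ × ℝ => 2 * |w.1| := by fun_prop
    exact hc.continuousAt.eventually (gt_mem_nhds (by simpa using hr))
  refine IsBigO.of_bound (1 / √(R ((0, z), 0) / 2) * 2) ?_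
  filter_upwards [ha, hσ, eventually_energy_mem hz] with w hw hwσ hwD
  have hq : |qStep (Real.exp w.1) (energy w)| ≤ 2 * |w.1| := by
    rw [qStep_eq_force (Real.exp_pos _) hwD.1]
    exact abs_force_exp_le _ _
  have hbound : ∀ q ∈ Set.uIoc 0 (qStep (Real.exp w.1) (energy w)),
      ‖1 / √(radicand (Real.exp w.1) (energy w) q)‖ ≤ 1 / √(R ((0, z), 0) / 2) := by
    intro q hq'
    have hq1 : |q| ≤ |qStep (Real.exp w.1) (energy w)| := by
      simpa using Set.abs_sub_left_of_mem_uIcc (Set.uIoc_subset_uIcc hq')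
    have hRq : R ((0, z), 0) / 2 < R (w, q) := hab hw (hrb (by
      rw [Real.dist_0_eq_abs]; linarith))
    rw [Real.norm_of_nonneg (by positivity)]
    gcongr
  have := intervalIntegral.norm_integral_le_of_norm_le_const hbound
  rw [sub_zero] at this
  rw [frequency, norm_neg, mul_assoc]
  exact this.trans (mul_le_mul_of_nonneg_left hq (by positivity))

/-- Taylor's formula in time for the iterates of the map, which are the flow of the invariant at
multiples of the frequency. The remainder is uniform because the level curves near `z` lie in a
fixed ball. -/
lemma isBigO_iterate_sub_flow (N : ℕ) (F : Fam) {z : ℝ × ℝ} (hz : z ≠ 0) (j : ℕ) :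
    (fun w : ℝ × ℝ × ℝ => F (famMap^[j] w) - ∑ k ∈ Finset.range (N + 1),
      (j * frequency (Real.exp w.1) (energy w)) ^ k / k.factorial * (ham energy ^ k) F w)
      =O[𝓝 ((0 : ℝ), z)] fun w => w.1 ^ (N + 1) := by
  set E₀ := energy (0, z) + 1
  have hK : IsCompact (Metric.closedBall (0 : ℝ) 1 ×ˢ Metric.closedBall (0 : ℝ × ℝ) E₀) :=
    (isCompact_closedBall _ _).prod (isCompact_closedBall _ _)
  obtain ⟨C, hC⟩ := hK.exists_bound_of_continuousOn
    ((ham energy ^ (N + 1)) F).continuous.continuousOn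
  have hmain : (fun w : ℝ × ℝ × ℝ => F (famMap^[j] w) - ∑ k ∈ Finset.range (N + 1),
      (j * frequency (Real.exp w.1) (energy w)) ^ k / k.factorial * (ham energy ^ k) F w)
      =O[𝓝 ((0 : ℝ), z)] fun w => (j * frequency (Real.exp w.1) (energy w)) ^ (N + 1) := by
    refine IsBigO.of_bound C ?_
    have h1 : ∀ᶠ w : ℝ × ℝ × ℝ in 𝓝 ((0 : ℝ), z), energy w < E₀ :=
      energy.continuous.continuousAt.eventually (gt_mem_nhds (by simp [E₀]))
    have h2 : ∀ᶠ w : ℝ × ℝ × ℝ in 𝓝 ((0 : ℝ), z), 1 / 2 < Real.exp w.1 :=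
      (Real.continuous_exp.comp continuous_fst).continuousAt.eventually
        (lt_mem_nhds (by norm_num))
    have h3 : ∀ᶠ w : ℝ × ℝ × ℝ in 𝓝 ((0 : ℝ), z), |w.1| < 1 :=
      continuous_fst.abs.continuousAt.eventually (gt_mem_nhds (by simp))
    filter_upwards [h1, h2, h3, eventually_energy_mem hz] with w hw1 hw2 hw3 hwD
    have hρ := Real.exp_pos w.1
    obtain ⟨γ, hγ, hγ0⟩ := exists_orbit hρ w.2
    have hI : ∀ s, invariant (Real.exp w.1) (γ s) = energy w := fun s => by
      rw [hγ.invariant_eq s 0, hγ0, energy_apply]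
    have hiter : ∀ j : ℕ, famMap^[j] w = (w.1, γ (j * frequency (Real.exp w.1) (energy w))) := by
      intro j
      induction j with
      | zero => simp [hγ0]
      | succ j ih =>
        rw [Function.iterate_succ_apply', ih, famMap]
        simp only
        rw [hγ.map_eq hρ hwD (hI 0)]
        congr 2
        push_cast
        ring
    have hmem : ∀ s, (w.1, γ s) ∈
        Metric.closedBall (0 : ℝ) 1 ×ˢ Metric.closedBall (0 : ℝ × ℝ) E₀ := fun s => by
      refine ⟨by simpa using hw3.le, ?_⟩
      have := abs_le_invariant hρ (γ s)
      rw [hI] at this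
      rw [mem_closedBall_zero_iff]
      nlinarith [norm_nonneg (γ s)]
    have hC0 : 0 ≤ C := (norm_nonneg _).trans (hC _ (hmem 0))
    have ht := abs_sub_taylor_le (u := fun k s => (ham energy ^ k) F (w.1, γ s))
      (fun k s => by
        rw [pow_succ', Module.End.mul_apply]
        exact hasDerivAt_comp_orbit _ hγ s) N hC0 (r := |j * frequency (Real.exp w.1) (energy w)|)
      (fun s _ => hC _ (hmem s)) (j * frequency (Real.exp w.1) (energy w)) le_rfl
    rw [hγ0] at ht
    rw [hiter, norm_pow]
    simpa using ht
  refine hmain.trans ?_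
  exact ((isBigO_frequency hz).const_mul_left (j : ℝ)).pow (N + 1)

/-- Away from the fixed point, the derivation of the Baker-Campbell-Hausdorff sum is the frequency
times the derivation of the invariant, up to order `N + 1`. -/
theorem isBigO_ham_bchSum_sub_frequency {N : ℕ} (hN : 1 ≤ N) (F : Fam) {z : ℝ × ℝ}
    (hz : z ≠ 0) :
    (fun w : ℝ × ℝ × ℝ => ham (bchSum N) F w -
      frequency (Real.exp w.1) (energy w) * ham energy F w)
      =O[𝓝 ((0 : ℝ), z)] fun w => w.1 ^ (N + 1) := by
  obtain ⟨a, ha⟩ := exists_weights N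
  have h1 := isBigO_ham_bchSum_sub_iterates hN ha F z
  have h2 : (fun w : ℝ × ℝ × ℝ => ∑ j ∈ Finset.range (N + 1), a j *
      (F (famMap^[j] w) - ∑ k ∈ Finset.range (N + 1),
      (j * frequency (Real.exp w.1) (energy w)) ^ k / k.factorial * (ham energy ^ k) F w))
      =O[𝓝 ((0 : ℝ), z)] fun w => w.1 ^ (N + 1) :=
    IsBigO.fun_sum fun j _ => (isBigO_iterate_sub_flow N F hz j).const_mul_left _
  refine (h1.add h2).congr_left fun w => ?_
  set ν := frequency (Real.exp w.1) (energy w)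
  have h3 : ∑ j ∈ Finset.range (N + 1), a j * ∑ k ∈ Finset.range (N + 1),
      (j * ν) ^ k / k.factorial * (ham energy ^ k) F w = ν * ham energy F w := by
    simp only [Finset.mul_sum]
    rw [Finset.sum_comm]
    have : ∀ k ∈ Finset.range (N + 1), ∑ j ∈ Finset.range (N + 1), a j *
        ((j * ν) ^ k / k.factorial * (ham energy ^ k) F w) =
        if k = 1 then ν * ham energy F w else 0 := by
      intro k hk
      have e : ∑ j ∈ Finset.range (N + 1), a j *
        ((j * ν) ^ k / k.factorial * (ham energy ^ k) F w) =
        (∑ j ∈ Finset.range (N + 1), a j * (j : ℝ) ^ k) *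
          (ν ^ k / k.factorial * (ham energy ^ k) F w) := by
        rw [Finset.sum_mul]
        exact Finset.sum_congr rfl fun j _ => by rw [mul_pow]; ring
      rw [e, ha k (by rw [Finset.mem_range] at hk; omega)]
      split_ifs with h
      · simp [h]
      · simp
    rw [Finset.sum_congr rfl this, Finset.sum_ite_eq' (Finset.range (N + 1)),
      if_pos (by simp; omega)]
  simp only [mul_sub, Finset.sum_sub_distrib, h3]
  ring

/-! ### Integration over phase space -/

/-- A family whose gradient in phase space is of order `m`, locally uniformly, is of order `m` up
to a function of the parameter. -/
lemma isBigO_sub_of_gradient {Ω : Set (ℝ × ℝ)} (hc : IsPreconnected Ω)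
    {G : ℝ × ℝ × ℝ → ℝ} {G' : ℝ × ℝ × ℝ → ℝ × ℝ →L[ℝ] ℝ} {m : ℕ}
    (hG : ∀ z ∈ Ω, ∀ᶠ w in 𝓝 ((0 : ℝ), z), HasFDerivAt (fun y => G (w.1, y)) (G' w) w.2)
    (hO : ∀ z ∈ Ω, G' =O[𝓝 ((0 : ℝ), z)] fun w => w.1 ^ m) {z z₁ : ℝ × ℝ} (hz : z ∈ Ω)
    (hz₁ : z₁ ∈ Ω) :
    (fun w : ℝ × ℝ × ℝ => G w - G (w.1, z₁)) =O[𝓝 ((0 : ℝ), z)] fun w => w.1 ^ m := by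
  have hloc : ∀ x ∈ Ω, ∃ C r : ℝ, 0 < r ∧ ∀ σ, |σ| < r → ∀ y ∈ Metric.ball x r,
      ∀ y' ∈ Metric.ball x r, ‖G (σ, y) - G (σ, y')‖ ≤ C * ‖σ ^ m‖ := by
    intro x hx
    obtain ⟨C, hC, hC1⟩ := (hO x hx).exists_nonneg
    obtain ⟨r, hr, hb⟩ := Metric.eventually_nhds_iff_ball.1 ((hG x hx).and hC1.bound)
    refine ⟨C * (r + r), r, hr, fun σ hσ y hy y' hy' => ?_⟩
    have hb' : ∀ y ∈ Metric.ball x r, (σ, y) ∈ Metric.ball ((0 : ℝ), x) r := fun y hy => by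
      rw [← ball_prod_same]
      exact ⟨by simpa using hσ, hy⟩
    have := Convex.norm_image_sub_le_of_norm_hasFDerivWithin_le (f := fun y => G (σ, y))
      (f' := fun y => G' (σ, y)) (C := C * ‖σ ^ m‖) (s := Metric.ball x r)
      (fun y hy => (hb _ (hb' y hy)).1.hasFDerivWithinAt) (fun y hy => (hb _ (hb' y hy)).2)
      (convex_ball _ _) hy' hy
    refine this.trans ?_
    have hd : ‖y - y'‖ ≤ r + r := by
      rw [← dist_eq_norm]
      exact (dist_triangle_right y y' x).trans (add_le_add hy.le hy'.le)
    calc C * ‖σ ^ m‖ * ‖y - y'‖ ≤ C * ‖σ ^ m‖ * (r + r) := by gcongr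
      _ = C * (r + r) * ‖σ ^ m‖ := by ring
  have hpt : (fun σ : ℝ => G (σ, z) - G (σ, z₁)) =O[𝓝 0] fun σ => σ ^ m := by
    refine hc.induction₂' (fun z z' => (fun σ : ℝ => G (σ, z) - G (σ, z')) =O[𝓝 0] fun σ => σ ^ m)
      (fun x hx => ?_) (fun x y z _ _ _ h h' => ?_) hz hz₁
    · obtain ⟨C, r, hr, hb⟩ := hloc x hx
      have hσ : ∀ᶠ σ : ℝ in 𝓝 0, |σ| < r := by
        have := Metric.ball_mem_nhds (0 : ℝ) hr
        filter_upwards [this] with σ hσ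
        simpa using hσ
      filter_upwards [mem_nhdsWithin_of_mem_nhds (Metric.ball_mem_nhds x hr)] with y hy
      exact ⟨IsBigO.of_bound C (hσ.mono fun σ hσ => hb σ hσ x (Metric.mem_ball_self hr) y hy),
        IsBigO.of_bound C (hσ.mono fun σ hσ => hb σ hσ y hy x (Metric.mem_ball_self hr))⟩
    · exact (h.add h').congr_left fun σ => by ring
  obtain ⟨C, r, hr, hb⟩ := hloc z hz
  have h1 : (fun w : ℝ × ℝ × ℝ => G w - G (w.1, z)) =O[𝓝 ((0 : ℝ), z)] fun w => w.1 ^ m := by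
    refine IsBigO.of_bound C ?_
    filter_upwards [Metric.ball_mem_nhds ((0 : ℝ), z) hr] with w hw
    rw [← ball_prod_same] at hw
    exact hb w.1 (by simpa using hw.1) w.2 hw.2 z (Metric.mem_ball_self hr)
  have h2 := hpt.comp_tendsto (continuous_fst.tendsto ((0 : ℝ), z))
  exact (h1.add h2).congr_left fun w => by simp

lemma isBigO_of_partials {L : ℝ × ℝ × ℝ → ℝ × ℝ →L[ℝ] ℝ} {l : Filter (ℝ × ℝ × ℝ)}
    {g : ℝ × ℝ × ℝ → ℝ} (h1 : (fun w => L w (1, 0)) =O[l] g)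
    (h2 : (fun w => L w (0, 1)) =O[l] g) : L =O[l] g := by
  refine IsBigO.trans (isBigO_of_le _ fun w => ?_) (h1.norm_left.add h2.norm_left)
  rw [Real.norm_of_nonneg (by positivity)]
  refine ContinuousLinearMap.opNorm_le_bound _ (by positivity) fun v => ?_
  have : L w v = v.1 * L w (1, 0) + v.2 * L w (0, 1) := by
    rw [← smul_eq_mul, ← smul_eq_mul, ← map_smul, ← map_smul, ← map_add]
    simp
  rw [this, add_mul]
  refine (norm_add_le _ _).trans (add_le_add ?_ ?_)
  · rw [norm_mul, mul_comm]; gcongr; exact norm_fst_le v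
  · rw [norm_mul, mul_comm]; gcongr; exact norm_snd_le v

/-- The phase space gradient of a family. -/
def grad (F : Fam) (w : ℝ × ℝ × ℝ) : ℝ × ℝ →L[ℝ] ℝ :=
  (fderiv ℝ F w).comp (ContinuousLinearMap.inr ℝ ℝ (ℝ × ℝ))

lemma hasFDerivAt_grad (F : Fam) (w : ℝ × ℝ × ℝ) :
    HasFDerivAt (fun y => F (w.1, y)) (grad F w) w.2 := by
  have h := (F.differentiable w).hasFDerivAt
  exact HasFDerivAt.comp w.2 (f := fun y => (w.1, y)) h (hasFDerivAt_prodMk_right w.1 w.2)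

/-- The coordinate `q`. -/
def coordQ : Fam := ofQ (fun y => y.2) contDiff_snd
/-- The coordinate `p`. -/
def coordP : Fam := ofP (fun y => y.2) contDiff_snd

lemma ham_coordQ_apply (G : Fam) (w : ℝ × ℝ × ℝ) : ham G coordQ w = dP G w := by
  obtain ⟨σ, q, p⟩ := w
  rw [ham_apply_apply, coordQ, dP_ofQ, zero_apply, zero_mul, sub_zero,
    dQ_apply_eq (F := ofQ (fun y => y.2) contDiff_snd) (hasDerivAt_id q), one_mul]

lemma ham_coordP_apply (G : Fam) (w : ℝ × ℝ × ℝ) : ham G coordP w = -dQ G w := by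
  obtain ⟨σ, q, p⟩ := w
  rw [ham_apply_apply, coordP, dQ_ofP, zero_apply, zero_mul, zero_sub,
    dP_apply_eq (F := ofP (fun y => y.2) contDiff_snd) (hasDerivAt_id p), one_mul]

lemma isBigO_grad_bchSum_sub_frequency {N : ℕ} (hN : 1 ≤ N) {z : ℝ × ℝ} (hz : z ≠ 0) :
    (fun w : ℝ × ℝ × ℝ => grad (bchSum N) w -
      frequency (Real.exp w.1) (energy w) • grad energy w)
      =O[𝓝 ((0 : ℝ), z)] fun w => w.1 ^ (N + 1) := by
  refine isBigO_of_partials ?_ ?_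
  · refine (isBigO_ham_bchSum_sub_frequency hN coordP hz).neg_left.congr_left fun w => ?_
    rw [ham_coordP_apply, ham_coordP_apply]
    change _ = dQ (bchSum N) w - frequency (Real.exp w.1) (energy w) * dQ energy w
    ring
  · refine (isBigO_ham_bchSum_sub_frequency hN coordQ hz).congr_left fun w => ?_
    rw [ham_coordQ_apply, ham_coordQ_apply]
    rfl

lemma isPreconnected_compl_zero : IsPreconnected ({0}ᶜ : Set (ℝ × ℝ)) :=
  (isConnected_compl_singleton_of_one_lt_rank (by
    rw [rank_prod', Module.rank_self, one_add_one_eq_two]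
    exact Cardinal.one_lt_two) 0).isPreconnected

/-- Antiderivatives of the frequency, evaluated on the invariant, agree with the
Baker-Campbell-Hausdorff sum of degree `N` up to order `N + 1` and a function of the parameter. -/
theorem isBigO_antiderivative_sub_bchSum {Hs : ℝ → ℝ → ℝ}
    (hHs : ∀ ρ, 0 < ρ → IsFrequencyAntiderivative ρ (Hs ρ)) {N : ℕ} (hN : 1 ≤ N)
    {z z₁ : ℝ × ℝ} (hz : z ≠ 0) (hz₁ : z₁ ≠ 0) :
    (fun w : ℝ × ℝ × ℝ => (bchSum N w - Hs (Real.exp w.1) (energy w)) -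
      (bchSum N (w.1, z₁) - Hs (Real.exp w.1) (energy (w.1, z₁))))
      =O[𝓝 ((0 : ℝ), z)] fun w => w.1 ^ (N + 1) := by
  refine isBigO_sub_of_gradient isPreconnected_compl_zero
    (G := fun w => bchSum N w - Hs (Real.exp w.1) (energy w))
    (fun x hx => ?_) (fun x hx => isBigO_grad_bchSum_sub_frequency hN hx) hz hz₁
  filter_upwards [eventually_energy_mem (z := x) hx] with w hw
  have h1 := hHs _ (Real.exp_pos w.1) _ hw
  exact (hasFDerivAt_grad _ w).sub (HasDerivAt.comp_hasFDerivAt w.2 h1 (hasFDerivAt_grad energy w))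

end Fam

/-! ### Antiderivatives of the frequency -/

lemma continuous_Delta : ContinuousOn (fun y : ℝ × ℝ => Delta y.1 y.2) {y | 0 < y.1} := by
  unfold Delta
  refine ContinuousOn.div (by fun_prop) (by fun_prop) fun y hy => ?_
  have : 0 < y.1 := hy
  positivity

lemma isOpen_energyDomain (ρ : ℝ) : IsOpen (energyDomain ρ) :=
  (isOpen_lt continuous_const continuous_id).inter
    (isOpen_lt continuous_const (continuous_id.sub continuous_const))

lemma ordConnected_energyDomain (ρ : ℝ) : (energyDomain ρ).OrdConnected :=
  ⟨fun _ hx _ _ _ hz => ⟨hx.1.trans_le hz.1, hx.2.trans_le (sub_le_sub_right hz.1 _)⟩⟩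

lemma continuousOn_frequency {ρ : ℝ} (hρ : 0 < ρ) :
    ContinuousOn (frequency ρ) (energyDomain ρ) := by
  rw [continuousOn_iff_continuous_domRestrict]
  have hΔ : Continuous fun P : energyDomain ρ => Delta ρ P :=
    continuous_Delta.comp_continuous (f := fun P : energyDomain ρ => (ρ, (P : ℝ)))
      (continuous_const.prodMk continuous_subtype_val) fun _ => hρ
  have hΔ0 : ∀ P : energyDomain ρ, 0 < Delta ρ P := fun P => (Delta_spec hρ P.2.1).1
  have hx : Continuous fun P : energyDomain ρ => qStep ρ P := by
    have h1 : ∀ P : energyDomain ρ, 1 + ρ * Delta ρ P ≠ 0 := fun P => by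
      have := hΔ0 P; positivity
    have h2 : ∀ P : energyDomain ρ, (ρ + Delta ρ P) / (1 + ρ * Delta ρ P) ≠ 0 := fun P => by
      have := hΔ0 P; positivity
    exact continuous_const.mul (((continuous_const.add hΔ).div
      (continuous_const.add (continuous_const.mul hΔ)) h1).log h2)
  -- Clamping the variable to the interval of integration makes the integrand globally continuous.
  let c : energyDomain ρ → ℝ → ℝ := fun P q => max (-|qStep ρ P|) (min q |qStep ρ P|)
  have hc : ∀ P q, |c P q| ≤ |qStep ρ P| := fun P q =>
    abs_le.2 ⟨le_max_left _ _, max_le (by linarith [abs_nonneg (qStep ρ P)]) (min_le_right _ _)⟩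
  have hc_id : ∀ (P : energyDomain ρ) (q : ℝ), |q| ≤ |qStep ρ P| → c P q = q := fun P q h => by
    simp only [c, min_eq_left (abs_le.1 h).2, max_eq_right (abs_le.1 h).1]
  let f : energyDomain ρ → ℝ → ℝ := fun P q => 1 / √(radicand ρ P (c P q))
  have hf : Continuous f.uncurry := by
    have h1 : Continuous fun y : energyDomain ρ × ℝ => qStep ρ y.1 := hx.comp continuous_fst
    have h2 : Continuous fun y : energyDomain ρ × ℝ => c y.1 y.2 :=
      h1.abs.neg.max (continuous_snd.min h1.abs)
    have h3 : Continuous fun y : energyDomain ρ × ℝ => radicand ρ y.1 (c y.1 y.2) := by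
      unfold radicand
      fun_prop
    refine continuous_const.div h3.sqrt fun y => ?_
    have h4 := radicand_pos_of_mem_step hρ y.1.2 Set.right_mem_uIcc
    exact (Real.sqrt_pos.2 (h4.trans_le (radicand_anti hρ y.1.2.1 (hc y.1 y.2)))).ne'
  refine (intervalIntegral.continuous_parametric_intervalIntegral_of_continuous
    (μ := MeasureTheory.volume) (a₀ := 0) hf hx).neg.congr fun P => ?_
  change _ = frequency ρ P
  rw [frequency]
  congr 1
  refine intervalIntegral.integral_congr fun q hq => ?_
  have : |q| ≤ |qStep ρ P| := by simpa using Set.abs_sub_left_of_mem_uIcc hq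
  simp only [f, hc_id P q this]

lemma hasDerivAt_integral_frequency {ρ b P : ℝ} (hρ : 0 < ρ) (hb : b ∈ energyDomain ρ)
    (hP : P ∈ energyDomain ρ) :
    HasDerivAt (fun P => ∫ x in b..P, frequency ρ x) (frequency ρ P) P := by
  have hc := continuousOn_frequency hρ
  have hs : Set.uIcc b P ⊆ energyDomain ρ := (ordConnected_energyDomain ρ).uIcc_subset hb hP
  exact intervalIntegral.integral_hasDerivAt_right (hc.mono hs).intervalIntegrable
    (hc.stronglyMeasurableAtFilter (isOpen_energyDomain ρ) P hP)
    (hc.continuousAt ((isOpen_energyDomain ρ).mem_nhds hP))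

lemma frequency_one (P : ℝ) : frequency 1 P = 0 := by
  have : qStep 1 P = 0 := by
    rw [qStep, one_mul]
    by_cases h : 1 + Delta 1 P = 0
    · rw [h, div_zero, Real.log_zero, mul_zero]
    · rw [div_self h, Real.log_one, mul_zero]
  rw [frequency, this, intervalIntegral.integral_same, neg_zero]

/-- The base point of the antiderivative: the value of the invariant at `z`, as long as it lies in
the energy domain, and otherwise an arbitrary point of the energy domain. -/
def basePoint (z : ℝ × ℝ) (ρ : ℝ) : ℝ :=
  open Classical in
  if invariant ρ z ∈ energyDomain ρ then invariant ρ z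
  else max (2 * ρ ^ 2 + 8 * ρ + 2) ((1 + ρ) ^ 2 * (ρ + 1 / ρ - 4) + 4 * ρ) + 1

lemma basePoint_mem (z : ℝ × ℝ) (ρ : ℝ) : basePoint z ρ ∈ energyDomain ρ := by
  rw [basePoint]
  split_ifs with h
  · exact h
  · have h1 := le_max_left (2 * ρ ^ 2 + 8 * ρ + 2) ((1 + ρ) ^ 2 * (ρ + 1 / ρ - 4) + 4 * ρ)
    have h2 := le_max_right (2 * ρ ^ 2 + 8 * ρ + 2) ((1 + ρ) ^ 2 * (ρ + 1 / ρ - 4) + 4 * ρ)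
    constructor <;> linarith

/-- The antiderivative of the frequency that takes the value of the explicit third order expansion
at the point `z`. -/
def modifiedHam (z : ℝ × ℝ) (ρ P : ℝ) : ℝ :=
  expansionQP (ρ - 1) z + ∫ x in basePoint z ρ..P, frequency ρ x

lemma isFrequencyAntiderivative_modifiedHam (z : ℝ × ℝ) {ρ : ℝ} (hρ : 0 < ρ) :
    IsFrequencyAntiderivative ρ (modifiedHam z ρ) := fun _ hP =>
  (hasDerivAt_integral_frequency hρ (basePoint_mem z ρ) hP).const_add _

lemma modifiedHam_one (z : ℝ × ℝ) (P : ℝ) : modifiedHam z 1 P = 0 := by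
  have h : frequency 1 = fun _ => 0 := funext frequency_one
  simp [modifiedHam, h, expansionQP]

lemma modifiedHam_invariant {z : ℝ × ℝ} {ρ : ℝ} (h : invariant ρ z ∈ energyDomain ρ) :
    modifiedHam z ρ (invariant ρ z) = expansionQP (ρ - 1) z := by
  rw [modifiedHam, basePoint, if_pos h, intervalIntegral.integral_same, add_zero]

lemma tendsto_startPoint {P : ℝ} (hP : 12 < P) :
    Tendsto (fun σ => startPoint (Real.exp σ) P) (𝓝 0) (𝓝 (startPoint 1 P)) := by
  have h1 : ContinuousAt (fun y : ℝ × ℝ => Delta y.1 y.2) (1, P) :=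
    continuous_Delta.continuousAt ((isOpen_lt continuous_const continuous_fst).mem_nhds
      (show (0 : ℝ) < 1 from one_pos))
  have h2 : Tendsto (fun σ : ℝ => (Real.exp σ, P)) (𝓝 0) (𝓝 ((1 : ℝ), P)) := by
    have : Continuous fun σ : ℝ => (Real.exp σ, P) := by fun_prop
    simpa using this.tendsto 0
  have h3 := (h1.tendsto.comp h2).log
    (Delta_spec (ρ := 1) (P := P) one_pos (by linarith)).1.ne'
  exact tendsto_const_nhds.prodMk_nhds h3

lemma startPoint_one_ne_zero {P : ℝ} (hP : 12 < P) : startPoint 1 P ≠ 0 := fun h => by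
  obtain ⟨h0, h1, -⟩ := Delta_spec (ρ := 1) (P := P) one_pos (by linarith)
  have h2 : Real.log (Delta 1 P) = 0 := congrArg Prod.snd h
  have := Real.log_neg h0 h1
  linarith

/-! ### The half-angle hyperbolic tangent -/

/-- The function `x ↦ tanh (x / 2)`. -/
def tanhHalf (x : ℝ) : ℝ := (Real.exp x - 1) / (Real.exp x + 1)

lemma hasDerivAt_tanhHalf (x : ℝ) : HasDerivAt tanhHalf ((1 - tanhHalf x ^ 2) / 2) x := by
  have := Real.exp_pos x
  refine (((Real.hasDerivAt_exp x).sub_const 1).div ((Real.hasDerivAt_exp x).add_const 1)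
    (by positivity)).congr_deriv ?_
  rw [tanhHalf]
  field_simp
  ring

lemma contDiff_tanhHalf : ContDiff ℝ ∞ tanhHalf :=
  (Real.contDiff_exp.sub contDiff_const).div (Real.contDiff_exp.add contDiff_const)
    fun x => (add_pos (Real.exp_pos x) one_pos).ne'

lemma hasDerivAt_force_exp (σ x : ℝ) : HasDerivAt (fun s => force (Real.exp s) x)
    (-tanhHalf (x - σ) - tanhHalf (x + σ)) σ := by
  have e1 := Real.exp_pos σ
  have e2 := Real.exp_pos x
  have h1 : HasDerivAt (fun s => Real.exp s + Real.exp x) (Real.exp σ) σ :=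
    (Real.hasDerivAt_exp σ).add_const _
  have h2 : HasDerivAt (fun s => 1 + Real.exp s * Real.exp x) (Real.exp σ * Real.exp x) σ :=
    ((Real.hasDerivAt_exp σ).mul_const _).const_add _
  have h0 : (Real.exp σ + Real.exp x) / (1 + Real.exp σ * Real.exp x) ≠ 0 := by positivity
  refine (((h1.fun_div h2 (by positivity)).log h0).const_mul 2).congr_deriv ?_
  rw [tanhHalf, tanhHalf, Real.exp_sub, Real.exp_add]
  field_simp
  ring

namespace Fam

/-- Evaluation of families at a point, as a ring homomorphism. -/
def ev (w : ℝ × ℝ × ℝ) : Fam →+* ℝ where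
  toFun F := F w
  map_one' := rfl
  map_mul' _ _ := rfl
  map_zero' := rfl
  map_add' _ _ := rfl

lemma ofNat_apply (n : ℕ) [n.AtLeastTwo] (w : ℝ × ℝ × ℝ) :
    (ofNat(n) : Fam) w = ofNat(n) := map_ofNat (ev w) n

lemma one_apply (w : ℝ × ℝ × ℝ) : (1 : Fam) w = 1 := rfl

lemma dirDeriv_one (v : ℝ × ℝ × ℝ) : dirDeriv v 1 = 0 := by
  have h := dirDeriv_mul v 1 1
  rw [one_mul, one_mul] at h
  exact left_eq_add.1 h

lemma dirDeriv_ofNat (v : ℝ × ℝ × ℝ) (n : ℕ) [n.AtLeastTwo] :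
    dirDeriv v (ofNat(n) : Fam) = 0 := by
  have h : (ofNat(n) : Fam) = (n : ℝ) • 1 := ext fun w => by
    rw [ofNat_apply, smul_apply, one_apply, mul_one]; rfl
  rw [h, map_smul, dirDeriv_one, smul_zero]

lemma dirDeriv_pow (v : ℝ × ℝ × ℝ) (F : Fam) (n : ℕ) :
    dirDeriv v (F ^ n) = n * F ^ (n - 1) * dirDeriv v F := by
  induction n with
  | zero => rw [pow_zero, dirDeriv_one]; simp
  | succ n ih =>
    rw [pow_succ, dirDeriv_mul, ih]
    cases n with
    | zero => simp
    | succ n => simp only [Nat.add_sub_cancel]; push_cast; ring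

/-- The ideal of families vanishing to order `m`. -/
def vanishIdeal (m : ℕ) : Ideal Fam :=
  { vanish m with
    smul_mem' := fun F G hG => by
      have := mul_mem_vanish (mem_vanish_zero F) hG
      rwa [zero_add] at this }

lemma ofQ_mem_vanish_succ {f f' : ℝ × ℝ → ℝ} (hf : ContDiff ℝ ∞ f) (hf' : ContDiff ℝ ∞ f')
    (h : ∀ σ x, HasDerivAt (fun s => f (s, x)) (f' (σ, x)) σ) (h0 : ∀ x, f (0, x) = 0) {m : ℕ}
    (hm : ofQ f' hf' ∈ vanish m) : ofQ f hf ∈ vanish (m + 1) :=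
  ⟨fun z => h0 z.1, by rwa [dS_ofQ hf hf' h]⟩

lemma ofP_mem_vanish_succ {f f' : ℝ × ℝ → ℝ} (hf : ContDiff ℝ ∞ f) (hf' : ContDiff ℝ ∞ f')
    (h : ∀ σ x, HasDerivAt (fun s => f (s, x)) (f' (σ, x)) σ) (h0 : ∀ x, f (0, x) = 0) {m : ℕ}
    (hm : ofP f' hf' ∈ vanish m) : ofP f hf ∈ vanish (m + 1) :=
  ⟨fun z => h0 z.2, by rwa [dS_ofP hf hf' h]⟩

/-! ### Third order expansion of the elementary families -/

/-- The parameter `σ / 12`; the factor clears the denominators of the third order expansions. -/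
def sF : Fam := ofQ (fun y => y.1 / 12) (contDiff_fst.div_const 12)
/-- The parameter `τ = ρ - 1`. -/
def tF : Fam := ofQ (fun y => Real.exp y.1 - 1) (by fun_prop)
/-- The function `a = tanh (q / 2)`. -/
def aF : Fam := ofQ (fun y => tanhHalf y.2) (contDiff_tanhHalf.comp contDiff_snd)
/-- The function `b = tanh (p / 2)`. -/
def bF : Fam := ofP (fun y => tanhHalf y.2) (contDiff_tanhHalf.comp contDiff_snd)
/-- The derivative of `tanh (q / 2)`. -/
def aF' : Fam := (1 / 2 : ℝ) • (1 - aF ^ 2)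
/-- The derivative of `tanh (p / 2)`. -/
def bF' : Fam := (1 / 2 : ℝ) • (1 - bF ^ 2)

lemma aF_sq : aF ^ 2 = 1 - 2 * aF' := ext fun w => by
  simp only [aF', pow_apply, sub_apply, mul_apply, smul_apply, one_apply, ofNat_apply]; ring

lemma bF_sq : bF ^ 2 = 1 - 2 * bF' := ext fun w => by
  simp only [bF', pow_apply, sub_apply, mul_apply, smul_apply, one_apply, ofNat_apply]; ring

lemma dQ_aF : dQ aF = aF' := ext fun ⟨σ, q, p⟩ => by
  rw [dQ_apply_eq (F := aF) (hasDerivAt_tanhHalf q), aF', smul_apply, sub_apply, pow_apply,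
    one_apply]
  change _ = 1 / 2 * (1 - tanhHalf q ^ 2)
  ring

lemma dP_bF : dP bF = bF' := ext fun ⟨σ, q, p⟩ => by
  rw [dP_apply_eq (F := bF) (hasDerivAt_tanhHalf p), bF', smul_apply, sub_apply, pow_apply,
    one_apply]
  change _ = 1 / 2 * (1 - tanhHalf p ^ 2)
  ring

lemma dP_aF : dP aF = 0 := dP_ofQ _
lemma dQ_bF : dQ bF = 0 := dQ_ofP _
lemma dP_sF : dP sF = 0 := dP_ofQ _
lemma dP_tF : dP tF = 0 := dP_ofQ _
lemma dQ_sF : dQ sF = 0 :=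
  ext fun ⟨σ, q, _⟩ => dQ_apply_eq (F := sF) (hasDerivAt_const q (σ / 12))
lemma dQ_tF : dQ tF = 0 :=
  ext fun ⟨σ, q, _⟩ => dQ_apply_eq (F := tF) (hasDerivAt_const q (Real.exp σ - 1))

lemma dQ_aF' : dQ aF' = -aF * aF' := by
  rw [aF', map_smul, map_sub, dirDeriv_one, dirDeriv_pow, dQ_aF, aF']
  ext w
  simp only [sub_apply, mul_apply, smul_apply, neg_apply, zero_apply, pow_apply, one_apply, pow_one,
    Nat.cast_ofNat, ofNat_apply, Nat.add_one_sub_one]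
  ring

lemma dP_bF' : dP bF' = -bF * bF' := by
  rw [bF', map_smul, map_sub, dirDeriv_one, dirDeriv_pow, dP_bF, bF']
  ext w
  simp only [sub_apply, mul_apply, smul_apply, neg_apply, zero_apply, pow_apply, one_apply, pow_one,
    Nat.cast_ofNat, ofNat_apply, Nat.add_one_sub_one]
  ring

lemma sF_mem_vanish : sF ∈ vanish 1 := ⟨fun _ => zero_div _, mem_vanish_zero _⟩

lemma tF_mem_vanish : tF ∈ vanish 1 :=
  ⟨fun _ => by change Real.exp 0 - 1 = 0; rw [Real.exp_zero, sub_self], mem_vanish_zero _⟩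

lemma pow_four_mem_vanish {F : Fam} (hF : F ∈ vanish 1) : F ^ 4 ∈ vanish 4 := by
  have h := mul_mem_vanish (mul_mem_vanish (mul_mem_vanish hF hF) hF) hF
  rwa [show F * F * F * F = F ^ 4 by ring] at h

lemma tF_sub_mem_vanish : tF - (12 * sF + 72 * sF ^ 2 + 288 * sF ^ 3) ∈ vanish 4 := by
  have c : ∀ f : ℝ → ℝ, ContDiff ℝ ∞ f → ContDiff ℝ ∞ fun y : ℝ × ℝ => f y.1 :=
    fun f hf => hf.comp contDiff_fst
  have h := ofQ_mem_vanish_succ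
    (c (fun x => Real.exp x - 1 - x - x ^ 2 / 2 - x ^ 3 / 6) (by fun_prop))
    (c (fun x => Real.exp x - 1 - x - x ^ 2 / 2) (by fun_prop))
    (fun σ x => ((((((Real.hasDerivAt_exp σ).sub_const 1).sub (hasDerivAt_id σ)).sub
      ((hasDerivAt_pow 2 σ).div_const 2)).sub ((hasDerivAt_pow 3 σ).div_const 6))).congr_deriv
        (by simp; ring)) (fun x => by simp)
    (ofQ_mem_vanish_succ _ (c (fun x => Real.exp x - 1 - x) (by fun_prop))
      (fun σ x => ((((Real.hasDerivAt_exp σ).sub_const 1).sub (hasDerivAt_id σ)).sub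
        ((hasDerivAt_pow 2 σ).div_const 2)).congr_deriv (by simp)) (fun x => by simp)
      (ofQ_mem_vanish_succ _ (c (fun x => Real.exp x - 1) (by fun_prop))
        (fun σ x => ((Real.hasDerivAt_exp σ).sub_const 1).sub (hasDerivAt_id σ))
        (fun x => by simp)
        (ofQ_mem_vanish_succ _ (c Real.exp Real.contDiff_exp)
          (fun σ x => (Real.hasDerivAt_exp σ).sub_const 1) (fun x => by simp)
          (mem_vanish_zero _))))
  convert h using 1
  ext ⟨σ, q, p⟩
  simp only [sub_apply, add_apply, mul_apply, pow_apply, ofNat_apply]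
  change (Real.exp σ - 1) - (12 * (σ / 12) + 72 * (σ / 12) ^ 2 + 288 * (σ / 12) ^ 3) =
    Real.exp σ - 1 - σ - σ ^ 2 / 2 - σ ^ 3 / 6
  ring

/-- The successive derivatives in `σ` of the remainder in the third order expansion of the force,
together with the initial values that vanish. -/
lemma exists_force_remainder : ∃ f₁ f₂ f₃ f₄ : ℝ × ℝ → ℝ,
    ContDiff ℝ ∞ f₁ ∧ ContDiff ℝ ∞ f₂ ∧ ContDiff ℝ ∞ f₃ ∧ ContDiff ℝ ∞ f₄ ∧
    (∀ σ x, HasDerivAt (fun s => force (Real.exp s) x + 2 * s * tanhHalf x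
      - s ^ 3 / 6 * (tanhHalf x - tanhHalf x ^ 3)) (f₁ (σ, x)) σ) ∧
    (∀ σ x, HasDerivAt (fun s => f₁ (s, x)) (f₂ (σ, x)) σ) ∧
    (∀ σ x, HasDerivAt (fun s => f₂ (s, x)) (f₃ (σ, x)) σ) ∧
    (∀ σ x, HasDerivAt (fun s => f₃ (s, x)) (f₄ (σ, x)) σ) ∧
    (∀ x, f₁ (0, x) = 0) ∧ (∀ x, f₂ (0, x) = 0) ∧ (∀ x, f₃ (0, x) = 0) := by
  have ct := contDiff_tanhHalf
  have cA : ContDiff ℝ ∞ fun y : ℝ × ℝ => tanhHalf (y.2 - y.1) :=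
    ct.comp (contDiff_snd.sub contDiff_fst)
  have cB : ContDiff ℝ ∞ fun y : ℝ × ℝ => tanhHalf (y.2 + y.1) :=
    ct.comp (contDiff_snd.add contDiff_fst)
  have cX : ContDiff ℝ ∞ fun y : ℝ × ℝ => tanhHalf y.2 := ct.comp contDiff_snd
  have cs : ContDiff ℝ ∞ fun y : ℝ × ℝ => y.1 := contDiff_fst
  have hA : ∀ σ x, HasDerivAt (fun s => tanhHalf (x - s))
      ((1 - tanhHalf (x - σ) ^ 2) / 2 * (-1)) σ := fun σ x =>
    (hasDerivAt_tanhHalf (x - σ)).comp σ ((hasDerivAt_id σ).const_sub x)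
  have hB : ∀ σ x, HasDerivAt (fun s => tanhHalf (x + s))
      ((1 - tanhHalf (x + σ) ^ 2) / 2 * 1) σ := fun σ x =>
    (hasDerivAt_tanhHalf (x + σ)).comp σ ((hasDerivAt_id σ).const_add x)
  refine ⟨fun y => -tanhHalf (y.2 - y.1) - tanhHalf (y.2 + y.1) + 2 * tanhHalf y.2
      - y.1 ^ 2 / 2 * (tanhHalf y.2 - tanhHalf y.2 ^ 3),
    fun y => (tanhHalf (y.2 + y.1) ^ 2 - tanhHalf (y.2 - y.1) ^ 2) / 2
      - y.1 * (tanhHalf y.2 - tanhHalf y.2 ^ 3),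
    fun y => (tanhHalf (y.2 + y.1) - tanhHalf (y.2 + y.1) ^ 3) / 2
      + (tanhHalf (y.2 - y.1) - tanhHalf (y.2 - y.1) ^ 3) / 2
      - (tanhHalf y.2 - tanhHalf y.2 ^ 3),
    fun y => (1 - 3 * tanhHalf (y.2 + y.1) ^ 2) * (1 - tanhHalf (y.2 + y.1) ^ 2) / 4
      - (1 - 3 * tanhHalf (y.2 - y.1) ^ 2) * (1 - tanhHalf (y.2 - y.1) ^ 2) / 4,
    by fun_prop, by fun_prop, by fun_prop, by fun_prop, fun σ x => ?_, fun σ x => ?_,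
    fun σ x => ?_, fun σ x => ?_, fun x => ?_, fun x => ?_, fun x => ?_⟩
  · refine (((hasDerivAt_force_exp σ x).add (((hasDerivAt_id σ).const_mul 2).mul_const
      (tanhHalf x))).sub (((hasDerivAt_pow 3 σ).div_const 6).mul_const
        (tanhHalf x - tanhHalf x ^ 3))).congr_deriv ?_
    simp only [Nat.cast_ofNat, Nat.add_one_sub_one]
    ring
  · refine ((((hA σ x).neg.sub (hB σ x)).add_const (2 * tanhHalf x)).sub
      (((hasDerivAt_pow 2 σ).div_const 2).mul_const
        (tanhHalf x - tanhHalf x ^ 3))).congr_deriv ?_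
    simp only [Nat.cast_ofNat, Nat.add_one_sub_one]
    ring
  · refine (((((hB σ x).pow 2).sub ((hA σ x).pow 2)).div_const 2).sub
      ((hasDerivAt_id σ).mul_const (tanhHalf x - tanhHalf x ^ 3))).congr_deriv ?_
    simp only [Nat.cast_ofNat, Nat.add_one_sub_one]
    ring
  · refine (((((hB σ x).sub ((hB σ x).pow 3)).div_const 2).add
      (((hA σ x).sub ((hA σ x).pow 3)).div_const 2)).sub_const
        (tanhHalf x - tanhHalf x ^ 3)).congr_deriv ?_
    simp only [Nat.cast_ofNat, Nat.add_one_sub_one]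
    ring
  · simp only [sub_zero, add_zero]; ring
  · simp only [sub_zero, add_zero]; ring
  · simp only [sub_zero, add_zero]; ring

lemma contDiff_force_remainder : ContDiff ℝ ∞ fun y : ℝ × ℝ => force (Real.exp y.1) y.2 +
    2 * y.1 * tanhHalf y.2 - y.1 ^ 3 / 6 * (tanhHalf y.2 - tanhHalf y.2 ^ 3) := by
  have h1 := contDiff_force_exp
  have h2 : ContDiff ℝ ∞ fun y : ℝ × ℝ => tanhHalf y.2 := contDiff_tanhHalf.comp contDiff_snd
  fun_prop

lemma forceQ_sub_mem_vanish :
    forceQ - (-24 * sF * aF + 288 * sF ^ 3 * (aF - aF ^ 3)) ∈ vanish 4 := by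
  obtain ⟨f₁, f₂, f₃, f₄, c₁, c₂, c₃, c₄, d₁, d₂, d₃, d₄, z₁, z₂, z₃⟩ := exists_force_remainder
  have h := ofQ_mem_vanish_succ contDiff_force_remainder c₁ d₁
    (fun x => by simp [force_one]) (ofQ_mem_vanish_succ c₁ c₂ d₂ z₁ (ofQ_mem_vanish_succ c₂ c₃ d₃ z₂
      (ofQ_mem_vanish_succ c₃ c₄ d₄ z₃ (mem_vanish_zero _))))
  convert h using 1
  ext ⟨σ, q, p⟩
  simp only [sub_apply, add_apply, mul_apply, pow_apply, neg_apply, ofNat_apply]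
  change force (Real.exp σ) q - (-24 * (σ / 12) * tanhHalf q +
    288 * (σ / 12) ^ 3 * (tanhHalf q - tanhHalf q ^ 3)) = force (Real.exp σ) q +
    2 * σ * tanhHalf q - σ ^ 3 / 6 * (tanhHalf q - tanhHalf q ^ 3)
  ring

lemma forceP_sub_mem_vanish :
    forceP - (-24 * sF * bF + 288 * sF ^ 3 * (bF - bF ^ 3)) ∈ vanish 4 := by
  obtain ⟨f₁, f₂, f₃, f₄, c₁, c₂, c₃, c₄, d₁, d₂, d₃, d₄, z₁, z₂, z₃⟩ := exists_force_remainder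
  have h := ofP_mem_vanish_succ contDiff_force_remainder c₁ d₁
    (fun x => by simp [force_one]) (ofP_mem_vanish_succ c₁ c₂ d₂ z₁ (ofP_mem_vanish_succ c₂ c₃ d₃ z₂
      (ofP_mem_vanish_succ c₃ c₄ d₄ z₃ (mem_vanish_zero _))))
  convert h using 1
  ext ⟨σ, q, p⟩
  simp only [sub_apply, add_apply, mul_apply, pow_apply, neg_apply, ofNat_apply]
  change force (Real.exp σ) p - (-24 * (σ / 12) * tanhHalf p +
    288 * (σ / 12) ^ 3 * (tanhHalf p - tanhHalf p ^ 3)) = force (Real.exp σ) p +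
    2 * σ * tanhHalf p - σ ^ 3 / 6 * (tanhHalf p - tanhHalf p ^ 3)
  ring

end Fam

namespace Fam

/-! ### The third order expansion of the Baker-Campbell-Hausdorff series -/

lemma bchFam_one : bchFam 1 = potQ + potP := by
  rw [bchFam, bchTermOf_succ]
  simp [adPowOf]

lemma bracket_potQ (F : Fam) : bracket potQ F = forceQ * dP F := by
  rw [bracket, dQ_potQ, dP_potQ, zero_mul, sub_zero]

lemma bracket_potP (F : Fam) : bracket potP F = -(forceP * dQ F) := by
  rw [bracket, dP_potP, dQ_potP, zero_mul, zero_sub]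

lemma dQ_bchFam_one : dQ (bchFam 1) = forceQ := by
  rw [bchFam_one, map_add, dQ_potQ, dQ_potP, add_zero]

lemma dP_bchFam_one : dP (bchFam 1) = forceP := by
  rw [bchFam_one, map_add, dP_potQ, dP_potP, zero_add]

lemma bracket_zero_left (F : Fam) : bracket 0 F = 0 := by simp [bracket]

lemma adPowOf_one_one (Z : ℕ → Fam) (W : Fam) : adPowOf bracket Z W 1 1 = bracket W (Z 1) := by
  simp [adPowOf]

lemma adPowOf_one_two (Z : ℕ → Fam) (W : Fam) : adPowOf bracket Z W 1 2 = bracket W (Z 2) := by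
  simp [adPowOf, show Finset.Icc 1 2 = {1, 2} from rfl, bracket_zero_left]

lemma adPowOf_two_two (Z : ℕ → Fam) (W : Fam) :
    adPowOf bracket Z W 2 2 = bracket (bracket W (Z 1)) (Z 1) := by
  rw [adPowOf, show Finset.Icc 1 2 = {1, 2} from rfl, Finset.sum_pair (by norm_num),
    show 2 - 1 = 1 from rfl, adPowOf_one_one, show 2 - 2 = 0 from rfl]
  simp [adPowOf, bracket_zero_left]

lemma bchFam_two : bchFam 2 = (-1 / 2 : ℝ) • (forceQ * forceP) := by
  have h1 : bchTermOf bracket potQ potP 1 = bchFam 1 := rfl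
  rw [bchFam, bchTermOf_succ, Finset.sum_range_succ, Finset.sum_range_one, adPowOf_one_one,
    adPowOf_one_one, h1, bracket_potQ, bracket_potP, dQ_bchFam_one, dP_bchFam_one]
  ext w
  simp [add_apply, smul_apply, mul_apply, neg_apply, bernoulli_one, bernoulli'_one,
    adPowOf]
  ring

lemma dQ_forceQ_forceP : dQ (forceQ * forceP) = forceP * dQ forceQ := by
  rw [dirDeriv_mul, dQ_forceP, mul_zero, zero_add]

lemma dP_forceQ_forceP : dP (forceQ * forceP) = forceQ * dP forceP := by
  rw [dirDeriv_mul, dP_forceQ, mul_zero, add_zero]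

lemma bchFam_three : bchFam 3 =
    (1 / 12 : ℝ) • (forceQ ^ 2 * dP forceP + forceP ^ 2 * dQ forceQ) := by
  have h1 : bchTermOf bracket potQ potP 1 = bchFam 1 := rfl
  have h2 : bchTermOf bracket potQ potP 2 = bchFam 2 := rfl
  have hb : bracket (-(forceP * forceQ)) (bchFam 1) = -bracket (forceQ * forceP) (bchFam 1) := by
    rw [bracket, bracket, _root_.map_neg, _root_.map_neg, mul_comm forceP]; ring
  rw [bchFam, bchTermOf_succ, Finset.sum_range_succ, Finset.sum_range_succ, Finset.sum_range_one,
    adPowOf_one_two, adPowOf_one_two, adPowOf_two_two, adPowOf_two_two, h1, h2, bracket_potQ,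
    bracket_potP, bracket_potQ, bracket_potP, dQ_bchFam_one, dP_bchFam_one, hb, bchFam_two,
    map_smul, map_smul, dQ_forceQ_forceP, dP_forceQ_forceP]
  ext w
  simp [add_apply, smul_apply, mul_apply, neg_apply, pow_apply, bernoulli_one,
    bernoulli'_one, bernoulli_eq_bernoulli'_of_ne_one, adPowOf]
  ring

lemma twelve_bchSum_three : 12 * bchSum 3 = 12 * potQ + 12 * potP - 6 * (forceQ * forceP) +
    (forceQ ^ 2 * dP forceP + forceP ^ 2 * dQ forceQ) := by
  have h0 : bchFam 0 = 0 := rfl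
  rw [bchSum]
  simp only [Finset.sum_range_succ, Finset.sum_range_zero, h0, bchFam_one, bchFam_two,
    bchFam_three]
  ext w
  simp only [add_apply, sub_apply, smul_apply, mul_apply, zero_apply, pow_apply, ofNat_apply]
  ring

lemma dQ_twelve_bchSum_three : dQ (12 * bchSum 3) = 12 * forceQ - 6 * dQ forceQ * forceP +
    forceP ^ 2 * dQ (dQ forceQ) + 2 * forceQ * dQ forceQ * dP forceP := by
  rw [twelve_bchSum_three]
  have h : dQ (dP forceP) = 0 := by rw [dirDeriv_comm, dQ_forceP, map_zero]
  simp only [map_add, map_sub, dirDeriv_mul, dirDeriv_ofNat, dirDeriv_pow, dQ_potQ, dQ_potP,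
    dQ_forceP, h]
  push_cast
  ring

lemma dP_twelve_bchSum_three : dP (12 * bchSum 3) = 12 * forceP - 6 * dP forceP * forceQ +
    forceQ ^ 2 * dP (dP forceP) + 2 * forceP * dP forceP * dQ forceQ := by
  rw [twelve_bchSum_three]
  have h : dP (dQ forceQ) = 0 := by rw [dirDeriv_comm, dP_forceQ, map_zero]
  simp only [map_add, map_sub, dirDeriv_mul, dirDeriv_ofNat, dirDeriv_pow, dP_potQ, dP_potP,
    dP_forceQ, h]
  push_cast
  ring

/-- The logarithmic term `L` of the explicit expansion. -/
def logF : Fam := ⟨fun w => w.2.2 + w.2.1 -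
    2 * Real.log ((1 + Real.exp w.2.2) * (1 + Real.exp w.2.1)), by
  change ContDiff ℝ ∞ _
  have : ∀ w : ℝ × ℝ × ℝ, (1 + Real.exp w.2.2) * (1 + Real.exp w.2.1) ≠ 0 :=
    fun w => by positivity
  fun_prop (disch := assumption)⟩

lemma dQ_logF : dQ logF = -aF := ext fun ⟨σ, q, p⟩ => by
  have e1 := Real.exp_pos q
  have e2 := Real.exp_pos p
  have h1 : HasDerivAt (fun s => (1 + Real.exp p) * (1 + Real.exp s))
      ((1 + Real.exp p) * Real.exp q) q := ((Real.hasDerivAt_exp q).const_add 1).const_mul _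
  have h2 := (((hasDerivAt_id q).const_add p).sub ((h1.log (by positivity)).const_mul 2))
  refine (dQ_apply_eq (F := logF) h2).trans ?_
  change _ = -((Real.exp q - 1) / (Real.exp q + 1))
  field_simp
  ring

lemma dP_logF : dP logF = -bF := ext fun ⟨σ, q, p⟩ => by
  have e1 := Real.exp_pos q
  have e2 := Real.exp_pos p
  have h1 : HasDerivAt (fun s => (1 + Real.exp s) * (1 + Real.exp q))
      (Real.exp p * (1 + Real.exp q)) p := ((Real.hasDerivAt_exp p).const_add 1).mul_const _
  have h2 := (((hasDerivAt_id p).add_const q).sub ((h1.log (by positivity)).const_mul 2))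
  refine (dP_apply_eq (F := logF) h2).trans ?_
  change _ = -((Real.exp p - 1) / (Real.exp p + 1))
  field_simp
  ring

/-- Twelve times the explicit third order expansion, written with `tanh (q / 2)` and
`tanh (p / 2)`. -/
def expansionF : Fam := 24 * tF * logF - 12 * tF ^ 2 * (logF + 2 * (1 + aF * bF)) +
  2 * tF ^ 3 * (3 * (1 - aF ^ 2 * bF ^ 2) + 3 * ((1 + aF * bF) ^ 2 + (aF + bF) ^ 2) +
    4 * (1 - aF ^ 2) * (1 - bF ^ 2) + 4 * logF)

lemma expansionF_apply (σ : ℝ) (z : ℝ × ℝ) :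
    expansionF (σ, z) = 12 * expansionQP (Real.exp σ - 1) z := by
  obtain ⟨q, p⟩ := z
  simp only [expansionF, add_apply, sub_apply, mul_apply, pow_apply, ofNat_apply, one_apply,
    expansionQP]
  have hl : logF (σ, q, p) = p + q - 2 * Real.log ((1 + Real.exp p) * (1 + Real.exp q)) := rfl
  have ht : tF (σ, q, p) = Real.exp σ - 1 := rfl
  have ha : aF (σ, q, p) = (Real.exp q - 1) / (Real.exp q + 1) := rfl
  have hb : bF (σ, q, p) = (Real.exp p - 1) / (Real.exp p + 1) := rfl
  have e1 := Real.exp_pos q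
  have e2 := Real.exp_pos p
  have x1 : Real.exp (p + q) = Real.exp p * Real.exp q := Real.exp_add _ _
  have x2 : Real.exp (p + 2 * q) = Real.exp p * Real.exp q ^ 2 := by
    rw [Real.exp_add, two_mul, Real.exp_add, sq]
  have x3 : Real.exp (2 * p + q) = Real.exp p ^ 2 * Real.exp q := by
    rw [Real.exp_add, two_mul, Real.exp_add, sq]
  have x4 : Real.exp (2 * (p + q)) = Real.exp p ^ 2 * Real.exp q ^ 2 := by
    rw [two_mul, Real.exp_add, x1]; ring
  rw [hl, ht, ha, hb, x1, x2, x3, x4]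
  generalize p + q - 2 * Real.log ((1 + Real.exp p) * (1 + Real.exp q)) = L
  generalize Real.exp σ - 1 = t
  generalize Real.exp q = x at *
  generalize Real.exp p = y at *
  field_simp
  ring

lemma dQ_expansionF : dQ expansionF = -24 * tF * aF - 12 * tF ^ 2 * (2 * aF' * bF - aF) +
    2 * tF ^ 3 * (12 * bF * aF' - 2 * aF * aF' + 8 * aF * bF ^ 2 * aF' - 4 * aF) := by
  simp only [expansionF, map_add, map_sub, dirDeriv_mul, dirDeriv_ofNat, dirDeriv_pow,
    dirDeriv_one, dQ_tF, dQ_logF, dQ_aF, dQ_bF]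
  push_cast
  ring

lemma dP_expansionF : dP expansionF = -24 * tF * bF - 12 * tF ^ 2 * (2 * bF' * aF - bF) +
    2 * tF ^ 3 * (12 * aF * bF' - 2 * bF * bF' + 8 * bF * aF ^ 2 * bF' - 4 * bF) := by
  simp only [expansionF, map_add, map_sub, dirDeriv_mul, dirDeriv_ofNat, dirDeriv_pow,
    dirDeriv_one, dP_tF, dP_logF, dP_aF, dP_bF]
  push_cast
  ring

/-- The coincidence of gradients at third order, as an identity in a commutative ring in which
`σ ^ 4 = 0`. The letters stand for `s = σ / 12`, `a = tanh (q / 2)`, `b = tanh (p / 2)` with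
derivatives `h`, `k`, for the force `f` in `q` with derivatives `f1`, `f2`, the force `g` in `p`
with derivative `g1`, and `t = τ`. -/
lemma gradient_identity {R : Type*} [CommRing R] {s a b h k f f1 f2 g g1 t : R}
    (hs : s ^ 4 = 0) (ha : a ^ 2 = 1 - 2 * h) (hb : b ^ 2 = 1 - 2 * k)
    (hf : f = -24 * s * a + 288 * s ^ 3 * (a - a ^ 3))
    (hf1 : f1 = -24 * s * h + 288 * s ^ 3 * (1 - 3 * a ^ 2) * h)
    (hf2 : f2 = 24 * s * a * h + s ^ 3 * (-288 * a * h - 1728 * a * h ^ 2 + 864 * a ^ 3 * h))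
    (hg : g = -24 * s * b + 288 * s ^ 3 * (b - b ^ 3))
    (hg1 : g1 = -24 * s * k + 288 * s ^ 3 * (1 - 3 * b ^ 2) * k)
    (ht : t = 12 * s + 72 * s ^ 2 + 288 * s ^ 3) :
    12 * f - 6 * f1 * g + g ^ 2 * f2 + 2 * f * f1 * g1 =
      -24 * t * a - 12 * t ^ 2 * (2 * h * b - a) +
        2 * t ^ 3 * (12 * b * h - 2 * a * h + 8 * a * b ^ 2 * h - 4 * a) := by
  subst hf hf1 hf2 hg hg1 ht
  grind

lemma mk_eq_of_sub_mem {F G : Fam} (h : F - G ∈ vanish 4) :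
    Ideal.Quotient.mk (vanishIdeal 4) F = Ideal.Quotient.mk (vanishIdeal 4) G :=
  (Ideal.Quotient.mk_eq_mk_iff_sub_mem F G).2 h

/-- The derivatives in `q` of the Baker-Campbell-Hausdorff sum of degree three and of the explicit
expansion agree modulo `σ⁴`. -/
lemma dQ_sub_mem_vanish : dQ (12 * bchSum 3 - expansionF) ∈ vanish 4 := by
  rw [map_sub, dQ_twelve_bchSum_three, dQ_expansionF]
  refine (Ideal.Quotient.mk_eq_mk_iff_sub_mem (I := vanishIdeal 4) _ _).1 ?_
  have hf := forceQ_sub_mem_vanish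
  have hf1 := dirDeriv_mem_vanish hf 1 0
  have hf2 := dirDeriv_mem_vanish hf1 1 0
  have hg := forceP_sub_mem_vanish
  have hg1 := dirDeriv_mem_vanish hg 0 1
  have e1 : dQ (-24 * sF * aF + 288 * sF ^ 3 * (aF - aF ^ 3)) =
      -24 * sF * aF' + 288 * sF ^ 3 * (1 - 3 * aF ^ 2) * aF' := by
    simp only [map_add, map_sub, dirDeriv_mul, _root_.map_neg, dirDeriv_ofNat, dirDeriv_pow,
      dQ_sF, dQ_aF]
    push_cast; ring
  have e2 : dQ (-24 * sF * aF' + 288 * sF ^ 3 * (1 - 3 * aF ^ 2) * aF') =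
      24 * sF * aF * aF' + sF ^ 3 * (-288 * aF * aF' - 1728 * aF * aF' ^ 2 +
        864 * aF ^ 3 * aF') := by
    simp only [map_add, map_sub, dirDeriv_mul, _root_.map_neg, dirDeriv_ofNat, dirDeriv_pow,
      dQ_sF, dQ_aF, dQ_aF', dirDeriv_one]
    push_cast; ring
  have e3 : dP (-24 * sF * bF + 288 * sF ^ 3 * (bF - bF ^ 3)) =
      -24 * sF * bF' + 288 * sF ^ 3 * (1 - 3 * bF ^ 2) * bF' := by
    simp only [map_add, map_sub, dirDeriv_mul, _root_.map_neg, dirDeriv_ofNat, dirDeriv_pow,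
      dP_sF, dP_bF]
    push_cast; ring
  rw [map_sub, map_sub, e1, e2] at hf2
  rw [map_sub, e1] at hf1
  rw [map_sub, e3] at hg1
  have m0 := mk_eq_of_sub_mem hf
  have m1 := mk_eq_of_sub_mem hf1
  have m2 := mk_eq_of_sub_mem hf2
  have m3 := mk_eq_of_sub_mem hg
  have m4 := mk_eq_of_sub_mem hg1
  have m5 := mk_eq_of_sub_mem tF_sub_mem_vanish
  have m6 := mk_eq_of_sub_mem (F := sF ^ 4) (G := 0)
    (by rw [sub_zero]; exact pow_four_mem_vanish sF_mem_vanish)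
  have m7 := congrArg (Ideal.Quotient.mk (vanishIdeal 4)) aF_sq
  have m8 := congrArg (Ideal.Quotient.mk (vanishIdeal 4)) bF_sq
  simp only [map_add, map_sub, map_mul, map_pow, _root_.map_neg, map_one, map_zero,
    map_ofNat] at m0 m1 m2 m3 m4 m5 m6 m7 m8 ⊢
  exact gradient_identity m6 m7 m8 m0 m1 m2 m3 m4 m5

/-- The derivatives in `p` agree by the same identity, which is symmetric under the exchange of
`q` and `p`. -/
lemma dP_sub_mem_vanish : dP (12 * bchSum 3 - expansionF) ∈ vanish 4 := by
  rw [map_sub, dP_twelve_bchSum_three, dP_expansionF]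
  refine (Ideal.Quotient.mk_eq_mk_iff_sub_mem (I := vanishIdeal 4) _ _).1 ?_
  have hf := forceP_sub_mem_vanish
  have hf1 := dirDeriv_mem_vanish hf 0 1
  have hf2 := dirDeriv_mem_vanish hf1 0 1
  have hg := forceQ_sub_mem_vanish
  have hg1 := dirDeriv_mem_vanish hg 1 0
  have e1 : dP (-24 * sF * bF + 288 * sF ^ 3 * (bF - bF ^ 3)) =
      -24 * sF * bF' + 288 * sF ^ 3 * (1 - 3 * bF ^ 2) * bF' := by
    simp only [map_add, map_sub, dirDeriv_mul, _root_.map_neg, dirDeriv_ofNat, dirDeriv_pow,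
      dP_sF, dP_bF]
    push_cast; ring
  have e2 : dP (-24 * sF * bF' + 288 * sF ^ 3 * (1 - 3 * bF ^ 2) * bF') =
      24 * sF * bF * bF' + sF ^ 3 * (-288 * bF * bF' - 1728 * bF * bF' ^ 2 +
        864 * bF ^ 3 * bF') := by
    simp only [map_add, map_sub, dirDeriv_mul, _root_.map_neg, dirDeriv_ofNat, dirDeriv_pow,
      dP_sF, dP_bF, dP_bF', dirDeriv_one]
    push_cast; ring
  have e3 : dQ (-24 * sF * aF + 288 * sF ^ 3 * (aF - aF ^ 3)) =
      -24 * sF * aF' + 288 * sF ^ 3 * (1 - 3 * aF ^ 2) * aF' := by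
    simp only [map_add, map_sub, dirDeriv_mul, _root_.map_neg, dirDeriv_ofNat, dirDeriv_pow,
      dQ_sF, dQ_aF]
    push_cast; ring
  rw [map_sub, map_sub, e1, e2] at hf2
  rw [map_sub, e1] at hf1
  rw [map_sub, e3] at hg1
  have m0 := mk_eq_of_sub_mem hf
  have m1 := mk_eq_of_sub_mem hf1
  have m2 := mk_eq_of_sub_mem hf2
  have m3 := mk_eq_of_sub_mem hg
  have m4 := mk_eq_of_sub_mem hg1
  have m5 := mk_eq_of_sub_mem tF_sub_mem_vanish
  have m6 := mk_eq_of_sub_mem (F := sF ^ 4) (G := 0)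
    (by rw [sub_zero]; exact pow_four_mem_vanish sF_mem_vanish)
  have m7 := congrArg (Ideal.Quotient.mk (vanishIdeal 4)) aF_sq
  have m8 := congrArg (Ideal.Quotient.mk (vanishIdeal 4)) bF_sq
  simp only [map_add, map_sub, map_mul, map_pow, _root_.map_neg, map_one, map_zero,
    map_ofNat] at m0 m1 m2 m3 m4 m5 m6 m7 m8 ⊢
  exact gradient_identity m6 m8 m7 m0 m1 m2 m3 m4 m5

/-- The Baker-Campbell-Hausdorff sum of degree three agrees with the explicit expansion up to
fourth order and a function of the parameter. -/
theorem isBigO_bchSum_three_sub_expansionQP (z z₁ : ℝ × ℝ) :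
    (fun w : ℝ × ℝ × ℝ => (bchSum 3 w - expansionQP (Real.exp w.1 - 1) w.2) -
      (bchSum 3 (w.1, z₁) - expansionQP (Real.exp w.1 - 1) z₁))
      =O[𝓝 ((0 : ℝ), z)] fun w => w.1 ^ 4 := by
  have h := isBigO_sub_of_gradient
    (G := fun w => (12 * bchSum 3 - expansionF : Fam) w) isPreconnected_univ
    (fun z _ => Eventually.of_forall fun w => hasFDerivAt_grad (12 * bchSum 3 - expansionF) w)
    (fun z _ => isBigO_of_partials (isBigO_of_mem_vanish dQ_sub_mem_vanish z)
      (isBigO_of_mem_vanish dP_sub_mem_vanish z)) (Set.mem_univ z) (Set.mem_univ z₁)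
  refine (h.const_mul_left (1 / 12)).congr_left fun w => ?_
  simp only [sub_apply, mul_apply, ofNat_apply]
  rw [← Prod.mk.eta (p := w), expansionF_apply, expansionF_apply]
  ring

end Fam

namespace Fam

/-! ### The third order expansion in the invariant -/

/-- Twice the relative deviation of `P + 4` from its value at `ρ = 1`, where `P` is the
invariant. -/
def devF : Fam := 2 * tF * (aF' + bF' - 2 * aF' * bF') +
  (2 * tF + tF ^ 2) * ((1 - aF') * (1 - bF') + aF * bF)

lemma devF_mem_vanish : devF ∈ vanish 1 := by
  rw [show devF = tF * (2 * (aF' + bF' - 2 * aF' * bF') +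
    (2 + tF) * ((1 - aF') * (1 - bF') + aF * bF)) by rw [devF]; ring]
  exact mul_mem_vanish tF_mem_vanish (mem_vanish_zero _)

lemma exp_logF_apply (w : ℝ × ℝ × ℝ) :
    Real.exp (logF w) = aF' w * bF' w / 4 := by
  obtain ⟨σ, q, p⟩ := w
  have hl : logF (σ, q, p) = p + q - 2 * Real.log ((1 + Real.exp p) * (1 + Real.exp q)) := rfl
  have ha : aF (σ, q, p) = (Real.exp q - 1) / (Real.exp q + 1) := rfl
  have hb : bF (σ, q, p) = (Real.exp p - 1) / (Real.exp p + 1) := rfl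
  have e1 := Real.exp_pos q
  have e2 := Real.exp_pos p
  rw [hl, Real.exp_sub, Real.exp_add, two_mul, Real.exp_add, Real.exp_log (by positivity), aF', bF',
    smul_apply, smul_apply, sub_apply, sub_apply, pow_apply, pow_apply, one_apply, ha, hb]
  field_simp
  ring

lemma energy_add_four_mul (w : ℝ × ℝ × ℝ) :
    2 * ((energy w + 4) * Real.exp (logF w)) = 2 + devF w := by
  rw [exp_logF_apply]
  obtain ⟨σ, q, p⟩ := w
  have ht : tF (σ, q, p) = Real.exp σ - 1 := rfl
  have ha : aF (σ, q, p) = (Real.exp q - 1) / (Real.exp q + 1) := rfl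
  have hb : bF (σ, q, p) = (Real.exp p - 1) / (Real.exp p + 1) := rfl
  have e1 := Real.exp_pos q
  have e2 := Real.exp_pos p
  rw [energy_apply, invariant]
  simp only [devF, aF', bF', add_apply, sub_apply, mul_apply, smul_apply, pow_apply, one_apply,
    ofNat_apply, ht, ha, hb, Real.exp_sub, Real.exp_add, neg_add, Real.exp_neg]
  generalize Real.exp q = x at *
  generalize Real.exp p = y at *
  generalize Real.exp σ = r
  field_simp
  ring

lemma energy_add_four_pos (w : ℝ × ℝ × ℝ) : 0 < energy w + 4 := by
  have := abs_le_invariant (Real.exp_pos w.1) w.2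
  rw [energy_apply]
  have h2 : 0 ≤ 2 * Real.exp w.1 * ‖w.2‖ := by positivity
  linarith

lemma two_add_devF_pos (w : ℝ × ℝ × ℝ) : 0 < 2 + devF w := by
  rw [← energy_add_four_mul]
  have := energy_add_four_pos w
  positivity

/-- The reciprocal of the ratio `(2 + devF) / 2` of `P + 4` to its value at `ρ = 1`. -/
def recF : Fam := ⟨fun w => 2 / (2 + devF w),
  contDiff_const.div (contDiff_const.add devF.contDiff) fun w => (two_add_devF_pos w).ne'⟩

lemma recF_mul : recF * (2 + devF) = 2 := ext fun w => by
  rw [mul_apply, add_apply, ofNat_apply]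
  exact div_mul_cancel₀ _ (two_add_devF_pos w).ne'

/-- The logarithm of the ratio `(2 + devF) / 2` of `P + 4` to its value at `ρ = 1`. -/
def logDevF : Fam := ⟨fun w => Real.log ((2 + devF w) / 2),
  ((contDiff_const.add devF.contDiff).div_const 2).log fun w =>
    (div_pos (two_add_devF_pos w) two_pos).ne'⟩

lemma two_mul_dS_logDevF : 2 * dS logDevF = dS devF * recF := ext fun ⟨σ, z⟩ => by
  have h0 := two_add_devF_pos (σ, z)
  have h := dS_apply_eq (F := logDevF) ((((devF.hasDerivAt_dS σ z).const_add 2).div_const 2).log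
    (div_pos h0 two_pos).ne')
  rw [mul_apply, ofNat_apply, h, mul_apply]
  change _ = dS devF (σ, z) * (2 / (2 + devF (σ, z)))
  field_simp

lemma logDevF_expansion : 8 * logDevF - 4 * devF + devF ^ 2 ∈ vanish 3 := by
  refine ⟨fun z => ?_, ?_⟩
  · have h0 : devF (0, z) = 0 := devF_mem_vanish.1 z
    have h1 : logDevF (0, z) = Real.log ((2 + devF (0, z)) / 2) := rfl
    simp only [add_apply, sub_apply, mul_apply, pow_apply, h1, h0]
    norm_num
  · have h : dS (8 * logDevF - 4 * devF + devF ^ 2) = devF * devF * (dS devF * recF) := by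
      simp only [map_add, map_sub, dirDeriv_mul, dirDeriv_ofNat, dirDeriv_pow]
      push_cast
      linear_combination 4 * two_mul_dS_logDevF + dS devF * (2 - devF) * recF_mul
    rw [h]
    exact mul_mem_vanish (mul_mem_vanish devF_mem_vanish devF_mem_vanish) (mem_vanish_zero _)

/-- The coincidence of the two explicit expansions, as an identity in a commutative ring in which
`τ ^ 4 = 0`. The letters stand for `t = τ`, `a = tanh (q / 2)`, `b = tanh (p / 2)` with derivatives
`h`, `k`, and for `x`, `r`, `l` as `devF`, `recF`, `logDevF`. -/
lemma expansion_identity {R : Type*} [CommRing R] {t a b h k x r l : R}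
    (ht : t ^ 4 = 0) (ha : a ^ 2 = 1 - 2 * h) (hb : b ^ 2 = 1 - 2 * k)
    (hx : x = 2 * t * (h + k - 2 * h * k) + (2 * t + t ^ 2) * ((1 - h) * (1 - k) + a * b))
    (hr : r * (2 + x) = 2) (hl : (6 * t - 3 * t ^ 2 + 2 * t ^ 3) * (8 * l - 4 * x + x ^ 2) = 0) :
    4 * (-4 * (6 * t - 3 * t ^ 2 + 2 * t ^ 3) * l - 24 * t ^ 2 * r * h * k
      + 8 * t ^ 3 * r * h * k + 12 * t ^ 3 * r ^ 2 * h ^ 2 * k ^ 2 + 24 * t ^ 2 * (1 + a * b)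
      - 2 * t ^ 3 * (3 * (1 - a ^ 2 * b ^ 2) + 3 * ((1 + a * b) ^ 2 + (a + b) ^ 2) +
        4 * (1 - a ^ 2) * (1 - b ^ 2))) = 0 := by
  obtain ⟨y, hy, hxy⟩ : ∃ y, y = 2 * (h + k - 2 * h * k) + (2 + t) * ((1 - h) * (1 - k) + a * b) ∧
      x = t * y := ⟨_, rfl, by rw [hx]; ring⟩
  subst hxy
  have h1 : 2 * t ^ 3 * r = 2 * t ^ 3 := by linear_combination t ^ 3 * hr - r * y * ht
  have h2 : 4 * t ^ 2 * r = 4 * t ^ 2 - 2 * t ^ 3 * y := by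
    linear_combination 2 * t ^ 2 * hr - y * h1
  have h3 : 2 * t ^ 3 * r ^ 2 = 2 * t ^ 3 := by linear_combination (r + 1) * h1
  have h4 : (6 * t - 3 * t ^ 2 + 2 * t ^ 3) * (4 * (t * y) - (t * y) ^ 2) =
      24 * t ^ 2 * y - 12 * t ^ 3 * y - 6 * t ^ 3 * y ^ 2 := by
    linear_combination (8 * y + 3 * y ^ 2 - 2 * y ^ 2 * t) * ht
  have h5 : -2 * (24 * t ^ 2 * y - 12 * t ^ 3 * y - 6 * t ^ 3 * y ^ 2)
      - 24 * (4 * t ^ 2 - 2 * t ^ 3 * y) * h * k + 32 * t ^ 3 * h * k + 48 * t ^ 3 * h ^ 2 * k ^ 2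
      + 96 * t ^ 2 * (1 + a * b) - 8 * t ^ 3 * (3 * (1 - a ^ 2 * b ^ 2) +
        3 * ((1 + a * b) ^ 2 + (a + b) ^ 2) + 4 * (1 - a ^ 2) * (1 - b ^ 2)) = 0 := by
    clear h1 h2 h3 h4 hl hr hx
    subst hy
    grind
  linear_combination h5 - 24 * h * k * h2 + 16 * h * k * h1 + 24 * h ^ 2 * k ^ 2 * h3
    - 2 * h4 - 2 * hl

/-- Twelve times the difference of the two explicit expansions. -/
def expansionDiffF : Fam := -4 * (6 * tF - 3 * tF ^ 2 + 2 * tF ^ 3) * logDevF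
  - 24 * tF ^ 2 * recF * aF' * bF' + 8 * tF ^ 3 * recF * aF' * bF'
  + 12 * tF ^ 3 * recF ^ 2 * aF' ^ 2 * bF' ^ 2 + 24 * tF ^ 2 * (1 + aF * bF)
  - 2 * tF ^ 3 * (3 * (1 - aF ^ 2 * bF ^ 2) + 3 * ((1 + aF * bF) ^ 2 + (aF + bF) ^ 2) +
    4 * (1 - aF ^ 2) * (1 - bF ^ 2))

lemma four_mul_expansionDiffF_mem_vanish : 4 * expansionDiffF ∈ vanish 4 := by
  have h0 : 6 * tF - 3 * tF ^ 2 + 2 * tF ^ 3 ∈ vanish 1 := by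
    rw [show 6 * tF - 3 * tF ^ 2 + 2 * tF ^ 3 = tF * (6 - 3 * tF + 2 * tF ^ 2) by ring]
    exact mul_mem_vanish tF_mem_vanish (mem_vanish_zero _)
  have h1 := mul_mem_vanish h0 logDevF_expansion
  rw [← sub_zero (4 * expansionDiffF)]
  refine (Ideal.Quotient.mk_eq_mk_iff_sub_mem (I := vanishIdeal 4) _ _).1 ?_
  have m1 := mk_eq_of_sub_mem (G := 0) (by rw [sub_zero]; exact h1)
  have m2 := mk_eq_of_sub_mem (F := tF ^ 4) (G := 0)
    (by rw [sub_zero]; exact pow_four_mem_vanish tF_mem_vanish)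
  have m3 := congrArg (Ideal.Quotient.mk (vanishIdeal 4)) aF_sq
  have m4 := congrArg (Ideal.Quotient.mk (vanishIdeal 4)) bF_sq
  have m5 := congrArg (Ideal.Quotient.mk (vanishIdeal 4)) recF_mul
  have e6 : devF = 2 * tF * (aF' + bF' - 2 * aF' * bF') +
      (2 * tF + tF ^ 2) * ((1 - aF') * (1 - bF') + aF * bF) := rfl
  have m6 := congrArg (Ideal.Quotient.mk (vanishIdeal 4)) e6
  simp only [expansionDiffF, map_add, map_sub, map_mul, map_pow, _root_.map_neg, map_one, map_zero,
    map_ofNat] at m1 m2 m3 m4 m5 m6 ⊢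
  exact expansion_identity m2 m3 m4 m6 m5 m1

lemma expansionDiffF_apply (w : ℝ × ℝ × ℝ) : expansionDiffF w =
    12 * (expansionP (Real.exp w.1 - 1) (energy w) - expansionQP (Real.exp w.1 - 1) w.2) := by
  have hpos := energy_add_four_pos w
  have hd := energy_add_four_mul w
  have hlog : Real.log (energy w + 4) = logDevF w - logF w := by
    have : logDevF w = Real.log ((2 + devF w) / 2) := rfl
    rw [this, ← hd, mul_div_cancel_left₀ _ two_ne_zero, Real.log_mul hpos.ne'
      (Real.exp_pos _).ne', Real.log_exp]
    ring
  have hinv : 1 / (energy w + 4) = recF w * (aF' w * bF' w / 4) := by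
    have h1 : recF w = 2 / (2 + devF w) := rfl
    rw [h1, ← hd, ← exp_logF_apply]
    have := Real.exp_pos (logF w)
    field_simp
  have hE := expansionF_apply w.1 w.2
  have hP : expansionP (Real.exp w.1 - 1) (energy w) =
      -2 * tF w * Real.log (energy w + 4)
        + tF w ^ 2 * (Real.log (energy w + 4) - 8 * (1 / (energy w + 4)))
        - 2 * tF w ^ 3 / 3 * (Real.log (energy w + 4) - 4 * (1 / (energy w + 4))
          - 24 * (1 / (energy w + 4)) ^ 2) := by
    have ht : tF w = Real.exp w.1 - 1 := rfl
    rw [expansionP, ht, div_pow, one_pow]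
    ring
  rw [mul_sub, ← hE, hP, hlog, hinv]
  simp only [expansionDiffF, expansionF, add_apply, sub_apply, mul_apply, neg_apply, pow_apply,
    one_apply, ofNat_apply]
  ring

theorem isBigO_expansionP_sub_expansionQP (z : ℝ × ℝ) :
    (fun w : ℝ × ℝ × ℝ => expansionP (Real.exp w.1 - 1) (energy w) -
      expansionQP (Real.exp w.1 - 1) w.2) =O[𝓝 ((0 : ℝ), z)] fun w => w.1 ^ 4 := by
  refine ((isBigO_of_mem_vanish four_mul_expansionDiffF_mem_vanish z).const_mul_left
    (1 / 48)).congr_left fun w => ?_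
  rw [mul_apply, ofNat_apply, expansionDiffF_apply]
  ring

end Fam

/-! ### The asymptotic expansions in `τ` -/

/-- The point at which the integration constants of the expansions are fixed. -/
def normPoint : ℝ × ℝ := (0, 1)

lemma normPoint_ne_zero : normPoint ≠ 0 := fun h => one_ne_zero (congrArg Prod.snd h)

namespace Fam

/-- Passage from the parameter `σ = log ρ` to `τ = ρ - 1`. -/
lemma isBigO_of_isBigO_log {f : ℝ × ℝ × ℝ → ℝ} {g : ℝ → ℝ} {z : ℝ × ℝ} {m : ℕ}
    (h : f =O[𝓝 ((0 : ℝ), z)] fun w => w.1 ^ m) (hg : ∀ σ, f (σ, z) = g (Real.exp σ - 1)) :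
    g =O[𝓝 0] fun τ => τ ^ m := by
  have hd : HasDerivAt (fun τ : ℝ => Real.log (1 + τ)) 1 0 := by
    simpa using ((hasDerivAt_id (0 : ℝ)).const_add 1).log (by simp)
  have hO : (fun τ : ℝ => Real.log (1 + τ)) =O[𝓝 0] fun τ => τ := by
    simpa using hd.isBigO_sub
  have ht : Tendsto (fun τ : ℝ => (Real.log (1 + τ), z)) (𝓝 0) (𝓝 ((0 : ℝ), z)) := by
    have := hd.continuousAt.tendsto.prodMk_nhds (tendsto_const_nhds (x := z))
    simpa using this
  refine ((h.comp_tendsto ht).trans (hO.pow m)).congr' ?_ EventuallyEq.rfl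
  filter_upwards [lt_mem_nhds (show (-1 : ℝ) < 0 by norm_num)] with τ hτ
  rw [Function.comp_apply, hg, Real.exp_log (by linarith)]
  congr 1
  ring

lemma tendsto_const_point (z z₁ : ℝ × ℝ) :
    Tendsto (fun w : ℝ × ℝ × ℝ => (w.1, z₁)) (𝓝 ((0 : ℝ), z)) (𝓝 ((0 : ℝ), z₁)) :=
  (continuous_fst.prodMk continuous_const).tendsto' _ _ rfl

lemma eventually_modifiedHam_normPoint (z : ℝ × ℝ) : ∀ᶠ w in 𝓝 ((0 : ℝ), z),
    modifiedHam normPoint (Real.exp w.1) (energy (w.1, normPoint)) =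
      expansionQP (Real.exp w.1 - 1) normPoint :=
  ((tendsto_const_point z normPoint).eventually
    (eventually_energy_mem normPoint_ne_zero)).mono fun _ hw => modifiedHam_invariant hw

theorem isBigO_modifiedHam_sub_expansionQP {z : ℝ × ℝ} (hz : z ≠ 0) :
    (fun w : ℝ × ℝ × ℝ => modifiedHam normPoint (Real.exp w.1) (energy w) -
      expansionQP (Real.exp w.1 - 1) w.2) =O[𝓝 ((0 : ℝ), z)] fun w => w.1 ^ 4 := by
  have h1 := isBigO_antiderivative_sub_bchSum
    (fun ρ hρ => isFrequencyAntiderivative_modifiedHam normPoint hρ) (N := 3) (by norm_num) hz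
    normPoint_ne_zero
  refine ((isBigO_bchSum_three_sub_expansionQP z normPoint).sub h1).congr' ?_ EventuallyEq.rfl
  filter_upwards [eventually_modifiedHam_normPoint z] with w hw
  rw [hw]
  ring

/-- For fixed `P`, both expansions are compared at the starting point of the level curve. -/
theorem isBigO_modifiedHam_sub_expansionP {P : ℝ} (hP : 12 < P) :
    (fun w : ℝ × ℝ × ℝ => modifiedHam normPoint (Real.exp w.1) P -
      expansionP (Real.exp w.1 - 1) P) =O[𝓝 0] fun w => w.1 ^ 4 := by
  have ht : Tendsto (fun w : ℝ × ℝ × ℝ => (w.1, startPoint (Real.exp w.1) P)) (𝓝 0)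
      (𝓝 ((0 : ℝ), startPoint 1 P)) := by
    have h1 : Tendsto (fun w : ℝ × ℝ × ℝ => w.1) (𝓝 0) (𝓝 0) := continuous_fst.tendsto' _ _ rfl
    exact h1.prodMk_nhds ((tendsto_startPoint hP).comp h1)
  have h1 := (isBigO_modifiedHam_sub_expansionQP (startPoint_one_ne_zero hP)).sub
    (isBigO_expansionP_sub_expansionQP (startPoint 1 P))
  have hc : Continuous fun w : ℝ × ℝ × ℝ =>
      2 * Real.exp w.1 ^ 2 + 8 * Real.exp w.1 + 2 := by fun_prop
  refine (h1.comp_tendsto ht).congr' ?_ EventuallyEq.rfl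
  filter_upwards [(hc.tendsto 0).eventually_lt_const (u := P) (by norm_num; exact hP)] with w hw
  have hE : energy (w.1, startPoint (Real.exp w.1) P) = P :=
    invariant_startPoint (Real.exp_pos _) hw
  simp only [Function.comp_apply, hE]
  ring

theorem isBigO_modifiedHam_sub_bchSum (N : ℕ) {z : ℝ × ℝ} (hz : z ≠ 0) :
    (fun w : ℝ × ℝ × ℝ => (modifiedHam normPoint (Real.exp w.1) (energy w) - bchSum N w) -
      (modifiedHam normPoint (Real.exp w.1) (energy (w.1, normPoint)) -
        bchSum N (w.1, normPoint))) =O[𝓝 ((0 : ℝ), z)] fun w => w.1 ^ (N + 1) := by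
  have key : ∀ M, 1 ≤ M → _ := fun M hM => isBigO_antiderivative_sub_bchSum
    (fun ρ hρ => isFrequencyAntiderivative_modifiedHam normPoint hρ) (N := M) hM hz
    normPoint_ne_zero
  rcases Nat.eq_zero_or_pos N with rfl | hN
  · -- For `N = 0` the assertion follows from the case `N = 1`, as the term of degree one is `O(τ)`.
    have h1 : (fun w : ℝ × ℝ × ℝ => w.1 ^ (1 + 1)) =O[𝓝 ((0 : ℝ), z)] fun w => w.1 ^ (0 + 1) := by
      have h2 : (fun w : ℝ × ℝ × ℝ => w.1) =O[𝓝 ((0 : ℝ), z)] fun _ => (1 : ℝ) :=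
        continuous_fst.continuousAt.isBigO_one ℝ
      exact (h2.mul (isBigO_refl (fun w : ℝ × ℝ × ℝ => w.1) _)).congr (fun w => by ring)
        fun w => by ring
    have h3 : ∀ N, bchSum N ∈ vanish (0 + 1) := bchSum_mem_vanish
    have h4 := fun N => (isBigO_of_mem_vanish (h3 N) normPoint).comp_tendsto
      (tendsto_const_point z normPoint)
    have h5 := fun N => (isBigO_of_mem_vanish (h3 N) z).sub (h4 N)
    exact (((h5 1).sub (h5 0)).sub ((key 1 le_rfl).trans h1)).congr_left fun w => by
      simp only [Function.comp_apply]
      ring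
  · exact (key N hN).neg_left.congr_left fun w => by ring

end Fam

theorem isBigO_bchPartialSum_three_sub_expansionQP (z : ℝ × ℝ) :
    (fun τ : ℝ => bchPartialSum 3 τ z - expansionQP τ z -
      (bchPartialSum 3 τ normPoint - expansionQP τ normPoint)) =O[𝓝 0] fun τ => τ ^ 4 :=
  Fam.isBigO_of_isBigO_log (Fam.isBigO_bchSum_three_sub_expansionQP z normPoint) fun σ => by
    simp only [Fam.bchSum_apply]

theorem isBigO_modifiedHam_one_add_sub_expansionP {P : ℝ} (hP : 12 < P) :
    (fun τ : ℝ => modifiedHam normPoint (1 + τ) P - expansionP τ P) =O[𝓝 0] fun τ => τ ^ 4 :=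
  Fam.isBigO_of_isBigO_log (z := 0) (Fam.isBigO_modifiedHam_sub_expansionP hP) fun σ => by
    simp only [add_sub_cancel]

theorem isBigO_modifiedHam_invariant_sub_expansionQP {z : ℝ × ℝ} (hz : z ≠ 0) :
    (fun τ : ℝ => modifiedHam normPoint (1 + τ) (invariant (1 + τ) z) - expansionQP τ z)
      =O[𝓝 0] fun τ => τ ^ 4 :=
  Fam.isBigO_of_isBigO_log (Fam.isBigO_modifiedHam_sub_expansionQP hz) fun σ => by
    simp only [add_sub_cancel, Fam.energy_apply]

theorem isBigO_modifiedHam_invariant_sub_bchPartialSum (N : ℕ) {z : ℝ × ℝ} (hz : z ≠ 0) :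
    (fun τ : ℝ => modifiedHam normPoint (1 + τ) (invariant (1 + τ) z) - bchPartialSum N τ z -
      (modifiedHam normPoint (1 + τ) (invariant (1 + τ) normPoint) -
        bchPartialSum N τ normPoint)) =O[𝓝 0] fun τ => τ ^ (N + 1) :=
  Fam.isBigO_of_isBigO_log (Fam.isBigO_modifiedHam_sub_bchSum N hz) fun σ => by
    simp only [add_sub_cancel, Fam.energy_apply, Fam.bchSum_apply]

end MKdV

end

theorem mainTheorem2 :
    (∀ ρ : ℝ, 0 < ρ →
      -- the map is the period-two reduction
      (∀ X Y X' Y' : ℤ → ℝ, MKdV.PeriodTwo X Y → MKdV.PeriodTwo X' Y' →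
        (MKdV.ReducedMap ρ X Y X' Y' ↔ MKdV.map ρ (Y 1, X 1) = (Y' 1, X' 1))) ∧
      -- it is a canonical transformation
      (ContDiff ℝ ∞ (MKdV.map ρ) ∧ Function.Bijective (MKdV.map ρ) ∧
        ∀ z u v : ℝ × ℝ,
          MKdV.symplecticForm (fderiv ℝ (MKdV.map ρ) z u) (fderiv ℝ (MKdV.map ρ) z v) =
            MKdV.symplecticForm u v) ∧
      -- with generating function `H`, through the discrete Hamilton equations
      ContDiff ℝ ∞ (fun w : ℝ × ℝ => MKdV.genFun ρ w.1 w.2) ∧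
      (∀ q p q' p' : ℝ, MKdV.map ρ (q, p) = (q', p') ↔
        (p' - p = -deriv (fun s => MKdV.genFun ρ s p') q ∧
          q' - q = deriv (fun s => MKdV.genFun ρ q s) p')) ∧
      -- which is expressed by dilogarithms
      (∀ x : ℝ, MKdV.potential ρ x =
        2 * (x * Real.log ρ
          - MKdV.dilog (-Real.exp x / ρ) + MKdV.dilog (-ρ * Real.exp x)
          + MKdV.dilog (-1 / ρ) - MKdV.dilog (-ρ))) ∧
      -- the invariant
      (∀ z : ℝ × ℝ, MKdV.invariant ρ (MKdV.map ρ z) = MKdV.invariant ρ z) ∧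
      -- the domain of the closed form
      (ρ + 1 / ρ ≤ 6 → ∀ z : ℝ × ℝ, z ≠ 0 → MKdV.invariant ρ z ∈ MKdV.energyDomain ρ) ∧
      -- the starting point `q = 0` and the elliptic integral
      (∀ P ∈ MKdV.energyDomain ρ,
        0 < MKdV.Delta ρ P ∧ MKdV.Delta ρ P < 1 ∧
        MKdV.invariant ρ (0, Real.log (MKdV.Delta ρ P)) = P ∧
        (MKdV.map ρ (0, Real.log (MKdV.Delta ρ P))).1 = MKdV.qStep ρ P ∧
        ∀ q ∈ Set.uIcc 0 (MKdV.qStep ρ P), 0 < MKdV.radicand ρ P q) ∧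
      -- the frequency is `∫ ∂p/∂P dq` over one step, from any starting point
      (∀ z : ℝ × ℝ,
        MKdV.dp (MKdV.invariant ρ) z ^ 2 = MKdV.radicand ρ (MKdV.invariant ρ z) z.1) ∧
      (∀ z : ℝ × ℝ, MKdV.invariant ρ z ∈ MKdV.energyDomain ρ →
        0 < MKdV.dp (MKdV.invariant ρ) z * MKdV.dp (MKdV.invariant ρ) (MKdV.map ρ z) →
        Real.sign (MKdV.dp (MKdV.invariant ρ) z) *
            ∫ q in z.1..(MKdV.map ρ z).1, 1 / √(MKdV.radicand ρ (MKdV.invariant ρ z) q) =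
          MKdV.frequency ρ (MKdV.invariant ρ z)) ∧
      -- every antiderivative of the frequency is a modified Hamiltonian: its Hamiltonian flow
      -- interpolates the map
      (∀ h : ℝ → ℝ, MKdV.IsFrequencyAntiderivative ρ h →
        ∀ z : ℝ × ℝ, MKdV.invariant ρ z ∈ MKdV.energyDomain ρ →
          ∃ γ : ℝ → ℝ × ℝ,
            MKdV.IsHamiltonianTrajectory (fun w => h (MKdV.invariant ρ w)) γ ∧
            γ 0 = z ∧ ∀ t, γ (t + 1) = MKdV.map ρ (γ t))) ∧
    -- the Baker-Campbell-Hausdorff series to third order, up to a function of `τ`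
    (∃ c : ℝ → ℝ, ∀ z : ℝ × ℝ,
      (fun τ : ℝ => MKdV.bchPartialSum 3 τ z - MKdV.expansionQP τ z - c τ)
        =O[𝓝 0] fun τ => τ ^ 4) ∧
    -- the expansion of the closed form, with suitable integration constants
    (∃ Hs : ℝ → ℝ → ℝ,
      (∀ ρ : ℝ, 0 < ρ → MKdV.IsFrequencyAntiderivative ρ (Hs ρ)) ∧
      (∀ P : ℝ, 12 < P → Hs 1 P = 0) ∧
      (∀ P : ℝ, 12 < P →
        (fun τ : ℝ => Hs (1 + τ) P - MKdV.expansionP τ P) =O[𝓝 0] fun τ => τ ^ 4) ∧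
      (∀ z : ℝ × ℝ, z ≠ 0 →
        (fun τ : ℝ => Hs (1 + τ) (MKdV.invariant (1 + τ) z) - MKdV.expansionQP τ z)
          =O[𝓝 0] fun τ => τ ^ 4) ∧
      (∀ N : ℕ, ∃ c : ℝ → ℝ, ∀ z : ℝ × ℝ, z ≠ 0 →
        (fun τ : ℝ =>
          Hs (1 + τ) (MKdV.invariant (1 + τ) z) - MKdV.bchPartialSum N τ z - c τ)
          =O[𝓝 0] fun τ => τ ^ (N + 1))) := by
  refine ⟨fun ρ hρ => ⟨fun X Y X' Y' h h' => MKdV.reducedMap_iff hρ h h',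
    ⟨MKdV.contDiff_map hρ, MKdV.bijective_map ρ, MKdV.symplecticForm_fderiv_map hρ⟩,
    MKdV.contDiff_genFun hρ, MKdV.map_eq_iff_genFun hρ, MKdV.potential_eq_dilog hρ,
    MKdV.invariant_map hρ,
    fun h6 z hz => MKdV.mem_energyDomain_of_lt hρ h6 (MKdV.lt_invariant hρ hz),
    fun P hP => ⟨(MKdV.Delta_spec hρ hP.1).1, (MKdV.Delta_spec hρ hP.1).2.1,
      MKdV.invariant_startPoint hρ hP.1, congrArg Prod.fst (MKdV.map_startPoint hρ hP.1),
      fun q hq => MKdV.radicand_pos_of_mem_step hρ hP hq⟩,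
    fun z => by rw [MKdV.dp_invariant, MKdV.invariantP_sq],
    MKdV.sign_mul_time_eq_frequency hρ,
    fun h hh z hz => MKdV.exists_trajectory hρ hh z hz⟩,
    ⟨_, MKdV.isBigO_bchPartialSum_three_sub_expansionQP⟩,
    MKdV.modifiedHam MKdV.normPoint,
    fun ρ hρ => MKdV.isFrequencyAntiderivative_modifiedHam _ hρ,
    fun P _ => MKdV.modifiedHam_one _ P,
    fun P hP => MKdV.isBigO_modifiedHam_one_add_sub_expansionP hP,
    fun z hz => MKdV.isBigO_modifiedHam_invariant_sub_expansionQP hz,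
    fun N => ⟨_, fun z hz => MKdV.isBigO_modifiedHam_invariant_sub_bchPartialSum N hz⟩⟩
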